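/- Let $n\ge 1$, let $\Omega\subset\mathbb{R}^n$ be a bounded domain and let $0<\alpha\le 1$. For $p$ with $\alpha p>2n$ put $s=\alpha-n/p\in(0,1)$, and let $W_0^{s,p}(\Omega)$ be the closure of $C_0^\infty(\Omega)$ in the norm given by $\|u\|^p_{W^{s,p}(\Omega)}=\int_\Omega\int_\Omega\frac{|u(y)-u(x)|^p}{|y-x|^{sp+n}}\,dx\,dy+\int_\Omega|u|^p\,dx$, its elements being extended by zero to $\mathbb{R}^n$. Put $$Q_p(\phi)=\frac{\int_{\mathbb{R}^n}\int_{\mathbb{R}^n}\frac{|\phi(y)-\phi(x)|^p}{|y-x|^{\alpha p}}\,dx\,dy}{\int_{\mathbb{R}^n}|\phi|^p\,dx},\qquad \lambda_p=\inf\{Q_p(\phi):\ \phi\in C_0^\infty(\Omega),\ \phi\not\equiv0\}.$$ A first eigenfunction for the exponent $p$ is a function $u\in W_0^{s,p}(\Omega)$, $u\ge0$, $u\not\equiv0$, with $Q_p(u)=\lambda_p$. Let $C_0(\overline\Omega)$ be the set of continuous functions on $\mathbb{R}^n$ that vanish on $\mathbb{R}^n\setminus\Omega$. Put $$\mathcal{L}_\infty^{-}u(x)=\inf_{y\ne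 x}\frac{u(y)-u(x)}{|y-x|^\alpha},\qquad \mathcal{L}_\infty u(x)=\sup_{y\neq x}\frac{u(y)-u(x)}{|y-x|^\alpha}+\mathcal{L}_\infty^{-}u(x),\qquad \Lambda_\infty^\alpha=\Bigl(\max_{x\in\Omega}\operatorname{dist}(x,\mathbb{R}^n\setminus\Omega)\Bigr)^{-\alpha}.$$ A continuous, compactly supported function $u\ge 0$ on $\mathbb{R}^n$ is a viscosity solution in $\Omega$ of $$\max\{\mathcal{L}_\infty u,\ \mathcal{L}_\infty^{-}u+\Lambda_\infty^\alpha u\}=0\qquad(\ast)$$ if for every $x_0\in\Omega$: (i) whenever $\phi\in C_0^1(\mathbb{R}^n)$ (continuously differentiable with compact support), $\phi\le u$ on $\mathbb{R}^n$ and $\phi(x_0)=u(x_0)$, then $\mathcal{L}_\infty\phi(x_0)\le0$ and $\mathcal{L}_\infty^{-}\phi(x_0)+\Lambda_\infty^\alpha\phi(x_0)\le0$; (ii) whenever $\psi\in C_0^1(\mathbb{R}^n)$, $\psi\ge u$ on $\mathbb{R}^n$ and $\psi(x_0)=u(x_0)$, then $\mathcal{L}_\infty\psi(x_0)\ge0$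 or $\mathcal{L}_\infty^{-}\psi(x_0)+\Lambda_\infty^\alpha\psi(x_0)\ge0$. Theorem. Let $p_k\to\infty$ be a sequence of real numbers with $\alpha p_k>2n$ for all $k$, and for each $k$ let $u_k$ be a first eigenfunction for the exponent $p_k$, normalized by $\|u_k\|_{L^{p_k}(\mathbb{R}^n)}=1$. Then every $u_k$ agrees almost everywhere with a (unique) function in $C_0(\overline\Omega)$, again denoted by $u_k$, and there is a subsequence of $(u_k)$ that converges uniformly in $\Omega$ to a function $u\in C_0(\overline\Omega)$ which is a viscosity solution of $(\ast)$ in $\Omega$. -/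

import Mathlib

open MeasureTheory Filter Topology Set
open scoped ENNReal

/-- `φ ∈ C_0^∞(D)`: smooth with compact support contained in `D`. -/
def IsTestFunction {n : ℕ} (D : Set (EuclideanSpace ℝ (Fin n)))
    (φ : EuclideanSpace ℝ (Fin n) → ℝ) : Prop :=
  ContDiff ℝ ((⊤ : ℕ∞) : WithTop ℕ∞) φ ∧ HasCompactSupport φ ∧ tsupport φ ⊆ D

/-- The double integral `∫_D ∫_D |u(y) - u(x)|^p / |y - x|^b dy dx ∈ [0, ∞]`. -/
noncomputable def gagliardoEnergy {n : ℕ} (D : Set (EuclideanSpace ℝ (Fin n))) (p b : ℝ)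
    (u : EuclideanSpace ℝ (Fin n) → ℝ) : ℝ≥0∞ :=
  ∫⁻ x in D, ∫⁻ y in D, ENNReal.ofReal (|u y - u x| ^ p / ‖y - x‖ ^ b)

/-- The integral `∫_D |u|^p dx ∈ [0, ∞]`. -/
noncomputable def powerIntegral {n : ℕ} (D : Set (EuclideanSpace ℝ (Fin n))) (p : ℝ)
    (u : EuclideanSpace ℝ (Fin n) → ℝ) : ℝ≥0∞ :=
  ∫⁻ x in D, ENNReal.ofReal (|u x| ^ p)

/-- The `p`-th power of the norm of the fractional Sobolev space `W^{s,p}(D)`. -/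
noncomputable def fracSobolevNormPow {n : ℕ} (D : Set (EuclideanSpace ℝ (Fin n))) (s p : ℝ)
    (u : EuclideanSpace ℝ (Fin n) → ℝ) : ℝ≥0∞ :=
  gagliardoEnergy D p (s * p + n) u + powerIntegral D p u

/-- `u ∈ W^{s,p}(D)`. -/
def MemFracSobolev {n : ℕ} (D : Set (EuclideanSpace ℝ (Fin n))) (s p : ℝ)
    (u : EuclideanSpace ℝ (Fin n) → ℝ) : Prop :=
  AEStronglyMeasurable u (volume.restrict D) ∧ fracSobolevNormPow D s p u < ∞

/-- `u ∈ W_0^{s,p}(D)`: `u` lies in the closure of `C_0^∞(D)` in `W^{s,p}(D)`, and is extended by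
zero to the whole space. -/
def MemFracSobolevZero {n : ℕ} (D : Set (EuclideanSpace ℝ (Fin n))) (s p : ℝ)
    (u : EuclideanSpace ℝ (Fin n) → ℝ) : Prop :=
  MemFracSobolev D s p u ∧
    (∀ ε : ℝ≥0∞, 0 < ε → ∃ φ, IsTestFunction D φ ∧ fracSobolevNormPow D s p (u - φ) < ε) ∧
    ∀ᵐ x, x ∉ D → u x = 0

/-- The fractional Rayleigh quotient, with both integrals taken over the whole space. -/
noncomputable def rayleighQuotient {n : ℕ} (α p : ℝ)
    (u : EuclideanSpace ℝ (Fin n) → ℝ) : ℝ≥0∞ :=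
  gagliardoEnergy univ p (α * p) u / powerIntegral univ p u

/-- The first eigenvalue `λ₁`: the infimum of the Rayleigh quotient over all `φ ∈ C_0^∞(Ω)`,
`φ ≢ 0`. -/
noncomputable def firstEigenvalue {n : ℕ} (Ω : Set (EuclideanSpace ℝ (Fin n))) (α p : ℝ) : ℝ≥0∞ :=
  sInf {r | ∃ φ, IsTestFunction Ω φ ∧ φ ≠ 0 ∧ r = rayleighQuotient α p φ}

/-- A first eigenfunction: a non-negative `u ∈ W_0^{s,p}(Ω)`, `s = α - n/p`, `u ≢ 0`, whose
Rayleigh quotient is the minimum value `λ₁`.  As an element of the Sobolev space, `u` is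
only determined almost everywhere. -/
def IsFirstEigenfunction {n : ℕ} (Ω : Set (EuclideanSpace ℝ (Fin n))) (α p : ℝ)
    (u : EuclideanSpace ℝ (Fin n) → ℝ) : Prop :=
  MemFracSobolevZero Ω (α - n / p) p u ∧ (∀ᵐ x, 0 ≤ u x) ∧ (¬ ∀ᵐ x, u x = 0) ∧
    rayleighQuotient α p u = firstEigenvalue Ω α p

/-- `L_∞^+ φ (x) = sup_{y ≠ x} (φ(y) - φ(x)) / |y - x|^α`. -/
noncomputable def holderSup {n : ℕ} (α : ℝ) (φ : EuclideanSpace ℝ (Fin n) → ℝ)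
    (x : EuclideanSpace ℝ (Fin n)) : ℝ :=
  ⨆ y : {y : EuclideanSpace ℝ (Fin n) // y ≠ x}, (φ y - φ x) / ‖(y : EuclideanSpace ℝ (Fin n)) - x‖ ^ α

/-- `L_∞^- φ (x) = inf_{y ≠ x} (φ(y) - φ(x)) / |y - x|^α`. -/
noncomputable def holderInf {n : ℕ} (α : ℝ) (φ : EuclideanSpace ℝ (Fin n) → ℝ)
    (x : EuclideanSpace ℝ (Fin n)) : ℝ :=
  ⨅ y : {y : EuclideanSpace ℝ (Fin n) // y ≠ x}, (φ y - φ x) / ‖(y : EuclideanSpace ℝ (Fin n)) - x‖ ^ α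

/-- `L_∞ φ (x) = L_∞^+ φ (x) + L_∞^- φ (x)`. -/
noncomputable def holderInfinityLaplacian {n : ℕ} (α : ℝ) (φ : EuclideanSpace ℝ (Fin n) → ℝ)
    (x : EuclideanSpace ℝ (Fin n)) : ℝ :=
  holderSup α φ x + holderInf α φ x

/-- The radius `R = max_{x ∈ Ω} dist(x, ℝⁿ \ Ω)` of the largest inscribed ball. -/
noncomputable def inradius {n : ℕ} (Ω : Set (EuclideanSpace ℝ (Fin n))) : ℝ :=
  sSup ((fun x => Metric.infDist x Ωᶜ) '' Ω)

/-- `Λ_∞^α = (1 / R)^α`. -/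
noncomputable def infinityEigenvalue {n : ℕ} (Ω : Set (EuclideanSpace ℝ (Fin n))) (α : ℝ) : ℝ :=
  (1 / inradius Ω) ^ α

/-- `u ∈ C_0(ℝⁿ)`. -/
def MemCZero {n : ℕ} (u : EuclideanSpace ℝ (Fin n) → ℝ) : Prop :=
  Continuous u ∧ HasCompactSupport u

/-- `u ∈ C_0(closure Ω)`, extended by zero to the whole space. -/
def MemCZeroClosure {n : ℕ} (Ω : Set (EuclideanSpace ℝ (Fin n)))
    (u : EuclideanSpace ℝ (Fin n) → ℝ) : Prop :=
  Continuous u ∧ ∀ x, x ∉ Ω → u x = 0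

/-- `φ ∈ C_0^1(ℝⁿ)`. -/
def MemCOneZero {n : ℕ} (φ : EuclideanSpace ℝ (Fin n) → ℝ) : Prop :=
  ContDiff ℝ 1 φ ∧ HasCompactSupport φ

/-- Viscosity supersolution in `Ω` of `max {L_∞ u, L_∞^- u + lam * u} = 0`. -/
def IsViscositySupersolution {n : ℕ} (Ω : Set (EuclideanSpace ℝ (Fin n))) (α lam : ℝ)
    (u : EuclideanSpace ℝ (Fin n) → ℝ) : Prop :=
  MemCZero u ∧ (∀ x, 0 ≤ u x) ∧
    ∀ x₀ ∈ Ω, ∀ φ : EuclideanSpace ℝ (Fin n) → ℝ, MemCOneZero φ →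
      φ x₀ = u x₀ → (∀ x, φ x ≤ u x) →
      holderInfinityLaplacian α φ x₀ ≤ 0 ∧ holderInf α φ x₀ + lam * φ x₀ ≤ 0

/-- Viscosity subsolution in `Ω` of `max {L_∞ u, L_∞^- u + lam * u} = 0`. -/
def IsViscositySubsolution {n : ℕ} (Ω : Set (EuclideanSpace ℝ (Fin n))) (α lam : ℝ)
    (u : EuclideanSpace ℝ (Fin n) → ℝ) : Prop :=
  MemCZero u ∧
    ∀ x₀ ∈ Ω, ∀ ψ : EuclideanSpace ℝ (Fin n) → ℝ, MemCOneZero ψ →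
      ψ x₀ = u x₀ → (∀ x, u x ≤ ψ x) →
      0 ≤ holderInfinityLaplacian α ψ x₀ ∨ 0 ≤ holderInf α ψ x₀ + lam * ψ x₀

/-- Viscosity solution in `Ω` of `max {L_∞ u, L_∞^- u + lam * u} = 0`. -/
def IsViscositySolution {n : ℕ} (Ω : Set (EuclideanSpace ℝ (Fin n))) (α lam : ℝ)
    (u : EuclideanSpace ℝ (Fin n) → ℝ) : Prop :=
  IsViscositySupersolution Ω α lam u ∧ IsViscositySubsolution Ω α lam u

/-! For large p a quantity of size C·p·b^p is felt only through its base b. Equation (∗) is what the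
minimality of u_k says when the bases of competing terms are compared.

Growth of the eigenvalue: λ_p has base Λ_∞^α. From above, dist(·, Ωᶜ)^α has Hölder constant 1 and
energy bounded independently of p, while its p-th power integral has base R^α, R being the inradius
(`exists_firstEigenvalue_le`). From below, the normalization forces the uniform limit w to reach 1
somewhere. Such a point is within R of a point outside Ω, where w = 0, and the energy between two
small balls around these points has base arbitrarily close to R^(-α)
(`exists_one_le_of_tendstoUniformly`, `exists_le_gagliardoEnergy`).

Compactness: a Morrey inequality with exponent α - 2n/p and constant bounded in p (`morrey_on_ball`)
provides the continuous representatives and makes them equi-Hölder, so Arzelà–Ascoli applies.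

Minimality: let u be a minimizer, Φ ≤ 0 off Ω, and h = (Φ - u)^+. Comparing u with max(Φ, u),
convexity of |t|^p and symmetrization give, formally, ∫ h(x) [λ |u|^(p-2) u(x) + ∫ (flux(x, x+z) +
flux(x, x-z)) dz] dx ≤ 0, where the flux is that of Φ. If the bracket is bounded below by a positive
constant on {Φ > u}, then Φ ≤ u everywhere (`IsRayleighMinimizer.le_of_flux_lower_bound`). This
replaces an Euler–Lagrange equation for u_k.

Limit: let φ touch w from below at x₀. A small smooth perturbation Φ of φ exceeds u_k at x₀, for
large k, but not outside a small ball. So the bracket cannot be positive throughout {Φ > u_k}. Its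
negative part is at most C·p·b^p whenever b > -L⁻φ(x₀). A set of increments with Hölder quotient at
least a contributes a multiple of a^p, and the λ term has base Λ_∞^α φ(x₀)
(`eventually_growth_le_of_touching`). Comparing bases gives L⁺φ(x₀) ≤ -L⁻φ(x₀) and Λ_∞^α φ(x₀) ≤
-L⁻φ(x₀).

For the subsolution property, -u_k is also a minimizer and -ψ touches -w from below. If both
alternatives failed, -L⁻ψ(x₀) would exceed L⁺ψ(x₀), Λ_∞^α ψ(x₀) and 0, and the same comparison of
bases is violated. -/

/-! ### Elementary inequalities for powers -/

/-- The odd power function `t ↦ |t|^(p-2) t`. -/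
noncomputable def oddPow (p t : ℝ) : ℝ := |t| ^ (p - 2) * t

lemma oddPow_neg (p t : ℝ) : oddPow p (-t) = -oddPow p t := by simp [oddPow]

@[simp] lemma oddPow_zero (p : ℝ) : oddPow p 0 = 0 := by simp [oddPow]

lemma oddPow_of_nonneg {p t : ℝ} (hp : 1 < p) (ht : 0 ≤ t) : oddPow p t = t ^ (p - 1) := by
  rcases ht.eq_or_lt with rfl | h
  · rw [oddPow_zero, Real.zero_rpow (by linarith)]
  · rw [oddPow, abs_of_pos h, ← Real.rpow_add_one h.ne']
    congr 1
    ring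

lemma abs_oddPow {p : ℝ} (hp : 1 < p) (t : ℝ) : |oddPow p t| = |t| ^ (p - 1) := by
  rw [← oddPow_of_nonneg hp (abs_nonneg t), oddPow, oddPow, abs_mul, abs_abs,
    abs_of_nonneg (Real.rpow_nonneg (abs_nonneg t) _)]

lemma oddPow_mul_self {p : ℝ} (hp : 1 < p) (t : ℝ) : oddPow p t * t = |t| ^ p := by
  rw [oddPow, mul_assoc, ← abs_mul_abs_self t, ← mul_assoc]
  rcases (abs_nonneg t).eq_or_lt with h | h
  · rw [← h, Real.zero_rpow (by linarith : p ≠ 0)]; simp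
  · rw [← Real.rpow_add_one h.ne', ← Real.rpow_add_one h.ne']
    congr 1; ring

lemma continuous_oddPow {p : ℝ} (hp : 2 < p) : Continuous (oddPow p) :=
  (continuous_abs.rpow_const fun _ => Or.inr (by linarith)).mul continuous_id

lemma monotone_oddPow {p : ℝ} (hp : 1 < p) : Monotone (oddPow p) := by
  have key : ∀ s t : ℝ, 0 ≤ s → s ≤ t → oddPow p s ≤ oddPow p t := fun s t hs hst => by
    rw [oddPow_of_nonneg hp hs, oddPow_of_nonneg hp (hs.trans hst)]
    exact Real.rpow_le_rpow hs hst (by linarith)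
  intro s t hst
  rcases le_total 0 s with hs | hs
  · exact key s t hs hst
  · rcases le_total 0 t with ht | ht
    · calc oddPow p s = -oddPow p (-s) := by rw [oddPow_neg, neg_neg]
        _ ≤ 0 := by simpa using key 0 (-s) le_rfl (by linarith)
        _ ≤ oddPow p t := by simpa using key 0 t le_rfl ht
    · have := key (-t) (-s) (by linarith) (by linarith)
      rw [oddPow_neg, oddPow_neg] at this
      linarith

lemma rpow_sub_one_mul_le {p a b : ℝ} (hp : 1 < p) (ha : 0 ≤ a) (hb : 0 ≤ b) :
    p * (b ^ (p - 1) * a) ≤ (p - 1) * b ^ p + a ^ p := by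
  have h := Real.young_inequality_of_nonneg ha (Real.rpow_nonneg hb (p - 1))
    (Real.HolderConjugate.conjExponent hp)
  have h2 : (b ^ (p - 1)) ^ (p.conjExponent) = b ^ p := by
    rw [← Real.rpow_mul hb, Real.conjExponent]
    congr 1
    field_simp [show p - 1 ≠ 0 by linarith]
  rw [h2, Real.conjExponent] at h
  have h3 : p * (a ^ p / p + b ^ p / (p / (p - 1))) = (p - 1) * b ^ p + a ^ p := by
    field_simp [show p - 1 ≠ 0 by linarith]
    ring
  calc p * (b ^ (p - 1) * a) = p * (a * b ^ (p - 1)) := by ring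
    _ ≤ _ := mul_le_mul_of_nonneg_left h (by linarith)
    _ = _ := h3

/-- The tangent inequality for the convex function `|t|^p`. -/
lemma abs_rpow_sub_le {p : ℝ} (hp : 1 < p) (a b : ℝ) :
    |b| ^ p - |a| ^ p ≤ p * (oddPow p b * (b - a)) := by
  have h1 : oddPow p b * a ≤ |b| ^ (p - 1) * |a| := by
    rw [← abs_oddPow hp, ← abs_mul]; exact le_abs_self _
  have h2 := rpow_sub_one_mul_le hp (abs_nonneg a) (abs_nonneg b)
  have h3 := oddPow_mul_self hp b
  have h4 := mul_le_mul_of_nonneg_left h1 (by linarith : (0:ℝ) ≤ p)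
  nlinarith

lemma abs_rpow_mul_le {p : ℝ} (hp : 1 < p) (a b : ℝ) :
    |oddPow p a * b| ≤ |a| ^ p + |b| ^ p := by
  have h2 := rpow_sub_one_mul_le hp (abs_nonneg b) (abs_nonneg a)
  rw [abs_mul, abs_oddPow hp]
  have h3 : 0 ≤ |a| ^ p := by positivity
  have h4 : 0 ≤ |b| ^ p := by positivity
  have : p * (|a| ^ (p - 1) * |b|) ≤ p * (|a| ^ p + |b| ^ p) := by nlinarith
  exact le_of_mul_le_mul_left this (by linarith)

lemma rpow_sub_rpow_le {q s t L : ℝ} (hq : 1 < q) (hs : 0 ≤ s) (hst : s ≤ t) (ht : t ≤ L) :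
    t ^ q - s ^ q ≤ q * L ^ (q - 1) * (t - s) := by
  have h := abs_rpow_sub_le hq s t
  rw [abs_of_nonneg hs, abs_of_nonneg (hs.trans hst), oddPow_of_nonneg hq (hs.trans hst)] at h
  have h2 : t ^ (q - 1) ≤ L ^ (q - 1) := Real.rpow_le_rpow (hs.trans hst) ht (by linarith)
  have h3 := mul_le_mul_of_nonneg_right h2 (sub_nonneg.2 hst)
  nlinarith

/-- The mean value bound for `oddPow` between a and -b, whose derivative is (p - 1)|t|^(p-2). It is
used for increments in opposite directions, which almost cancel, and it makes the symmetrized flux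
bounded near the diagonal. -/
lemma abs_oddPow_add_le {p a b L : ℝ} (hp : 2 < p) (ha : |a| ≤ L) (hb : |b| ≤ L) :
    |oddPow p a + oddPow p b| ≤ (p - 1) * L ^ (p - 2) * |a + b| := by
  have hp1 : 1 < p := by linarith
  have hL : 0 ≤ L := (abs_nonneg a).trans ha
  have e : p - 1 - 1 = p - 2 := by ring
  have hsame : ∀ a b : ℝ, |a| ≤ L → |b| ≤ L → 0 ≤ a → 0 ≤ b →
      |oddPow p a + oddPow p b| ≤ (p - 1) * L ^ (p - 2) * |a + b| := by
    intro a b ha hb h0a h0b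
    rw [abs_of_nonneg h0a] at ha
    rw [abs_of_nonneg h0b] at hb
    have h1 := rpow_sub_rpow_le (q := p - 1) (by linarith) le_rfl h0a ha
    have h2 := rpow_sub_rpow_le (q := p - 1) (by linarith) le_rfl h0b hb
    rw [Real.zero_rpow (by linarith), e] at h1 h2
    rw [oddPow_of_nonneg hp1 h0a, oddPow_of_nonneg hp1 h0b, abs_of_nonneg (by positivity),
      abs_of_nonneg (by positivity)]
    linarith
  have hopp : ∀ a b : ℝ, |a| ≤ L → |b| ≤ L → 0 ≤ a → b ≤ 0 → -b ≤ a →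
      |oddPow p a + oddPow p b| ≤ (p - 1) * L ^ (p - 2) * |a + b| := by
    intro a b ha hb h0a h0b hba
    rw [abs_of_nonneg h0a] at ha
    have h1 := rpow_sub_rpow_le (q := p - 1) (by linarith) (by linarith : (0:ℝ) ≤ -b) hba ha
    have h2 : (-b) ^ (p - 1) ≤ a ^ (p - 1) :=
      Real.rpow_le_rpow (by linarith) hba (by linarith)
    rw [e] at h1
    have : oddPow p b = - (-b) ^ (p - 1) := by
      rw [← oddPow_of_nonneg hp1 (by linarith : (0:ℝ) ≤ -b), oddPow_neg, neg_neg]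
    rw [this, oddPow_of_nonneg hp1 h0a, abs_of_nonneg (by linarith : 0 ≤ a + b),
      abs_of_nonneg (by linarith)]
    linarith
  have hneg : ∀ a b : ℝ, |oddPow p (-a) + oddPow p (-b)| = |oddPow p a + oddPow p b| := by
    intro a b
    rw [oddPow_neg, oddPow_neg, ← neg_add, abs_neg]
  have hneg' : ∀ a b : ℝ, |-a + -b| = |a + b| := fun a b => by rw [← neg_add, abs_neg]
  have hna : |-a| ≤ L := by rwa [abs_neg]
  have hnb : |-b| ≤ L := by rwa [abs_neg]
  rcases le_total 0 a with h0a | h0a <;> rcases le_total 0 b with h0b | h0b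
  · exact hsame a b ha hb h0a h0b
  · rcases le_total (-b) a with h | h
    · exact hopp a b ha hb h0a h0b h
    · have := hopp (-b) (-a) hnb hna (by linarith) (by linarith) (by linarith)
      rwa [hneg, hneg', add_comm, add_comm b] at this
  · rcases le_total (-a) b with h | h
    · have := hopp b a hb ha h0b h0a h
      rwa [add_comm, add_comm b] at this
    · have := hopp (-a) (-b) hna hnb (by linarith) (by linarith) (by linarith)
      rwa [hneg, hneg'] at this
  · have := hsame (-a) (-b) hna hnb (by linarith) (by linarith)
    rwa [hneg, hneg'] at this

/-- Exponentials beat polynomial factors: `C p b^p < a^p` for large `p` if `0 ≤ b < a`. -/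
lemma eventually_mul_rpow_lt_rpow {a b : ℝ} (hb : 0 ≤ b) (hab : b < a) (C : ℝ) :
    ∀ᶠ p : ℝ in atTop, C * (p * b ^ p) < a ^ p := by
  have ha : 0 < a := hb.trans_lt hab
  -- A base strictly between 0 and a is needed for the logarithm, and b may be 0.
  set b' := max b (a / 2)
  have hb' : 0 < b' := lt_max_of_lt_right (by linarith)
  have hb'a : b' < a := max_lt hab (by linarith)
  have hlog : 0 < Real.log (a / b') := Real.log_pos ((one_lt_div hb').2 hb'a)
  have h := (tendsto_rpow_mul_exp_neg_mul_atTop_nhds_zero 1 _ hlog).const_mul (|C|)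
  rw [mul_zero] at h
  filter_upwards [h.eventually (gt_mem_nhds one_pos), eventually_gt_atTop 0] with p hp hp0
  have e : Real.exp (-Real.log (a / b') * p) = b' ^ p / a ^ p := by
    rw [← Real.log_inv, inv_div, ← Real.rpow_def_of_pos (by positivity),
      Real.div_rpow hb'.le ha.le]
  rw [Real.rpow_one, e] at hp
  have hap : 0 < a ^ p := Real.rpow_pos_of_pos ha p
  have h1 : |C| * (p * b' ^ p) < a ^ p := by
    have := mul_lt_mul_of_pos_right hp hap
    rw [one_mul] at this
    calc |C| * (p * b' ^ p) = |C| * (p * (b' ^ p / a ^ p)) * a ^ p := by field_simp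
      _ < _ := this
  refine lt_of_le_of_lt ?_ h1
  have h2 : b ^ p ≤ b' ^ p := Real.rpow_le_rpow hb (le_max_left _ _) hp0.le
  have h3 : 0 ≤ b ^ p := Real.rpow_nonneg hb p
  calc C * (p * b ^ p) ≤ |C| * (p * b ^ p) :=
        mul_le_mul_of_nonneg_right (le_abs_self C) (by positivity)
    _ ≤ |C| * (p * b' ^ p) := by gcongr

lemma abs_sub_rpow_le {p : ℝ} (hp : 0 ≤ p) (a b : ℝ) :
    |a + b| ^ p ≤ 2 ^ p * (|a| ^ p + |b| ^ p) := by
  have hm : |a + b| ≤ 2 * max |a| |b| := by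
    have := abs_add_le a b
    have := le_max_left |a| |b|
    have := le_max_right |a| |b|
    linarith
  calc |a + b| ^ p ≤ (2 * max |a| |b|) ^ p := Real.rpow_le_rpow (abs_nonneg _) hm hp
    _ = 2 ^ p * (max |a| |b|) ^ p := Real.mul_rpow (by norm_num) (by positivity)
    _ ≤ _ := by
      gcongr
      rcases max_choice |a| |b| with h | h <;> rw [h]
      · linarith [Real.rpow_nonneg (abs_nonneg b) p]
      · linarith [Real.rpow_nonneg (abs_nonneg a) p]

/-! ### The Gagliardo energy and the power integral -/

section FractionalEigenvalue
variable {n : ℕ}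
local notation "𝔼" => EuclideanSpace ℝ (Fin n)

/-- The integrand of the Gagliardo energy. -/
noncomputable def energyDensity (p b : ℝ) (u : 𝔼 → ℝ) (z : 𝔼 × 𝔼) : ℝ :=
  |u z.2 - u z.1| ^ p / ‖z.2 - z.1‖ ^ b

lemma energyDensity_nonneg (p b : ℝ) (u : 𝔼 → ℝ) (z : 𝔼 × 𝔼) : 0 ≤ energyDensity p b u z := by
  unfold energyDensity; positivity

lemma aemeasurable_energyDensity {p b : ℝ} {u : 𝔼 → ℝ} {μ ν : Measure 𝔼} [SFinite μ] [SFinite ν]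
    (hμ : AEMeasurable u μ) (hν : AEMeasurable u ν) :
    AEMeasurable (energyDensity p b u) (μ.prod ν) := by
  have h1 : AEMeasurable (fun z : 𝔼 × 𝔼 => u z.2) (μ.prod ν) := hν.comp_snd
  have h2 : AEMeasurable (fun z : 𝔼 × 𝔼 => u z.1) (μ.prod ν) := hμ.comp_fst
  have h3 : AEMeasurable (fun z : 𝔼 × 𝔼 => ‖z.2 - z.1‖) (μ.prod ν) := by fun_prop
  exact ((h1.sub h2).abs.pow_const p).div (h3.pow_const b)

lemma measurable_energyDensity {p b : ℝ} {u : 𝔼 → ℝ} (hu : Measurable u) :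
    Measurable (energyDensity p b u) := by
  unfold energyDensity
  have h1 : Measurable (fun z : 𝔼 × 𝔼 => |u z.2 - u z.1|) := by fun_prop
  have h3 : Measurable (fun z : 𝔼 × 𝔼 => ‖z.2 - z.1‖) := by fun_prop
  exact (h1.pow_const p).div (h3.pow_const b)

lemma gagliardoEnergy_eq_lintegral_prod {D : Set 𝔼} {p b : ℝ} {u : 𝔼 → ℝ}
    (hu : AEMeasurable u (volume.restrict D)) :
    gagliardoEnergy D p b u = ∫⁻ z, ENNReal.ofReal (energyDensity p b u z)
      ∂((volume.restrict D).prod (volume.restrict D)) := by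
  rw [lintegral_prod _ (aemeasurable_energyDensity hu hu).ennreal_ofReal]
  rfl

lemma gagliardoEnergy_congr {D : Set 𝔼} {p b : ℝ} {u v : 𝔼 → ℝ}
    (h : u =ᵐ[volume.restrict D] v) : gagliardoEnergy D p b u = gagliardoEnergy D p b v := by
  unfold gagliardoEnergy
  refine lintegral_congr_ae ?_
  filter_upwards [h] with x hx
  refine lintegral_congr_ae ?_
  filter_upwards [h] with y hy
  rw [hx, hy]

lemma powerIntegral_congr {D : Set 𝔼} {p : ℝ} {u v : 𝔼 → ℝ}
    (h : u =ᵐ[volume.restrict D] v) : powerIntegral D p u = powerIntegral D p v := by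
  unfold powerIntegral
  refine lintegral_congr_ae ?_
  filter_upwards [h] with x hx
  rw [hx]

lemma gagliardoEnergy_mono_set {D D' : Set 𝔼} (h : D ⊆ D') (p b : ℝ) (u : 𝔼 → ℝ) :
    gagliardoEnergy D p b u ≤ gagliardoEnergy D' p b u :=
  (lintegral_mono fun _ => lintegral_mono_set h).trans (lintegral_mono_set h)

lemma gagliardoEnergy_mono {D : Set 𝔼} {p b : ℝ} (hp : 0 ≤ p) {u v : 𝔼 → ℝ}
    (h : ∀ x y, |u y - u x| ≤ |v y - v x|) :
    gagliardoEnergy D p b u ≤ gagliardoEnergy D p b v := by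
  refine lintegral_mono fun x => lintegral_mono fun y => ENNReal.ofReal_le_ofReal ?_
  have := h x y
  gcongr

lemma energyDensity_add_le {p b : ℝ} (hp : 0 ≤ p) (u v : 𝔼 → ℝ) (z : 𝔼 × 𝔼) :
    energyDensity p b (u + v) z ≤ 2 ^ p * (energyDensity p b u z + energyDensity p b v z) := by
  unfold energyDensity
  rw [← add_div, ← mul_div_assoc]
  have h := abs_sub_rpow_le hp (u z.2 - u z.1) (v z.2 - v z.1)
  have e : (u + v) z.2 - (u + v) z.1 = u z.2 - u z.1 + (v z.2 - v z.1) := by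
    simp only [Pi.add_apply]; ring
  rw [e]
  gcongr

lemma gagliardoEnergy_add_le {D : Set 𝔼} {p b : ℝ} (hp : 0 ≤ p) {u v : 𝔼 → ℝ}
    (hu : AEMeasurable u (volume.restrict D)) (hv : AEMeasurable v (volume.restrict D)) :
    gagliardoEnergy D p b (u + v) ≤
      ENNReal.ofReal (2 ^ p) * (gagliardoEnergy D p b u + gagliardoEnergy D p b v) := by
  rw [gagliardoEnergy_eq_lintegral_prod hu, gagliardoEnergy_eq_lintegral_prod hv,
    gagliardoEnergy_eq_lintegral_prod (hu.add hv),
    ← lintegral_add_left' (aemeasurable_energyDensity hu hu).ennreal_ofReal,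
    ← lintegral_const_mul' _ _ ENNReal.ofReal_ne_top]
  refine lintegral_mono fun z => ?_
  rw [← ENNReal.ofReal_add (energyDensity_nonneg _ _ _ _) (energyDensity_nonneg _ _ _ _),
    ← ENNReal.ofReal_mul (by positivity)]
  exact ENNReal.ofReal_le_ofReal (energyDensity_add_le hp u v z)

lemma gagliardoEnergy_neg {D : Set 𝔼} {p b : ℝ} (u : 𝔼 → ℝ) :
    gagliardoEnergy D p b (-u) = gagliardoEnergy D p b u := by
  unfold gagliardoEnergy
  simp only [Pi.neg_apply, neg_sub_neg, abs_sub_comm]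

lemma powerIntegral_neg {D : Set 𝔼} {p : ℝ} (u : 𝔼 → ℝ) :
    powerIntegral D p (-u) = powerIntegral D p u := by
  simp [powerIntegral]

lemma gagliardoEnergy_sub_le {D : Set 𝔼} {p b : ℝ} (hp : 0 ≤ p) {u v : 𝔼 → ℝ}
    (hu : AEMeasurable u (volume.restrict D)) (hv : AEMeasurable v (volume.restrict D)) :
    gagliardoEnergy D p b (u - v) ≤
      ENNReal.ofReal (2 ^ p) * (gagliardoEnergy D p b u + gagliardoEnergy D p b v) := by
  rw [sub_eq_add_neg, ← gagliardoEnergy_neg v]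
  exact gagliardoEnergy_add_le hp hu hv.neg

lemma integrable_energyDensity {p b : ℝ} {u : 𝔼 → ℝ} (hu : Measurable u)
    (hE : gagliardoEnergy univ p b u ≠ ∞) :
    Integrable (energyDensity p b u) (volume.prod volume) := by
  refine ⟨(measurable_energyDensity hu).aestronglyMeasurable, ?_⟩
  rw [hasFiniteIntegral_iff_ofReal (Eventually.of_forall (energyDensity_nonneg p b u))]
  rw [gagliardoEnergy_eq_lintegral_prod hu.aemeasurable, Measure.restrict_univ] at hE
  exact hE.lt_top

lemma ofReal_integral_energyDensity {p b : ℝ} {u : 𝔼 → ℝ} (hu : Measurable u)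
    (hE : gagliardoEnergy univ p b u ≠ ∞) :
    ENNReal.ofReal (∫ z, energyDensity p b u z ∂(volume.prod volume)) =
      gagliardoEnergy univ p b u := by
  rw [ofReal_integral_eq_lintegral_ofReal (integrable_energyDensity hu hE)
    (Eventually.of_forall (energyDensity_nonneg p b u)),
    gagliardoEnergy_eq_lintegral_prod hu.aemeasurable, Measure.restrict_univ]

lemma ofReal_integral_abs_rpow {p : ℝ} (hp : 0 < p) {u : 𝔼 → ℝ} (hu : Continuous u)
    (hc : HasCompactSupport u) :
    ENNReal.ofReal (∫ x, |u x| ^ p) = powerIntegral univ p u := by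
  have hint : Integrable (fun x => |u x| ^ p) := by
    refine (hu.abs.rpow_const fun _ => Or.inr hp.le).integrable_of_hasCompactSupport ?_
    exact hc.comp_left (g := fun t => |t| ^ p) (by simp [hp.ne'])
  rw [ofReal_integral_eq_lintegral_ofReal hint (Eventually.of_forall fun x => by positivity),
    powerIntegral, Measure.restrict_univ]

lemma integrable_abs_rpow {p : ℝ} (hp : 0 < p) {u : 𝔼 → ℝ} (hu : Continuous u)
    (hc : HasCompactSupport u) : Integrable (fun x => |u x| ^ p) := by
  refine (hu.abs.rpow_const fun _ => Or.inr hp.le).integrable_of_hasCompactSupport ?_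
  exact hc.comp_left (g := fun t => |t| ^ p) (by simp [hp.ne'])

lemma powerIntegral_ne_top {p : ℝ} (hp : 0 < p) {u : 𝔼 → ℝ} (hu : Continuous u)
    (hc : HasCompactSupport u) : powerIntegral univ p u ≠ ∞ := by
  rw [← ofReal_integral_abs_rpow hp hu hc]; exact ENNReal.ofReal_ne_top

lemma powerIntegral_eq_zero_iff {p : ℝ} (hp : 0 < p) {u : 𝔼 → ℝ} (hu : Continuous u) :
    powerIntegral univ p u = 0 ↔ u = 0 := by
  rw [powerIntegral, Measure.restrict_univ, lintegral_eq_zero_iff (by fun_prop)]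
  constructor
  · intro h
    refine Continuous.ae_eq_iff_eq volume hu continuous_const |>.1 ?_
    filter_upwards [h] with x hx
    simp only [Pi.zero_apply, ENNReal.ofReal_eq_zero] at hx
    have h0 : |u x| ^ p = 0 := le_antisymm hx (by positivity)
    exact abs_eq_zero.1 ((Real.rpow_eq_zero (abs_nonneg _) hp.ne').1 h0)
  · rintro rfl
    refine Eventually.of_forall fun x => ?_
    simp [hp.ne']

/-- The lower semicontinuity of the power integral under pointwise convergence. -/
lemma powerIntegral_le_liminf {p : ℝ} (hp : 0 < p) {v : ℕ → 𝔼 → ℝ} {u : 𝔼 → ℝ}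
    (hv : ∀ i, Continuous (v i)) (h : ∀ x, Tendsto (fun i => v i x) atTop (𝓝 (u x))) :
    powerIntegral univ p u ≤ liminf (fun i => powerIntegral univ p (v i)) atTop := by
  unfold powerIntegral
  rw [Measure.restrict_univ]
  refine le_trans (lintegral_mono fun x => ?_) (lintegral_liminf_le fun i => ?_)
  · refine le_of_eq (Tendsto.liminf_eq ?_).symm
    exact ENNReal.tendsto_ofReal ((h x).abs.rpow_const (Or.inr hp.le))
  · have := (hv i).measurable
    fun_prop

/-! ### Mollification -/

/-- Mollification of a function on `ℝⁿ` by a normalized smooth bump. -/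
noncomputable def mollify (η : ContDiffBump (0 : EuclideanSpace ℝ (Fin n)))
    (v : EuclideanSpace ℝ (Fin n) → ℝ) (x : EuclideanSpace ℝ (Fin n)) : ℝ :=
  ∫ t, η.normed volume t * v (x - t)

lemma mollify_eq_convolution (η : ContDiffBump (0 : 𝔼)) (v : 𝔼 → ℝ) :
    mollify η v = convolution (η.normed volume) v (ContinuousLinearMap.lsmul ℝ ℝ) volume := by
  ext x; rfl

lemma integrable_normed_mul (η : ContDiffBump (0 : 𝔼)) {g : 𝔼 → ℝ} (hg : Continuous g) :
    Integrable (fun t => η.normed volume t * g t) :=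
  (η.continuous_normed.mul hg).integrable_of_hasCompactSupport η.hasCompactSupport_normed.mul_right

lemma contDiff_mollify (η : ContDiffBump (0 : 𝔼)) {v : 𝔼 → ℝ} (hv : Continuous v) :
    ContDiff ℝ ((⊤ : ℕ∞) : WithTop ℕ∞) (mollify η v) := by
  rw [mollify_eq_convolution]
  exact η.hasCompactSupport_normed.contDiff_convolution_left _ η.contDiff_normed
    hv.locallyIntegrable

lemma exists_of_mollify_ne_zero (η : ContDiffBump (0 : 𝔼)) {v : 𝔼 → ℝ} {x : 𝔼}
    (hx : mollify η v x ≠ 0) : ∃ y, dist x y < η.rOut ∧ v y ≠ 0 := by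
  by_contra! h
  refine hx ?_
  unfold mollify
  rw [show (fun t => η.normed volume t * v (x - t)) = fun _ => 0 from ?_, integral_zero]
  ext t
  by_cases ht : t ∈ Function.support (η.normed (volume : Measure 𝔼))
  · rw [η.support_normed_eq, mem_ball_zero_iff] at ht
    rw [h (x - t) (by simpa [dist_eq_norm] using ht), mul_zero]
  · rw [Function.notMem_support.1 ht, zero_mul]

lemma tsupport_mollify_subset (η : ContDiffBump (0 : 𝔼)) (v : 𝔼 → ℝ) :
    tsupport (mollify η v) ⊆ Metric.cthickening η.rOut (tsupport v) := by
  refine closure_minimal (fun x hx => ?_) Metric.isClosed_cthickening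
  obtain ⟨y, hxy, hy⟩ := exists_of_mollify_ne_zero η hx
  exact Metric.mem_cthickening_of_dist_le x y _ _ (subset_tsupport _ hy) hxy.le

lemma hasCompactSupport_mollify (η : ContDiffBump (0 : 𝔼)) {v : 𝔼 → ℝ}
    (hv : HasCompactSupport v) : HasCompactSupport (mollify η v) := by
  refine HasCompactSupport.of_support_subset_isCompact (K := Metric.cthickening η.rOut (tsupport v))
    hv.isCompact.cthickening ?_
  exact (subset_tsupport _).trans (tsupport_mollify_subset η v)

lemma abs_mollify_sub_le (η : ContDiffBump (0 : 𝔼)) {v : 𝔼 → ℝ} (hv : Continuous v) {x : 𝔼} {ε : ℝ}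
    (h : ∀ y, dist y x < η.rOut → |v y - v x| ≤ ε) : |mollify η v x - v x| ≤ ε := by
  rw [mollify_eq_convolution, ← Real.dist_eq]
  exact η.dist_normed_convolution_le hv.aestronglyMeasurable fun y hy => by
    rw [Real.dist_eq]; exact h y hy

/-- Jensen's inequality for the probability density of the bump: integrate the tangent inequality at
the mean m, where the linear term integrates to zero. -/
lemma abs_integral_normed_mul_rpow_le (η : ContDiffBump (0 : 𝔼)) {g : 𝔼 → ℝ} (hg : Continuous g)
    {p : ℝ} (hp : 1 < p) :
    |∫ t, η.normed volume t * g t| ^ p ≤ ∫ t, η.normed volume t * |g t| ^ p := by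
  set m := ∫ t, η.normed volume t * g t with hm
  have hgp : Continuous fun t => |g t| ^ p := hg.abs.rpow_const fun _ => Or.inr (by linarith)
  have i1 := integrable_normed_mul η hg
  have i2 := integrable_normed_mul η hgp
  have i0 : Integrable (fun t => η.normed (volume : Measure 𝔼) t) :=
    η.continuous_normed.integrable_of_hasCompactSupport η.hasCompactSupport_normed
  have h1 : ∫ t, (|m| ^ p * η.normed volume t - η.normed volume t * |g t| ^ p) ≤
      ∫ t, p * oddPow p m * (m * η.normed volume t - η.normed volume t * g t) := by
    refine integral_mono ((i0.const_mul _).sub i2) (((i0.const_mul _).sub i1).const_mul _)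
      fun t => ?_
    have := mul_le_mul_of_nonneg_left (abs_rpow_sub_le hp (g t) m)
      (η.nonneg_normed (μ := volume) t)
    simp only
    linarith
  rw [integral_sub (i0.const_mul _) i2, integral_const_mul, integral_const_mul,
    integral_sub (i0.const_mul _) i1, integral_const_mul, η.integral_normed, ← hm] at h1
  linarith

lemma mollify_sub_mollify (η : ContDiffBump (0 : 𝔼)) {v : 𝔼 → ℝ} (hv : Continuous v) (x y : 𝔼) :
    mollify η v y - mollify η v x = ∫ t, η.normed volume t * (v (y - t) - v (x - t)) := by
  unfold mollify
  rw [← integral_sub (integrable_normed_mul η (by fun_prop)) (integrable_normed_mul η (by fun_prop))]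
  simp only [mul_sub]

lemma gagliardoEnergy_translate (p b : ℝ) (v : 𝔼 → ℝ) (t : 𝔼) :
    gagliardoEnergy univ p b (fun x => v (x - t)) = gagliardoEnergy univ p b v := by
  unfold gagliardoEnergy
  rw [Measure.restrict_univ,
    ← lintegral_sub_right_eq_self (μ := volume) (fun x => ∫⁻ y,
      ENNReal.ofReal (|v y - v x| ^ p / ‖y - x‖ ^ b)) t]
  refine lintegral_congr fun x => ?_
  rw [← lintegral_sub_right_eq_self (μ := volume) (fun y =>
      ENNReal.ofReal (|v y - v (x - t)| ^ p / ‖y - (x - t)‖ ^ b)) t]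
  simp only [sub_sub_sub_cancel_right]

lemma ofReal_energyDensity_mollify_le (η : ContDiffBump (0 : 𝔼)) {v : 𝔼 → ℝ} (hv : Continuous v)
    {p : ℝ} (hp : 1 < p) (b : ℝ) (z : 𝔼 × 𝔼) :
    ENNReal.ofReal (energyDensity p b (mollify η v) z) ≤
      ∫⁻ t, ENNReal.ofReal (η.normed volume t) *
        ENNReal.ofReal (energyDensity p b (fun x => v (x - t)) z) := by
  obtain ⟨x, y⟩ := z
  have hc : Continuous fun t => v (y - t) - v (x - t) := by fun_prop
  have hcp : Continuous fun t => |v (y - t) - v (x - t)| ^ p :=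
    hc.abs.rpow_const fun _ => Or.inr (by linarith)
  have h1 : |mollify η v y - mollify η v x| ^ p / ‖y - x‖ ^ b ≤
      ∫ t, η.normed volume t * |v (y - t) - v (x - t)| ^ p / ‖y - x‖ ^ b := by
    rw [integral_div, mollify_sub_mollify η hv]
    gcongr
    exact abs_integral_normed_mul_rpow_le η hc hp
  refine (ENNReal.ofReal_le_ofReal h1).trans (le_of_eq ?_)
  rw [ofReal_integral_eq_lintegral_ofReal ((integrable_normed_mul η hcp).div_const _)]
  · refine lintegral_congr fun t => ?_
    rw [mul_div_assoc, ENNReal.ofReal_mul (η.nonneg_normed t), energyDensity]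
  · refine Eventually.of_forall fun t => ?_
    have := η.nonneg_normed (μ := volume) t
    simp only [Pi.zero_apply]
    positivity

lemma measurable_energyDensity_translate {v : 𝔼 → ℝ} (hv : Measurable v) (p b : ℝ) :
    Measurable fun q : (𝔼 × 𝔼) × 𝔼 => energyDensity p b (fun x => v (x - q.2)) q.1 := by
  unfold energyDensity
  have h1 : Measurable (fun q : (𝔼 × 𝔼) × 𝔼 => |v (q.1.2 - q.2) - v (q.1.1 - q.2)|) :=
    ((hv.comp (measurable_fst.snd.sub measurable_snd)).sub
      (hv.comp (measurable_fst.fst.sub measurable_snd))).abs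
  have h2 : Measurable (fun q : (𝔼 × 𝔼) × 𝔼 => ‖q.1.2 - q.1.1‖) :=
    (measurable_fst.snd.sub measurable_fst.fst).norm
  exact (h1.pow_const p).div (h2.pow_const b)

/-- Mollification does not increase the Gagliardo energy. -/
lemma gagliardoEnergy_mollify_le (η : ContDiffBump (0 : 𝔼)) {v : 𝔼 → ℝ} (hv : Continuous v)
    {p : ℝ} (hp : 1 < p) (b : ℝ) :
    gagliardoEnergy univ p b (mollify η v) ≤ gagliardoEnergy univ p b v := by
  have hη : Measurable fun t => ENNReal.ofReal (η.normed (volume : Measure 𝔼) t) :=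
    η.continuous_normed.measurable.ennreal_ofReal
  have hF : Measurable fun q : (𝔼 × 𝔼) × 𝔼 => ENNReal.ofReal (η.normed volume q.2) *
      ENNReal.ofReal (energyDensity p b (fun x => v (x - q.2)) q.1) :=
    (hη.comp measurable_snd).mul
      (measurable_energyDensity_translate hv.measurable p b).ennreal_ofReal
  have hE : ∀ w : 𝔼 → ℝ, Continuous w → gagliardoEnergy univ p b w =
      ∫⁻ z, ENNReal.ofReal (energyDensity p b w z) ∂(volume.prod volume) := fun w hw => by
    rw [gagliardoEnergy_eq_lintegral_prod hw.measurable.aemeasurable, Measure.restrict_univ]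
  calc gagliardoEnergy univ p b (mollify η v)
      ≤ ∫⁻ z : 𝔼 × 𝔼, ∫⁻ t, ENNReal.ofReal (η.normed volume t) *
        ENNReal.ofReal (energyDensity p b (fun x => v (x - t)) z) ∂volume
          ∂(volume.prod volume) := by
        rw [hE _ (contDiff_mollify η hv).continuous]
        exact lintegral_mono fun z => ofReal_energyDensity_mollify_le η hv hp b z
    _ = ∫⁻ t, ∫⁻ z : 𝔼 × 𝔼, ENNReal.ofReal (η.normed volume t) *
        ENNReal.ofReal (energyDensity p b (fun x => v (x - t)) z) ∂(volume.prod volume) :=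
        lintegral_lintegral_swap hF.aemeasurable
    _ = ∫⁻ t, ENNReal.ofReal (η.normed volume t) * gagliardoEnergy univ p b v := by
        refine lintegral_congr fun t => ?_
        rw [lintegral_const_mul' _ _ ENNReal.ofReal_ne_top, ← hE _ (by fun_prop),
          gagliardoEnergy_translate]
    _ = gagliardoEnergy univ p b v := by
        rw [lintegral_mul_const _ hη, ← ofReal_integral_eq_lintegral_ofReal
          (η.continuous_normed.integrable_of_hasCompactSupport η.hasCompactSupport_normed)
          (Eventually.of_forall η.nonneg_normed), η.integral_normed, ENNReal.ofReal_one, one_mul]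

/-- A sequence of bumps at the origin whose radii shrink to zero. -/
noncomputable def shrinkingBump (i : ℕ) : ContDiffBump (0 : EuclideanSpace ℝ (Fin n)) :=
  ⟨1 / (2 * (i + 1)), 1 / (i + 1), by positivity, by
    rw [div_lt_div_iff_of_pos_left one_pos (by positivity) (by positivity)]
    have : (0 : ℝ) ≤ i := by positivity
    linarith⟩

lemma tendsto_rOut_shrinkingBump :
    Tendsto (fun i => (shrinkingBump i : ContDiffBump (0 : 𝔼)).rOut) atTop (𝓝 0) :=
  tendsto_one_div_add_atTop_nhds_zero_nat

lemma tendsto_mollify_shrinkingBump {v : 𝔼 → ℝ} (hv : Continuous v) (x : 𝔼) :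
    Tendsto (fun i => mollify (shrinkingBump i) v x) atTop (𝓝 (v x)) := by
  rw [Metric.tendsto_atTop']
  intro ε hε
  obtain ⟨δ, hδ, h⟩ := Metric.continuousAt_iff.1 (hv.continuousAt (x := x)) (ε / 2) (half_pos hε)
  obtain ⟨N, hN⟩ := (tendsto_rOut_shrinkingBump (n := n)).eventually (gt_mem_nhds hδ) |>.exists_forall_of_atTop
  refine ⟨N, fun i hi => ?_⟩
  rw [Real.dist_eq]
  refine lt_of_le_of_lt (abs_mollify_sub_le _ hv (ε := ε / 2) fun y hy => ?_) (by linarith)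
  have := h (hy.trans (hN i hi.le))
  rw [Real.dist_eq] at this
  exact this.le

/-! ### Energies of Hölder functions and finiteness of the first eigenvalue -/

lemma integrable_one_add_norm_rpow {r : ℝ} (hr : (n : ℝ) < r) :
    Integrable (fun z : 𝔼 => (1 + ‖z‖) ^ (-r)) :=
  integrable_one_add_norm (by rwa [finrank_euclideanSpace, Fintype.card_fin])

/-- The difference quotient is at most H·min(1, R/t)^α with t = |y - x|. Since min(1, R/t) ≤ 1 and
αp ≥ 2n, its p-th power is at most H^p·min(1, R/t)^(2n). The dependence on p thus sits in H^p alone,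
and the remaining kernel decays with exponent 2n, which is integrable for n ≥ 1. -/
lemma holder_energyDensity_le {α p R H : ℝ} (hp : 0 < p)
    (hαp : 2 * (n : ℝ) ≤ α * p) (hR : 0 < R) (hH : 0 ≤ H) {v : 𝔼 → ℝ}
    (h1 : ∀ x y, |v y - v x| ≤ H * ‖y - x‖ ^ α) (h2 : ∀ x y, |v y - v x| ≤ H * R ^ α) (z : 𝔼 × 𝔼) :
    energyDensity p (α * p) v z ≤
      H ^ p * ((1 + R) ^ (2 * (n : ℝ)) * (1 + ‖z.2 - z.1‖) ^ (-(2 * (n : ℝ)))) := by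
  obtain ⟨x, y⟩ := z
  unfold energyDensity
  simp only
  set t := ‖y - x‖ with ht
  have ht0 : 0 ≤ t := norm_nonneg _
  rcases ht0.eq_or_lt with h0 | h0
  · have hyx : y = x := by rw [eq_comm, norm_eq_zero, sub_eq_zero] at h0; exact h0
    rw [hyx, sub_self, abs_zero, Real.zero_rpow hp.ne', zero_div]
    positivity
  have hpow : (t ^ (α * p)) = (t ^ α) ^ p := Real.rpow_mul ht0 _ _
  have hta : 0 < t ^ α := Real.rpow_pos_of_pos h0 _
  rw [hpow, ← Real.div_rpow (abs_nonneg _) hta.le]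
  have hm : |v y - v x| / t ^ α ≤ H * (min 1 (R / t)) ^ α := by
    rw [div_le_iff₀ hta]
    rcases le_total t R with h | h
    · rw [min_eq_left ((one_le_div h0).2 h), Real.one_rpow, mul_one]
      exact h1 x y
    · rw [min_eq_right ((div_le_one h0).2 h), Real.div_rpow hR.le ht0, mul_assoc,
        div_mul_cancel₀ _ hta.ne']
      exact h2 x y
  have hm0 : 0 < min 1 (R / t) := lt_min one_pos (by positivity)
  calc (|v y - v x| / t ^ α) ^ p ≤ (H * (min 1 (R / t)) ^ α) ^ p := by gcongr
    _ = H ^ p * (min 1 (R / t)) ^ (α * p) := by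
        rw [Real.mul_rpow hH (by positivity), ← Real.rpow_mul hm0.le]
    _ ≤ H ^ p * (min 1 (R / t)) ^ (2 * (n : ℝ)) := by
        gcongr ?_ * ?_
        exact Real.rpow_le_rpow_of_exponent_ge hm0 (min_le_left _ _) hαp
    _ ≤ H ^ p * ((1 + R) / (1 + t)) ^ (2 * (n : ℝ)) := by
        gcongr
        rcases le_total t R with h | h
        · exact (min_le_left _ _).trans ((one_le_div (by positivity)).2 (by linarith))
        · refine (min_le_right _ _).trans ?_
          rw [div_le_div_iff₀ h0 (by positivity)]
          nlinarith
    _ = _ := by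
        rw [Real.div_rpow (by positivity) (by positivity), Real.rpow_neg (by positivity),
          div_eq_mul_inv]

/-- A uniform bound for the energies of bounded Hölder functions with support in a fixed set. -/
lemma exists_gagliardoEnergy_le_of_holder (hn : 1 ≤ n) {S : Set 𝔼} (hS : MeasurableSet S)
    (hSf : volume S ≠ ∞) {R : ℝ} (hR : 0 < R) (α : ℝ) :
    ∃ C : ℝ≥0∞, C ≠ ∞ ∧ ∀ p H : ℝ, 0 < p → 2 * (n : ℝ) ≤ α * p → 0 ≤ H →
      ∀ v : 𝔼 → ℝ, (∀ x, x ∉ S → v x = 0) → (∀ x y, |v y - v x| ≤ H * ‖y - x‖ ^ α) →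
      (∀ x y, |v y - v x| ≤ H * R ^ α) →
      gagliardoEnergy univ p (α * p) v ≤ ENNReal.ofReal (H ^ p) * C := by
  set k : 𝔼 → ℝ≥0∞ := fun z =>
    ENNReal.ofReal ((1 + R) ^ (2 * (n : ℝ)) * (1 + ‖z‖) ^ (-(2 * (n : ℝ)))) with hk
  have hkm : Measurable k := by
    refine Measurable.ennreal_ofReal (measurable_const.mul ?_)
    exact (measurable_const.add measurable_norm).pow_const _
  have hkf : ∫⁻ z, k z ≠ ∞ := by
    have hn' : (n : ℝ) < 2 * n := by
      have : (1 : ℝ) ≤ n := by exact_mod_cast hn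
      linarith
    exact ((integrable_one_add_norm_rpow hn').const_mul _).lintegral_lt_top.ne
  set K := ∫⁻ z, k z
  refine ⟨volume S * K + volume S * K, by finiteness, ?_⟩
  intro p H hp hαp hH v hv h1 h2
  have hind : Measurable (S.indicator (1 : 𝔼 → ℝ≥0∞)) := measurable_one.indicator hS
  have hpt : ∀ x y, ENNReal.ofReal (|v y - v x| ^ p / ‖y - x‖ ^ (α * p)) ≤
      ENNReal.ofReal (H ^ p) *
        (S.indicator 1 x * k (y - x) + S.indicator 1 y * k (y - x)) := by
    intro x y
    by_cases hxy : x ∈ S ∨ y ∈ S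
    · have hb : ENNReal.ofReal (|v y - v x| ^ p / ‖y - x‖ ^ (α * p)) ≤
          ENNReal.ofReal (H ^ p) * k (y - x) := by
        rw [hk, ← ENNReal.ofReal_mul (by positivity)]
        exact ENNReal.ofReal_le_ofReal (holder_energyDensity_le hp hαp hR hH h1 h2 (x, y))
      refine hb.trans ?_
      gcongr
      rcases hxy with h | h
      · simp [h]
      · simp [h]
    · push Not at hxy
      rw [hv x hxy.1, hv y hxy.2, sub_self, abs_zero, Real.zero_rpow hp.ne', zero_div,
        ENNReal.ofReal_zero]
      exact zero_le
  have hk2 : ∀ x, ∫⁻ y, k (y - x) = K := fun x => lintegral_sub_right_eq_self (μ := volume) k x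
  have hk3 : ∀ y, ∫⁻ x, k (y - x) = K := fun y => lintegral_sub_left_eq_self k y
  have hka : ∀ x, Measurable fun y => k (y - x) := fun x => hkm.comp (measurable_id.sub_const x)
  have hkb : ∀ y, Measurable fun x => k (y - x) := fun y =>
    hkm.comp (measurable_const.sub measurable_id)
  have hS1 : ∫⁻ x, S.indicator 1 x = volume S := lintegral_indicator_one hS
  have hm : Measurable fun q : 𝔼 × 𝔼 => S.indicator 1 q.2 * k (q.2 - q.1) :=
    (hind.comp measurable_snd).mul (hkm.comp (measurable_snd.sub measurable_fst))
  unfold gagliardoEnergy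
  rw [Measure.restrict_univ]
  calc ∫⁻ x, ∫⁻ y, ENNReal.ofReal (|v y - v x| ^ p / ‖y - x‖ ^ (α * p))
      ≤ ∫⁻ x, ∫⁻ y, ENNReal.ofReal (H ^ p) *
        (S.indicator 1 x * k (y - x) + S.indicator 1 y * k (y - x)) :=
        lintegral_mono fun x => lintegral_mono fun y => hpt x y
    _ = ENNReal.ofReal (H ^ p) * ∫⁻ x, (S.indicator 1 x * K +
          ∫⁻ y, S.indicator 1 y * k (y - x)) := by
        rw [← lintegral_const_mul' _ _ ENNReal.ofReal_ne_top]
        refine lintegral_congr fun x => ?_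
        rw [lintegral_const_mul' _ _ ENNReal.ofReal_ne_top, lintegral_add_left
          ((hka x).const_mul _), lintegral_const_mul _ (hka x), hk2]
    _ = ENNReal.ofReal (H ^ p) * (volume S * K + volume S * K) := by
        rw [lintegral_add_left (hind.mul_const _), lintegral_mul_const _ hind, hS1,
          lintegral_lintegral_swap hm.aemeasurable]
        congr 2
        rw [← hS1, ← lintegral_mul_const _ hind]
        refine lintegral_congr fun y => ?_
        rw [lintegral_const_mul _ (hkb y), hk3]

/-- The Lipschitz constant serves at distances at most 1, where t ≤ t^α, and the supremum bound
serves beyond. -/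
lemma exists_holder_of_lipschitz {α : ℝ} (hα₀ : 0 < α) (hα₁ : α ≤ 1) {v : 𝔼 → ℝ} {L : NNReal}
    (hL : LipschitzWith L v) (hv : HasCompactSupport v) :
    ∃ H : ℝ, 0 ≤ H ∧ (∀ x y, |v y - v x| ≤ H * ‖y - x‖ ^ α) ∧ ∀ x y, |v y - v x| ≤ H := by
  obtain ⟨M, hM⟩ := hv.exists_bound_of_continuous hL.continuous
  have hM0 : 0 ≤ M := (norm_nonneg _).trans (hM 0)
  have hb : ∀ x y, |v y - v x| ≤ 2 * M := fun x y => by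
    have := hM x; have := hM y
    rw [Real.norm_eq_abs] at *
    have := abs_sub (v y) (v x)
    linarith
  refine ⟨max L (2 * M), by positivity, fun x y => ?_, fun x y => (hb x y).trans (le_max_right _ _)⟩
  rcases le_total ‖y - x‖ 1 with h | h
  · calc |v y - v x| ≤ L * ‖y - x‖ := by
          have := hL.dist_le_mul y x
          rwa [Real.dist_eq, dist_eq_norm] at this
      _ ≤ max (L : ℝ) (2 * M) * ‖y - x‖ ^ α := by
          gcongr
          · exact le_max_left _ _
          · rcases (norm_nonneg (y - x)).eq_or_lt with h0 | h0
            · rw [← h0, Real.zero_rpow hα₀.ne']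
            · simpa using Real.rpow_le_rpow_of_exponent_ge h0 h hα₁
  · calc |v y - v x| ≤ 2 * M * 1 := by simpa using hb x y
      _ ≤ max (L : ℝ) (2 * M) * ‖y - x‖ ^ α := by
          gcongr
          · exact le_max_right _ _
          · exact Real.one_le_rpow h hα₀.le

lemma gagliardoEnergy_ne_top_of_lipschitz (hn : 1 ≤ n) {α p : ℝ} (hα₀ : 0 < α) (hα₁ : α ≤ 1)
    (hp : 0 < p) (hαp : 2 * (n : ℝ) ≤ α * p) {v : 𝔼 → ℝ} {L : NNReal} (hL : LipschitzWith L v)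
    (hv : HasCompactSupport v) : gagliardoEnergy univ p (α * p) v ≠ ∞ := by
  obtain ⟨H, hH, h1, h2⟩ := exists_holder_of_lipschitz hα₀ hα₁ hL hv
  obtain ⟨C, hC, h⟩ := exists_gagliardoEnergy_le_of_holder hn (isClosed_tsupport v).measurableSet
    hv.isCompact.measure_lt_top.ne one_pos α
  refine ne_top_of_le_ne_top (by finiteness) (h p H hp hαp hH v
    (fun x hx => image_eq_zero_of_notMem_tsupport hx) h1 fun x y => ?_)
  rw [Real.one_rpow, mul_one]
  exact h2 x y

lemma IsTestFunction.exists_lipschitz {Ω : Set 𝔼} {φ : 𝔼 → ℝ} (h : IsTestFunction Ω φ) :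
    ∃ L, LipschitzWith L φ :=
  h.1.lipschitzWith_of_hasCompactSupport h.2.1 (by simp)

lemma firstEigenvalue_ne_top (hn : 1 ≤ n) {α p : ℝ} (hα₀ : 0 < α) (hα₁ : α ≤ 1)
    (hp : 0 < p) (hαp : 2 * (n : ℝ) ≤ α * p) {Ω : Set 𝔼} (hΩ : IsOpen Ω) (hne : Ω.Nonempty) :
    firstEigenvalue Ω α p ≠ ∞ := by
  obtain ⟨x, hx⟩ := hne
  obtain ⟨f, hf1, hf2, hf3, -, hf4⟩ := exists_contDiff_tsupport_subset (n := ⊤) (hΩ.mem_nhds hx)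
  have hf : IsTestFunction Ω f := ⟨hf3, hf2, hf1⟩
  have hf0 : f ≠ 0 := fun h => by simp [h] at hf4
  refine ne_top_of_le_ne_top ?_ (sInf_le ⟨f, hf, hf0, rfl⟩)
  obtain ⟨L, hL⟩ := hf.exists_lipschitz
  refine ENNReal.div_ne_top (gagliardoEnergy_ne_top_of_lipschitz hn hα₀ hα₁ hp hαp hL hf2) ?_
  rw [Ne, powerIntegral_eq_zero_iff hp hL.continuous]
  exact hf0

lemma firstEigenvalue_mul_le_of_isTestFunction {α p : ℝ} (hp : 0 < p) {Ω : Set 𝔼} {φ : 𝔼 → ℝ}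
    (hφ : IsTestFunction Ω φ) :
    firstEigenvalue Ω α p * powerIntegral univ p φ ≤ gagliardoEnergy univ p (α * p) φ := by
  have hc := hφ.1.continuous
  by_cases h0 : φ = 0
  · rw [(powerIntegral_eq_zero_iff hp hc).2 h0, mul_zero]; exact zero_le
  · have h := (powerIntegral_eq_zero_iff hp hc).not.2 h0
    exact (ENNReal.le_div_iff_mul_le (Or.inl h) (Or.inl (powerIntegral_ne_top hp hc hφ.2.1))).1
      (sInf_le ⟨φ, hφ, h0, rfl⟩)

/-! ### The Rayleigh inequality beyond test functions -/

/-- Mollifications with small radius are test functions of no larger energy. Fatou's lemma on the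
power integral suffices, so no convergence of energies is needed. -/
lemma firstEigenvalue_mul_le_of_tsupport_subset {α p : ℝ} (hp : 1 < p) {Ω : Set 𝔼}
    (hΩ : IsOpen Ω) (hfin : firstEigenvalue Ω α p ≠ ∞) {v : 𝔼 → ℝ} (hv : Continuous v)
    (hc : HasCompactSupport v) (hs : tsupport v ⊆ Ω) :
    firstEigenvalue Ω α p * powerIntegral univ p v ≤ gagliardoEnergy univ p (α * p) v := by
  obtain ⟨δ, hδ, hsub⟩ := hc.isCompact.exists_cthickening_subset_open hΩ hs
  have hev : ∀ᶠ i : ℕ in atTop, firstEigenvalue Ω α p *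
      powerIntegral univ p (mollify (shrinkingBump i) v) ≤ gagliardoEnergy univ p (α * p) v := by
    filter_upwards [(tendsto_rOut_shrinkingBump (n := n)).eventually (gt_mem_nhds hδ)] with i hi
    refine (firstEigenvalue_mul_le_of_isTestFunction (by linarith) ⟨contDiff_mollify _ hv,
      hasCompactSupport_mollify _ hc, (tsupport_mollify_subset _ v).trans
        ((Metric.cthickening_mono hi.le _).trans hsub)⟩).trans ?_
    exact gagliardoEnergy_mollify_le _ hv hp _
  calc _ ≤ firstEigenvalue Ω α p *
        liminf (fun i => powerIntegral univ p (mollify (shrinkingBump i) v)) atTop := by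
        gcongr
        exact powerIntegral_le_liminf (by linarith)
          (fun i => (contDiff_mollify _ hv).continuous) (tendsto_mollify_shrinkingBump hv)
    _ = liminf (fun i => firstEigenvalue Ω α p *
        powerIntegral univ p (mollify (shrinkingBump i) v)) atTop :=
        (ENNReal.liminf_const_mul_of_ne_top hfin).symm
    _ ≤ _ := liminf_le_of_frequently_le' hev.frequently

/-- Soft thresholding of real numbers at level `ε`. -/
noncomputable def softThreshold (ε t : ℝ) : ℝ := t - max (-ε) (min t ε)

lemma abs_softThreshold_sub_le {ε : ℝ} (s t : ℝ) :
    |softThreshold ε t - softThreshold ε s| ≤ |t - s| := by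
  unfold softThreshold
  rw [abs_le]
  constructor <;>
  cases abs_cases (t - s) <;> cases max_cases (-ε) (min t ε) <;> cases max_cases (-ε) (min s ε) <;>
    cases min_cases t ε <;> cases min_cases s ε <;> linarith

lemma softThreshold_eq_zero {ε t : ℝ} (h : |t| ≤ ε) : softThreshold ε t = 0 := by
  obtain ⟨h1, h2⟩ := abs_le.1 h
  rw [softThreshold, min_eq_left h2, max_eq_right h1, sub_self]

lemma abs_softThreshold_sub_self_le {ε : ℝ} (hε : 0 ≤ ε) (t : ℝ) :
    |softThreshold ε t - t| ≤ ε := by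
  unfold softThreshold
  rw [abs_le]
  constructor <;>
  cases max_cases (-ε) (min t ε) <;> cases min_cases t ε <;> linarith

lemma continuous_softThreshold (ε : ℝ) : Continuous (softThreshold ε) := by
  unfold softThreshold; fun_prop

lemma MemCZeroClosure.hasCompactSupport {Ω : Set 𝔼} {v : 𝔼 → ℝ} (hv : MemCZeroClosure Ω v)
    (hb : Bornology.IsBounded Ω) : HasCompactSupport v :=
  HasCompactSupport.intro hb.isCompact_closure fun x hx => hv.2 x fun h => hx (subset_closure h)

/-- The Rayleigh inequality extends from test functions to `C_0(closure Ω)`. -/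
lemma firstEigenvalue_mul_le {α p : ℝ} (hp : 1 < p) {Ω : Set 𝔼}
    (hΩ : IsOpen Ω) (hb : Bornology.IsBounded Ω) (hfin : firstEigenvalue Ω α p ≠ ∞) {v : 𝔼 → ℝ}
    (hv : MemCZeroClosure Ω v) :
    firstEigenvalue Ω α p * powerIntegral univ p v ≤ gagliardoEnergy univ p (α * p) v := by
  -- Thresholding removes the values of modulus at most 1/(i+1), so the support becomes compact
  -- inside Ω. Being 1-Lipschitz, it does not increase the energy.
  set w : ℕ → 𝔼 → ℝ := fun i x => softThreshold (1 / ((i : ℝ) + 1)) (v x) with hw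
  have hwc : ∀ i, Continuous (w i) := fun i => (continuous_softThreshold _).comp hv.1
  have hws : ∀ i, tsupport (w i) ⊆ {x | 1 / ((i : ℝ) + 1) ≤ |v x|} := fun i => by
    refine closure_minimal (fun x hx => ?_) (isClosed_le continuous_const hv.1.abs)
    by_contra h
    exact hx (softThreshold_eq_zero (not_le.1 h).le)
  have hwΩ : ∀ i, tsupport (w i) ⊆ Ω := fun i x hx => by
    by_contra h
    have h1 := hws i hx
    rw [mem_ofPred_eq, hv.2 x h, abs_zero] at h1
    have : (0 : ℝ) < 1 / ((i : ℝ) + 1) := by positivity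
    linarith
  have hE : ∀ i, firstEigenvalue Ω α p * powerIntegral univ p (w i) ≤
      gagliardoEnergy univ p (α * p) v := fun i => by
    refine (firstEigenvalue_mul_le_of_tsupport_subset hp hΩ hfin (hwc i) ?_ (hwΩ i)).trans ?_
    · exact HasCompactSupport.intro hb.isCompact_closure fun x hx =>
        image_eq_zero_of_notMem_tsupport fun h => hx (subset_closure (hwΩ i h))
    · exact gagliardoEnergy_mono (by linarith) fun x y => abs_softThreshold_sub_le _ _
  have hlim : ∀ x, Tendsto (fun i => w i x) atTop (𝓝 (v x)) := fun x => by
    rw [tendsto_iff_dist_tendsto_zero]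
    refine squeeze_zero (fun _ => dist_nonneg) (fun i => ?_) tendsto_one_div_add_atTop_nhds_zero_nat
    rw [Real.dist_eq]
    exact abs_softThreshold_sub_self_le (by positivity) _
  calc _ ≤ firstEigenvalue Ω α p * liminf (fun i => powerIntegral univ p (w i)) atTop := by
        gcongr
        exact powerIntegral_le_liminf (by linarith) hwc hlim
    _ = liminf (fun i => firstEigenvalue Ω α p * powerIntegral univ p (w i)) atTop :=
        (ENNReal.liminf_const_mul_of_ne_top hfin).symm
    _ ≤ _ := liminf_le_of_frequently_le' (Frequently.of_forall hE)

/-! ### Morrey's inequality -/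

lemma mul_volume_mul_volume_le_gagliardoEnergy {D B₁ B₂ : Set 𝔼} (h1 : B₁ ⊆ D) (h2 : B₂ ⊆ D)
    (m1 : MeasurableSet B₁) (m2 : MeasurableSet B₂) {p b c : ℝ} {u : 𝔼 → ℝ}
    (h : ∀ x ∈ B₁, ∀ y ∈ B₂, c ≤ |u y - u x| ^ p / ‖y - x‖ ^ b) :
    ENNReal.ofReal c * volume B₂ * volume B₁ ≤ gagliardoEnergy D p b u := by
  calc ENNReal.ofReal c * volume B₂ * volume B₁
      = ∫⁻ _ in B₁, ∫⁻ _ in B₂, ENNReal.ofReal c := by rw [setLIntegral_const, setLIntegral_const]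
    _ ≤ ∫⁻ x in B₁, ∫⁻ y in B₂, ENNReal.ofReal (|u y - u x| ^ p / ‖y - x‖ ^ b) :=
        setLIntegral_mono' m1 fun x hx => setLIntegral_mono' m2 fun y hy =>
          ENNReal.ofReal_le_ofReal (h x hx y hy)
    _ ≤ ∫⁻ x in D, ∫⁻ y in B₂, ENNReal.ofReal (|u y - u x| ^ p / ‖y - x‖ ^ b) :=
        lintegral_mono_set h1
    _ ≤ _ := lintegral_mono fun x => lintegral_mono_set h2

lemma volume_ball_eq (x : 𝔼) {r : ℝ} (hr : 0 < r) :
    volume (Metric.ball x r) = ENNReal.ofReal (r ^ n * (volume (Metric.ball (0 : 𝔼) 1)).toReal) := by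
  rw [Measure.addHaar_ball_of_pos _ _ hr, finrank_euclideanSpace, Fintype.card_fin,
    ENNReal.ofReal_mul (by positivity), ENNReal.ofReal_toReal measure_ball_lt_top.ne]

lemma volume_ball_toReal_pos : 0 < (volume (Metric.ball (0 : 𝔼) 1)).toReal :=
  ENNReal.toReal_pos (Metric.measure_ball_pos _ _ one_pos).ne' measure_ball_lt_top.ne

/-- The homothety with centre x and ratio t maps the convex ball into itself. So even a point x of
the bounding sphere has, close to it, a ball of comparable size inside the given one. -/
lemma ball_homothety_subset {z x : 𝔼} {r t : ℝ} (hx : x ∈ Metric.closedBall z r) (ht : 0 < t)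
    (ht1 : t ≤ 1) :
    Metric.ball (x + t • (z - x)) (t * r) ⊆ Metric.ball z r ∩ Metric.ball x (2 * (t * r)) := by
  intro w hw
  rw [mem_ball_iff_norm] at hw
  rw [mem_closedBall_iff_norm] at hx
  rw [mem_inter_iff, mem_ball_iff_norm, mem_ball_iff_norm]
  constructor
  · calc ‖w - z‖ = ‖(w - (x + t • (z - x))) + (1 - t) • (x - z)‖ := by congr 1; module
      _ ≤ ‖w - (x + t • (z - x))‖ + (1 - t) * ‖x - z‖ := by
          refine (norm_add_le _ _).trans_eq ?_
          rw [norm_smul, Real.norm_of_nonneg (by linarith)]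
      _ < t * r + (1 - t) * r := by
          have := mul_le_mul_of_nonneg_left hx (sub_nonneg.2 ht1)
          linarith
      _ = r := by ring
  · calc ‖w - x‖ = ‖(w - (x + t • (z - x))) + t • (z - x)‖ := by congr 1; module
      _ ≤ ‖w - (x + t • (z - x))‖ + t * ‖x - z‖ := by
          refine (norm_add_le _ _).trans_eq ?_
          rw [norm_smul, Real.norm_of_nonneg ht.le, norm_sub_rev z x]
      _ < 2 * (t * r) := by
          have := mul_le_mul_of_nonneg_left hx ht.le
          linarith

/-- The volume factor in the Morrey inequality. -/
noncomputable def morreyVolume (n : ℕ) (β : ℝ) : ℝ :=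
  (((8 : ℝ) ^ (-(1 / β)) / 2) ^ n * (volume (Metric.ball (0 : EuclideanSpace ℝ (Fin n)) 1)).toReal) ^ 2

lemma morreyVolume_pos (n : ℕ) (β : ℝ) : 0 < morreyVolume n β := by
  have := volume_ball_toReal_pos (n := n)
  unfold morreyVolume
  positivity

lemma morreyVolume_mono (n : ℕ) {β β' : ℝ} (hβ : 0 < β) (h : β ≤ β') :
    morreyVolume n β ≤ morreyVolume n β' := by
  have := volume_ball_toReal_pos (n := n)
  unfold morreyVolume
  gcongr
  · norm_num

/-- The constant in the Morrey inequality. -/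
noncomputable def morreyConst (n : ℕ) (α β : ℝ) : ℝ := 2 * 3 ^ α * max 1 (morreyVolume n β)⁻¹

lemma morreyConst_pos (n : ℕ) (α β : ℝ) : 0 < morreyConst n α β := by
  unfold morreyConst; positivity

/-- The constant can degenerate only as β → 0. A lower bound on β = α - 2n/p therefore gives a bound
uniform in p. -/
lemma morreyConst_anti (n : ℕ) {α β β' : ℝ} (hβ : 0 < β) (h : β ≤ β') :
    morreyConst n α β' ≤ morreyConst n α β := by
  have := morreyVolume_pos n β
  have := morreyVolume_mono n hβ h
  unfold morreyConst
  gcongr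

/-- Let the pair x, y nearly attain the Hölder seminorm H, and put d = |y - x|. By the seminorm
bound itself, φ oscillates by at most H d^β / 8 between each of x, y and a nearby ball of radius
comparable to d. So differences across the two balls are still at least H d^β / 2, at distances at
most 3d. The volume factor d^(2n) is compensated exactly by β p = α p - 2n. -/
lemma morrey_of_almost_extremal {α β p r H : ℝ} {z x y : 𝔼} {φ : 𝔼 → ℝ} (hα : 0 < α)
    (hp : 1 < p) (hβ : 0 < β) (hβp : β * p = α * p - 2 * n) (hr : 0 < r) (hH : 0 < H)
    (hφ : ∀ x ∈ Metric.closedBall z r, ∀ y ∈ Metric.closedBall z r,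
      |φ y - φ x| ≤ H * ‖y - x‖ ^ β)
    (hx : x ∈ Metric.closedBall z r) (hy : y ∈ Metric.closedBall z r)
    (hxy : 3 / 4 * H * ‖y - x‖ ^ β ≤ |φ y - φ x|) (hne : x ≠ y) :
    ENNReal.ofReal ((H / (2 * 3 ^ α)) ^ p * morreyVolume n β) ≤
      gagliardoEnergy (Metric.ball z r) p (α * p) φ := by
  set d := ‖y - x‖ with hd
  -- The radius factor for which κ^β = 1/8: two oscillations of 1/8 leave 1/2 of the initial 3/4.
  set κ : ℝ := (8 : ℝ) ^ (-(1 / β)) with hκ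
  have hd0 : 0 < d := norm_pos_iff.2 (sub_ne_zero.2 hne.symm)
  have hκ0 : 0 < κ := by positivity
  have hκ1 : κ ≤ 1 := Real.rpow_le_one_of_one_le_of_nonpos (by norm_num)
    (neg_nonpos.2 (by positivity))
  have hκβ : κ ^ β = 1 / 8 := by
    rw [hκ, ← Real.rpow_mul (by norm_num), neg_mul, one_div_mul_cancel hβ.ne', Real.rpow_neg_one]
    norm_num
  have hd2 : d ≤ 2 * r := by
    have h1 := mem_closedBall_iff_norm.1 hx
    have h2 := mem_closedBall_iff_norm.1 hy
    calc d = ‖(y - z) - (x - z)‖ := by rw [sub_sub_sub_cancel_right]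
      _ ≤ _ := norm_sub_le _ _
      _ ≤ 2 * r := by linarith
  set t := κ * d / (2 * r) with ht
  have ht0 : 0 < t := by positivity
  have ht1 : t ≤ 1 := by
    rw [ht, div_le_one (by positivity)]
    nlinarith
  have htr : t * r = κ / 2 * d := by rw [ht]; field_simp
  have hB1 := ball_homothety_subset hx ht0 ht1
  have hB2 := ball_homothety_subset hy ht0 ht1
  rw [htr] at hB1 hB2
  have hlow : ∀ x' ∈ Metric.ball (x + t • (z - x)) (κ / 2 * d),
      ∀ y' ∈ Metric.ball (y + t • (z - y)) (κ / 2 * d),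
      (H / (2 * 3 ^ α)) ^ p / (d ^ n) ^ 2 ≤ |φ y' - φ x'| ^ p / ‖y' - x'‖ ^ (α * p) := by
    intro x' hx' y' hy'
    obtain ⟨hx1, hx2⟩ := hB1 hx'
    obtain ⟨hy1, hy2⟩ := hB2 hy'
    have hx3 : ‖x' - x‖ ≤ κ * d := by
      have := mem_ball_iff_norm.1 hx2; linarith
    have hy3 : ‖y' - y‖ ≤ κ * d := by
      have := mem_ball_iff_norm.1 hy2; linarith
    have hosc : ∀ a b : 𝔼, a ∈ Metric.closedBall z r → b ∈ Metric.closedBall z r →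
        ‖b - a‖ ≤ κ * d → |φ b - φ a| ≤ H * d ^ β / 8 := by
      intro a b ha hb hab
      calc |φ b - φ a| ≤ H * ‖b - a‖ ^ β := hφ a ha b hb
        _ ≤ H * (κ * d) ^ β := by gcongr
        _ = H * d ^ β / 8 := by rw [Real.mul_rpow hκ0.le hd0.le, hκβ]; ring
    have o1 := hosc x x' hx (Metric.ball_subset_closedBall hx1) hx3
    have o2 := hosc y y' hy (Metric.ball_subset_closedBall hy1) hy3
    have o3 : H / 2 * d ^ β ≤ |φ y' - φ x'| := by
      have : |φ y - φ x| ≤ |φ y' - φ x'| + |φ y' - φ y| + |φ x' - φ x| := by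
        have e : φ y - φ x = (φ y' - φ x') - (φ y' - φ y) + (φ x' - φ x) := by ring
        rw [e]
        exact (abs_add_le _ _).trans (by gcongr; exact abs_sub _ _)
      linarith
    have o4 : ‖y' - x'‖ ≤ 3 * d := by
      calc ‖y' - x'‖ = ‖(y' - y) + (y - x) - (x' - x)‖ := by congr 1; abel
        _ ≤ ‖y' - y‖ + ‖y - x‖ + ‖x' - x‖ :=
            (norm_sub_le _ _).trans (by gcongr; exact norm_add_le _ _)
        _ ≤ κ * d + d + κ * d := by gcongr
        _ ≤ 3 * d := by nlinarith
    have o5 : 0 < ‖y' - x'‖ := by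
      refine norm_pos_iff.2 (sub_ne_zero.2 fun h => ?_)
      rw [h, sub_self, abs_zero] at o3
      have : 0 < H / 2 * d ^ β := by positivity
      linarith
    have e1 : (H / (2 * 3 ^ α)) ^ p / (d ^ n) ^ 2 = (H / 2 * d ^ β) ^ p / (3 * d) ^ (α * p) := by
      have e2 : (d ^ n) ^ 2 * d ^ (β * p) = d ^ (α * p) := by
        rw [hβp, ← pow_mul, ← Real.rpow_natCast, ← Real.rpow_add hd0]
        congr 1
        push_cast
        ring
      have e3 : (3 * d) ^ (α * p) = (3 ^ α) ^ p * d ^ (α * p) := by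
        rw [Real.mul_rpow (by norm_num) hd0.le, Real.rpow_mul (by norm_num) α p]
      rw [e3, ← e2, Real.mul_rpow (by positivity) (by positivity), ← Real.rpow_mul hd0.le,
        Real.div_rpow hH.le (by positivity), Real.div_rpow hH.le (by positivity),
        Real.mul_rpow (by positivity) (by positivity)]
      have : 0 < d ^ (β * p) := by positivity
      field_simp
    rw [e1]
    gcongr
  have h := mul_volume_mul_volume_le_gagliardoEnergy (hB1.trans inter_subset_left)
    (hB2.trans inter_subset_left) measurableSet_ball measurableSet_ball hlow
  refine le_trans (le_of_eq ?_) h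
  have hω := volume_ball_toReal_pos (n := n)
  rw [volume_ball_eq (x + t • (z - x)) (by positivity),
    volume_ball_eq (y + t • (z - y)) (by positivity),
    ← ENNReal.ofReal_mul (by positivity), ← ENNReal.ofReal_mul (by positivity)]
  congr 1
  unfold morreyVolume
  rw [← hκ, mul_pow (κ / 2) d n]
  field_simp

/-- Morrey's inequality on a ball, for functions already known to be Hölder continuous. -/
lemma morrey_on_ball {α β p r H₀ e : ℝ} {z : 𝔼} {φ : 𝔼 → ℝ} (hα : 0 < α)
    (hp : 1 < p) (hβ : 0 < β) (hβp : β * p = α * p - 2 * n) (hr : 0 < r)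
    (hφ : ∀ x ∈ Metric.closedBall z r, ∀ y ∈ Metric.closedBall z r,
      |φ y - φ x| ≤ H₀ * ‖y - x‖ ^ β) (he : 0 ≤ e)
    (hE : gagliardoEnergy (Metric.ball z r) p (α * p) φ ≤ ENNReal.ofReal (e ^ p)) :
    ∀ x ∈ Metric.closedBall z r, ∀ y ∈ Metric.closedBall z r,
      |φ y - φ x| ≤ morreyConst n α β * e * ‖y - x‖ ^ β := by
  set S : Set ℝ := {q | ∃ x ∈ Metric.closedBall z r, ∃ y ∈ Metric.closedBall z r, x ≠ y ∧
    q = |φ y - φ x| / ‖y - x‖ ^ β} with hS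
  have hpos : ∀ {x y : 𝔼}, x ≠ y → 0 < ‖y - x‖ ^ β := fun h =>
    Real.rpow_pos_of_pos (norm_pos_iff.2 (sub_ne_zero.2 h.symm)) _
  -- The a priori constant H₀ only makes the supremum finite; it does not enter the final bound.
  have hbdd : BddAbove S := by
    refine ⟨H₀, ?_⟩
    rintro q ⟨x, hx, y, hy, hne, rfl⟩
    rw [div_le_iff₀ (hpos hne)]
    exact hφ x hx y hy
  set H := sSup S with hH
  have hval : ∀ x ∈ Metric.closedBall z r, ∀ y ∈ Metric.closedBall z r,
      |φ y - φ x| ≤ H * ‖y - x‖ ^ β := by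
    intro x hx y hy
    by_cases hne : x = y
    · simp [hne, hβ.ne']
    · rw [← div_le_iff₀ (hpos hne)]
      exact le_csSup hbdd ⟨x, hx, y, hy, hne, rfl⟩
  suffices hHe : H ≤ morreyConst n α β * e by
    intro x hx y hy
    exact (hval x hx y hy).trans (by gcongr)
  rcases le_or_gt H 0 with h0 | h0
  · exact h0.trans (mul_nonneg (morreyConst_pos n α β).le he)
  have hne : S.Nonempty := by
    by_contra h
    rw [not_nonempty_iff_eq_empty] at h
    rw [hH, h, Real.sSup_empty] at h0
    exact lt_irrefl _ h0
  obtain ⟨q, ⟨x, hx, y, hy, hxy, rfl⟩, hq⟩ := exists_lt_of_lt_csSup hne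
    (show 3 / 4 * H < sSup S by rw [← hH]; linarith)
  have h1 := (morrey_of_almost_extremal hα hp hβ hβp hr h0 hval hx hy
    ((lt_div_iff₀ (hpos hxy)).1 hq).le hxy).trans hE
  have hV := morreyVolume_pos n β
  rw [ENNReal.ofReal_le_ofReal_iff (by positivity), ← le_div_iff₀ hV] at h1
  -- Because m ≥ 1, the inverse volume is at most m ≤ m^p, so taking the p-th root leaves a factor m
  -- free of p.
  set m := max 1 (morreyVolume n β)⁻¹ with hm
  have hm1 : 1 ≤ m := le_max_left _ _
  have h2 : (H / (2 * 3 ^ α)) ^ p ≤ (m * e) ^ p := by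
    calc (H / (2 * 3 ^ α)) ^ p ≤ (morreyVolume n β)⁻¹ * e ^ p := by
          rw [inv_mul_eq_div]; exact h1
      _ ≤ m ^ p * e ^ p := by
          gcongr
          calc (morreyVolume n β)⁻¹ ≤ m := le_max_right _ _
            _ = m ^ (1 : ℝ) := (Real.rpow_one _).symm
            _ ≤ m ^ p := Real.rpow_le_rpow_of_exponent_le hm1 hp.le
      _ = _ := (Real.mul_rpow (by positivity) he).symm
  have h3 := (Real.rpow_le_rpow_iff (by positivity) (by positivity) (by linarith)).1 h2
  rw [div_le_iff₀ (by positivity)] at h3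
  unfold morreyConst
  rw [← hm]
  linarith

lemma LipschitzWith.exists_holder_closedBall {φ : 𝔼 → ℝ} {L : NNReal} (hL : LipschitzWith L φ)
    {β r : ℝ} (hβ : 0 < β) (hβ1 : β ≤ 1) (z : 𝔼) :
    ∃ H, ∀ x ∈ Metric.closedBall z r, ∀ y ∈ Metric.closedBall z r,
      |φ y - φ x| ≤ H * ‖y - x‖ ^ β := by
  refine ⟨L * (2 * r) ^ (1 - β), fun x hx y hy => ?_⟩
  have h1 : |φ y - φ x| ≤ L * ‖y - x‖ := by
    have := hL.dist_le_mul y x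
    rwa [Real.dist_eq, dist_eq_norm] at this
  rcases (norm_nonneg (y - x)).eq_or_lt with h0 | h0
  · rw [← h0, Real.zero_rpow hβ.ne', mul_zero]
    simpa [← h0] using h1
  have hd2 : ‖y - x‖ ≤ 2 * r := by
    have h1 := mem_closedBall_iff_norm.1 hx
    have h2 := mem_closedBall_iff_norm.1 hy
    calc ‖y - x‖ = ‖(y - z) - (x - z)‖ := by rw [sub_sub_sub_cancel_right]
      _ ≤ _ := _root_.norm_sub_le _ _
      _ ≤ 2 * r := by linarith
  calc |φ y - φ x| ≤ L * ‖y - x‖ := h1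
    _ = L * (‖y - x‖ ^ (1 - β) * ‖y - x‖ ^ β) := by
        rw [← Real.rpow_add h0]; simp
    _ ≤ L * ((2 * r) ^ (1 - β) * ‖y - x‖ ^ β) := by
        gcongr
    _ = _ := by ring

/-- Morrey's inequality on the whole space for continuous functions with compact support. -/
lemma morrey_whole_space {α β p e : ℝ} {v : 𝔼 → ℝ} (hα : 0 < α)
    (hp : 1 < p) (hβ : 0 < β) (hβ1 : β ≤ 1) (hβp : β * p = α * p - 2 * n) (hv : Continuous v)
    (hc : HasCompactSupport v) (he : 0 ≤ e)
    (hE : gagliardoEnergy univ p (α * p) v ≤ ENNReal.ofReal (e ^ p)) (x y : 𝔼) :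
    |v y - v x| ≤ morreyConst n α β * e * ‖y - x‖ ^ β := by
  have key : ∀ i : ℕ, |mollify (shrinkingBump i) v y - mollify (shrinkingBump i) v x| ≤
      morreyConst n α β * e * ‖y - x‖ ^ β := by
    intro i
    obtain ⟨L, hL⟩ := (contDiff_mollify (shrinkingBump i) hv).lipschitzWith_of_hasCompactSupport
      (hasCompactSupport_mollify _ hc) (by simp)
    set r := ‖y - x‖ + 1
    obtain ⟨H, hH⟩ := hL.exists_holder_closedBall (r := r) hβ hβ1 x
    refine morrey_on_ball hα hp hβ hβp (by positivity) hH he ?_ x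
      (Metric.mem_closedBall_self (by positivity)) y (by simp [r, dist_eq_norm])
    exact (gagliardoEnergy_mono_set (subset_univ _) _ _ _).trans
      ((gagliardoEnergy_mollify_le _ hv hp _).trans hE)
  exact le_of_tendsto ((tendsto_mollify_shrinkingBump hv y).sub
    (tendsto_mollify_shrinkingBump hv x)).abs (Eventually.of_forall key)

/-! ### The inradius, and continuous representatives -/

lemma nonempty_compl_of_isBounded (hn : 1 ≤ n) {Ω : Set 𝔼} (hb : Bornology.IsBounded Ω) :
    (Ωᶜ).Nonempty := by
  have : Nonempty (Fin n) := ⟨⟨0, hn⟩⟩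
  by_contra h
  rw [not_nonempty_iff_eq_empty, compl_empty_iff] at h
  exact NormedSpace.unbounded_univ ℝ 𝔼 (h ▸ hb)

lemma bddAbove_infDist_compl (hn : 1 ≤ n) {Ω : Set 𝔼} (hb : Bornology.IsBounded Ω) :
    BddAbove ((fun x => Metric.infDist x Ωᶜ) '' Ω) := by
  obtain ⟨z, hz⟩ := nonempty_compl_of_isBounded hn hb
  obtain ⟨ρ, hρ⟩ := hb.subset_closedBall z
  refine ⟨ρ, ?_⟩
  rintro _ ⟨x, hx, rfl⟩
  exact (Metric.infDist_le_dist_of_mem hz).trans (hρ hx)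

lemma inradius_pos (hn : 1 ≤ n) {Ω : Set 𝔼} (hΩ : IsOpen Ω) (hne : Ω.Nonempty)
    (hb : Bornology.IsBounded Ω) : 0 < inradius Ω := by
  obtain ⟨x, hx⟩ := hne
  have : 0 < Metric.infDist x Ωᶜ :=
    (hΩ.isClosed_compl.notMem_iff_infDist_pos (nonempty_compl_of_isBounded hn hb)).1
      (notMem_compl_iff.2 hx)
  exact this.trans_le (le_csSup (bddAbove_infDist_compl hn hb) ⟨x, hx, rfl⟩)

lemma infDist_compl_le_inradius (hn : 1 ≤ n) {Ω : Set 𝔼} (hΩ : IsOpen Ω) (hne : Ω.Nonempty)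
    (hb : Bornology.IsBounded Ω) (x : 𝔼) : Metric.infDist x Ωᶜ ≤ inradius Ω := by
  by_cases hx : x ∈ Ω
  · exact le_csSup (bddAbove_infDist_compl hn hb) ⟨x, hx, rfl⟩
  · rw [Metric.infDist_zero_of_mem (mem_compl hx)]
    exact (inradius_pos hn hΩ hne hb).le

/-- Functions with zero boundary values are controlled by their energy in the domain. -/
lemma abs_le_of_lipschitz_of_eq_zero (hn : 1 ≤ n) {Ω : Set 𝔼} (hΩ : IsOpen Ω) (hne : Ω.Nonempty)
    (hb : Bornology.IsBounded Ω) {α β p e : ℝ} (hα : 0 < α)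
    (hp : 1 < p) (hβ : 0 < β) (hβ1 : β ≤ 1) (hβp : β * p = α * p - 2 * n)
    {φ : 𝔼 → ℝ} {L : NNReal} (hL : LipschitzWith L φ) (h0 : ∀ x, x ∉ Ω → φ x = 0) (he : 0 ≤ e)
    (hE : gagliardoEnergy Ω p (α * p) φ ≤ ENNReal.ofReal (e ^ p)) (x : 𝔼) :
    |φ x| ≤ morreyConst n α β * e * inradius Ω ^ β := by
  have hM := morreyConst_pos n α β
  have hR := inradius_pos hn hΩ hne hb
  by_cases hx : x ∈ Ω
  · have hcn := nonempty_compl_of_isBounded hn hb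
    obtain ⟨z, hz, hzd⟩ := hΩ.isClosed_compl.exists_infDist_eq_dist hcn x
    have hpos : 0 < Metric.infDist x Ωᶜ :=
      (hΩ.isClosed_compl.notMem_iff_infDist_pos hcn).1 (notMem_compl_iff.2 hx)
    obtain ⟨H, hH⟩ := hL.exists_holder_closedBall (r := Metric.infDist x Ωᶜ) hβ hβ1 x
    -- The open ball around x with radius dist(x, Ωᶜ) lies in Ω, and the nearest point z of Ωᶜ,
    -- where φ = 0, lies on its sphere. Hence the energy over Ω suffices, which is all that the norm
    -- of W^{s,p}(Ω) controls.
    have := morrey_on_ball hα hp hβ hβp hpos hH he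
      ((gagliardoEnergy_mono_set Metric.ball_infDist_compl_subset _ _ _).trans hE) z
      (by rw [Metric.mem_closedBall, dist_comm, hzd]) x (Metric.mem_closedBall_self hpos.le)
    rw [h0 z hz, sub_zero, ← dist_eq_norm, ← hzd] at this
    refine this.trans ?_
    have := infDist_compl_le_inradius hn hΩ hne hb x
    gcongr
  · rw [h0 x hx, abs_zero]
    positivity

lemma fracSobolev_exponent {α p : ℝ} (hp : p ≠ 0) : (α - n / p) * p + n = α * p := by
  field_simp
  ring

/-- Elements of the fractional Sobolev space with zero boundary values have representatives in
`C_0(closure Ω)` when the exponent is large. -/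
lemma exists_memCZeroClosure_ae_eq (hn : 1 ≤ n) {Ω : Set 𝔼} (hΩ : IsOpen Ω) (hne : Ω.Nonempty)
    (hb : Bornology.IsBounded Ω) {α β p : ℝ} (hα : 0 < α)
    (hp : 1 < p) (hβ : 0 < β) (hβ1 : β ≤ 1) (hβp : β * p = α * p - 2 * n) {u : 𝔼 → ℝ}
    (hu : MemFracSobolevZero Ω (α - n / p) p u) :
    ∃ v, MemCZeroClosure Ω v ∧ v =ᵐ[volume] u := by
  obtain ⟨⟨hum, -⟩, happ, hu0⟩ := hu
  unfold fracSobolevNormPow at happ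
  rw [fracSobolev_exponent (by linarith : p ≠ 0)] at happ
  set ε : ℕ → ℝ := fun i => 1 / ((i : ℝ) + 1) with hε
  have hε0 : ∀ i, 0 < ε i := fun i => by positivity
  have hεlim : Tendsto ε atTop (𝓝 0) := tendsto_one_div_add_atTop_nhds_zero_nat
  have hεanti : ∀ i j, i ≤ j → ε j ≤ ε i := fun i j h => by
    simp only [hε]; gcongr
  choose φ hφt hφ using fun i => happ (ENNReal.ofReal (ε i ^ p))
    (ENNReal.ofReal_pos.2 (Real.rpow_pos_of_pos (hε0 i) p))
  have hφm : ∀ i, AEMeasurable (φ i) (volume.restrict Ω) := fun i =>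
    (hφt i).1.continuous.measurable.aemeasurable
  have humm := hum.aemeasurable
  have hφ0 : ∀ i x, x ∉ Ω → φ i x = 0 := fun i x hx =>
    image_eq_zero_of_notMem_tsupport fun h => hx ((hφt i).2.2 h)
  set C := morreyConst n α β * inradius Ω ^ β with hC
  have hC0 : 0 ≤ C := by
    have := morreyConst_pos n α β
    have := inradius_pos hn hΩ hne hb
    positivity
  -- The factor 4 comes from 2^p·2·ε^p ≤ (4ε)^p, after splitting the difference through u.
  have hdiff : ∀ i j, i ≤ j → ∀ x, |φ i x - φ j x| ≤ C * (4 * ε i) := by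
    intro i j hij x
    obtain ⟨L1, hL1⟩ := (hφt i).exists_lipschitz
    obtain ⟨L2, hL2⟩ := (hφt j).exists_lipschitz
    have hE : gagliardoEnergy Ω p (α * p) (φ i - φ j) ≤ ENNReal.ofReal ((4 * ε i) ^ p) := by
      have e1 : φ i - φ j = (u - φ j) - (u - φ i) := by abel
      rw [e1]
      refine (gagliardoEnergy_sub_le (by linarith) (humm.sub (hφm j)) (humm.sub (hφm i))).trans ?_
      have h1 := (le_self_add.trans_lt (hφ j)).le
      have h2 := (le_self_add.trans_lt (hφ i)).le
      calc _ ≤ ENNReal.ofReal (2 ^ p) *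
            (ENNReal.ofReal (ε j ^ p) + ENNReal.ofReal (ε i ^ p)) := by gcongr
        _ ≤ ENNReal.ofReal (2 ^ p) *
            (ENNReal.ofReal (ε i ^ p) + ENNReal.ofReal (ε i ^ p)) := by
            have := hεanti i j hij
            have := (hε0 j).le
            gcongr
        _ = ENNReal.ofReal (2 ^ p * (2 * ε i ^ p)) := by
            have := Real.rpow_nonneg (hε0 i).le p
            rw [← ENNReal.ofReal_add this this, ← ENNReal.ofReal_mul (by positivity), two_mul]
        _ ≤ ENNReal.ofReal ((4 * ε i) ^ p) := by
            have := Real.rpow_nonneg (hε0 i).le p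
            have h2p : (2 : ℝ) ≤ 2 ^ p := by
              simpa using Real.rpow_le_rpow_of_exponent_le (by norm_num : (1 : ℝ) ≤ 2) hp.le
            have e4 : (4 : ℝ) ^ p = 2 ^ p * 2 ^ p := by
              rw [← Real.mul_rpow (by norm_num) (by norm_num)]; norm_num
            rw [Real.mul_rpow (by norm_num) (hε0 i).le, e4, mul_assoc]
            gcongr
    have := abs_le_of_lipschitz_of_eq_zero hn hΩ hne hb hα hp hβ hβ1 hβp (hL1.sub hL2)
      (fun x hx => by simp [hφ0 _ x hx]) (by have := hε0 i; positivity) hE x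
    calc |φ i x - φ j x| ≤ _ := this
      _ = _ := by rw [hC]; ring
  have hcauchy : ∀ x, ∃ l, Tendsto (fun i => φ i x) atTop (𝓝 l) := by
    intro x
    refine cauchySeq_tendsto_of_complete (cauchySeq_of_le_tendsto_0' (fun i => C * (4 * ε i))
      (fun i j hij => by rw [Real.dist_eq]; exact hdiff i j hij x) ?_)
    simpa using (hεlim.const_mul 4).const_mul C
  choose v hv using hcauchy
  have hclose : ∀ i x, |φ i x - v x| ≤ C * (4 * ε i) := fun i x =>
    le_of_tendsto ((hv x).const_sub (φ i x)).abs
      (eventually_atTop.2 ⟨i, fun j hij => hdiff i j hij x⟩)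
  have hunif : TendstoUniformly φ v atTop := by
    rw [Metric.tendstoUniformly_iff]
    intro δ hδ
    have hl : Tendsto (fun i => C * (4 * ε i)) atTop (𝓝 0) := by
      simpa using (hεlim.const_mul 4).const_mul C
    filter_upwards [hl.eventually (gt_mem_nhds hδ)] with i hi x
    rw [dist_comm, Real.dist_eq]
    exact (hclose i x).trans_lt hi
  have hvc : Continuous v := hunif.continuous (Frequently.of_forall fun i => (hφt i).1.continuous)
  have hv0 : ∀ x, x ∉ Ω → v x = 0 := fun x hx =>
    tendsto_nhds_unique (hv x) (by simp [hφ0 _ x hx])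
  refine ⟨v, ⟨hvc, hv0⟩, ?_⟩
  -- The uniform limit v is identified with u by Fatou's lemma applied to the power integral of u -
  -- φ_i.
  have hzero : ∫⁻ x in Ω, ENNReal.ofReal (|u x - v x| ^ p) = 0 := by
    refine le_antisymm ?_ zero_le
    calc ∫⁻ x in Ω, ENNReal.ofReal (|u x - v x| ^ p)
        = ∫⁻ x in Ω, liminf (fun i => ENNReal.ofReal (|u x - φ i x| ^ p)) atTop := by
          refine lintegral_congr fun x => (Tendsto.liminf_eq ?_).symm
          exact ENNReal.tendsto_ofReal
            (((hv x).const_sub (u x)).abs.rpow_const (Or.inr (by linarith)))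
      _ ≤ liminf (fun i => ∫⁻ x in Ω, ENNReal.ofReal (|u x - φ i x| ^ p)) atTop :=
          lintegral_liminf_le' fun i => ((humm.sub (hφm i)).abs.pow_const p).ennreal_ofReal
      _ ≤ liminf (fun i => ENNReal.ofReal (ε i ^ p)) atTop :=
          liminf_le_liminf (Eventually.of_forall fun i => (le_add_self.trans_lt (hφ i)).le)
      _ = 0 := by
          refine Tendsto.liminf_eq ?_
          have := ENNReal.tendsto_ofReal (hεlim.rpow_const (p := p) (Or.inr (by linarith)))
          rwa [Real.zero_rpow (by linarith), ENNReal.ofReal_zero] at this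
  have hmeas : AEMeasurable (fun x => ENNReal.ofReal (|u x - v x| ^ p)) (volume.restrict Ω) :=
    ((humm.sub hvc.measurable.aemeasurable).abs.pow_const p).ennreal_ofReal
  rw [lintegral_eq_zero_iff' hmeas, EventuallyEq, ae_restrict_iff' hΩ.measurableSet] at hzero
  filter_upwards [hzero, hu0] with x h1 h2
  by_cases hx : x ∈ Ω
  · have h3 := h1 hx
    simp only [Pi.zero_apply, ENNReal.ofReal_eq_zero] at h3
    have h4 : |u x - v x| ^ p = 0 := le_antisymm h3 (by positivity)
    have h5 := abs_eq_zero.1 ((Real.rpow_eq_zero (abs_nonneg _) (by linarith)).1 h4)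
    linarith
  · rw [hv0 x hx, h2 hx]

/-- The continuous representative of a normalized first eigenfunction. -/
lemma IsFirstEigenfunction.exists_representative (hn : 1 ≤ n) {Ω : Set 𝔼} (hΩ : IsOpen Ω)
    (hne : Ω.Nonempty) (hb : Bornology.IsBounded Ω) {α p : ℝ} (hα₀ : 0 < α) (hα₁ : α ≤ 1)
    (hαp : 2 * (n : ℝ) < α * p) {u : 𝔼 → ℝ} (hu : IsFirstEigenfunction Ω α p u)
    (hnorm : eLpNorm u (ENNReal.ofReal p) volume = 1) :
    ∃ v, MemCZeroClosure Ω v ∧ v =ᵐ[volume] u ∧ (∀ x, 0 ≤ v x) ∧ powerIntegral univ p v = 1 ∧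
      gagliardoEnergy univ p (α * p) v = firstEigenvalue Ω α p := by
  have hn' : (1 : ℝ) ≤ n := by exact_mod_cast hn
  have hp0 : 0 < p := by
    by_contra h
    have := mul_nonpos_of_nonneg_of_nonpos hα₀.le (not_lt.1 h)
    linarith
  have hp2 : 2 < p := by nlinarith
  have hβp : (α - 2 * n / p) * p = α * p - 2 * n := by field_simp
  have hβ : 0 < α - 2 * n / p := by
    have : 0 < (α - 2 * n / p) * p := by rw [hβp]; linarith
    exact pos_of_mul_pos_left this hp0.le
  have hβ1 : α - 2 * n / p ≤ 1 := by
    have : 0 ≤ 2 * n / p := by positivity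
    linarith
  obtain ⟨v, hv, hvu⟩ := exists_memCZeroClosure_ae_eq hn hΩ hne hb hα₀ (by linarith) hβ hβ1 hβp hu.1
  have hP : powerIntegral univ p v = 1 := by
    rw [powerIntegral_congr (v := u) (by rwa [Measure.restrict_univ])]
    rw [eLpNorm_eq_lintegral_rpow_enorm_toReal (by simpa using hp0) ENNReal.ofReal_ne_top,
      ENNReal.toReal_ofReal hp0.le] at hnorm
    replace hnorm := congrArg (· ^ p) hnorm
    rw [← ENNReal.rpow_mul, one_div_mul_cancel hp0.ne', ENNReal.rpow_one, ENNReal.one_rpow] at hnorm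
    rw [powerIntegral, Measure.restrict_univ, ← hnorm]
    refine lintegral_congr fun x => ?_
    rw [← ENNReal.ofReal_rpow_of_nonneg (abs_nonneg _) hp0.le, Real.enorm_eq_ofReal_abs]
  refine ⟨v, hv, hvu, ?_, hP, ?_⟩
  · intro x
    by_contra h
    -- By continuity, a negative value would occur on a set of positive measure, although v = u ≥ 0
    -- almost everywhere.
    have hopen : IsOpen {x | v x < 0} := isOpen_lt hv.1 continuous_const
    have hpos := hopen.measure_pos volume ⟨x, not_le.1 h⟩
    refine hpos.ne' (measure_mono_null (t := {x | ¬ (0 ≤ u x ∧ v x = u x)}) ?_ ?_)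
    · rintro y hy ⟨h1, h2⟩
      rw [mem_ofPred_eq] at hy
      linarith
    · exact ae_iff.1 (hu.2.1.and hvu)
  · have := hu.2.2.2
    rw [rayleighQuotient, ← powerIntegral_congr (u := v) (by rwa [Measure.restrict_univ]),
      ← gagliardoEnergy_congr (u := v) (by rwa [Measure.restrict_univ]), hP, div_one] at this
    exact this

/-! ### Upper growth rate of the first eigenvalue -/

/-- Subadditivity of t^α. It gives dist(·, Ωᶜ)^α the Hölder constant exactly 1, as the sharp growth
rate requires. -/
lemma abs_rpow_sub_rpow_le_of_le_one {α a b : ℝ} (hα₀ : 0 < α) (hα₁ : α ≤ 1) (ha : 0 ≤ a)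
    (hb : 0 ≤ b) : |a ^ α - b ^ α| ≤ |a - b| ^ α := by
  have key : ∀ a b : ℝ, 0 ≤ b → b ≤ a → |a ^ α - b ^ α| ≤ |a - b| ^ α := by
    intro a b hb hab
    have h1 : b ^ α ≤ a ^ α := Real.rpow_le_rpow hb hab hα₀.le
    have h2 := Real.rpow_add_le_add_rpow hb (sub_nonneg.2 hab) hα₀.le hα₁
    rw [add_sub_cancel] at h2
    rw [abs_of_nonneg (sub_nonneg.2 h1), abs_of_nonneg (sub_nonneg.2 hab)]
    linarith
  rcases le_total b a with h | h
  · exact key a b hb h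
  · rw [abs_sub_comm, abs_sub_comm a b]
    exact key b a ha h

lemma memCZeroClosure_infDist_rpow {Ω : Set 𝔼} {α : ℝ} (hα : 0 < α) :
    MemCZeroClosure Ω fun x => Metric.infDist x Ωᶜ ^ α :=
  ⟨(Metric.continuous_infDist_pt _).rpow_const fun _ => Or.inr hα.le, fun x hx => by
    simp only [Metric.infDist_zero_of_mem (mem_compl hx), Real.zero_rpow hα.ne']⟩

/-- The exponential growth rate of the first eigenvalue is at most `Λ_∞^α`. -/
lemma exists_firstEigenvalue_le (hn : 1 ≤ n) {Ω : Set 𝔼} (hΩ : IsOpen Ω) (hne : Ω.Nonempty)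
    (hb : Bornology.IsBounded Ω) {α : ℝ} (hα₀ : 0 < α) (hα₁ : α ≤ 1) {d : ℝ}
    (hd : infinityEigenvalue Ω α < d) :
    ∃ C : ℝ, 0 < C ∧ ∀ p : ℝ, 1 < p → 2 * (n : ℝ) < α * p →
      firstEigenvalue Ω α p ≤ ENNReal.ofReal (C * d ^ p) := by
  have hR := inradius_pos hn hΩ hne hb
  have hΛ : 0 < infinityEigenvalue Ω α := by unfold infinityEigenvalue; positivity
  have hd0 := hΛ.trans hd
  -- The distance level with ρ^α = 1/d. The assumption on d says ρ < R, so the set U of points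
  -- deeper than ρ is nonempty and open.
  set ρ : ℝ := (1 / d) ^ (1 / α) with hρ
  have hρ0 : 0 < ρ := by positivity
  have hρα : ρ ^ α = 1 / d := by
    rw [hρ, ← Real.rpow_mul (by positivity), one_div_mul_cancel hα₀.ne', Real.rpow_one]
  have hρR : ρ < inradius Ω := by
    refine (Real.rpow_lt_rpow_iff hρ0.le hR.le hα₀).1 ?_
    rw [hρα, one_div_lt hd0 (by positivity)]
    rwa [infinityEigenvalue, Real.div_rpow zero_le_one hR.le, Real.one_rpow] at hd
  set U : Set 𝔼 := {x | ρ < Metric.infDist x Ωᶜ} with hU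
  have hUo : IsOpen U := isOpen_lt continuous_const (Metric.continuous_infDist_pt _)
  have hUΩ : U ⊆ Ω := fun x hx => by
    by_contra h
    rw [hU, mem_ofPred_eq, Metric.infDist_zero_of_mem (mem_compl h)] at hx
    linarith
  have hUne : U.Nonempty := by
    obtain ⟨_, ⟨x, -, rfl⟩, hx⟩ := exists_lt_of_lt_csSup (hne.image _) hρR
    exact ⟨x, hx⟩
  have hV0 : volume U ≠ 0 := (hUo.measure_pos volume hUne).ne'
  have hVf : volume U ≠ ∞ := (hb.subset hUΩ).measure_lt_top.ne
  obtain ⟨C, hC, hE⟩ := exists_gagliardoEnergy_le_of_holder hn hΩ.measurableSet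
    hb.measure_lt_top.ne hR α
  have hVpos : 0 < (volume U).toReal := ENNReal.toReal_pos hV0 hVf
  refine ⟨C.toReal / (volume U).toReal + 1, by positivity, fun p hp hαp => ?_⟩
  set g : 𝔼 → ℝ := fun x => Metric.infDist x Ωᶜ ^ α with hg
  have hgC : MemCZeroClosure Ω g := memCZeroClosure_infDist_rpow hα₀
  have hp0 : 0 < p := by linarith
  have hg1 : ∀ x y, |g y - g x| ≤ 1 * ‖y - x‖ ^ α := fun x y => by
    rw [one_mul]
    refine (abs_rpow_sub_rpow_le_of_le_one hα₀ hα₁ Metric.infDist_nonneg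
      Metric.infDist_nonneg).trans ?_
    gcongr
    rw [← dist_eq_norm, ← Real.dist_eq]
    simpa using (Metric.lipschitz_infDist_pt Ωᶜ).dist_le_mul y x
  have hg2 : ∀ x y, |g y - g x| ≤ 1 * inradius Ω ^ α := fun x y => by
    have h0 : ∀ x, 0 ≤ g x ∧ g x ≤ inradius Ω ^ α := fun x =>
      ⟨Real.rpow_nonneg Metric.infDist_nonneg _, Real.rpow_le_rpow Metric.infDist_nonneg
        (infDist_compl_le_inradius hn hΩ hne hb x) hα₀.le⟩
    have hx := h0 x; have hy := h0 y
    rw [one_mul, abs_le]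
    constructor <;> linarith
  have hE' := hE p 1 hp0 hαp.le zero_le_one g hgC.2 hg1 hg2
  rw [Real.one_rpow, ENNReal.ofReal_one, one_mul] at hE'
  have hP : ENNReal.ofReal ((1 / d) ^ p) * volume U ≤ powerIntegral univ p g := by
    rw [← setLIntegral_const]
    calc ∫⁻ _ in U, ENNReal.ofReal ((1 / d) ^ p)
        ≤ ∫⁻ x in U, ENNReal.ofReal (|g x| ^ p) := by
          refine setLIntegral_mono' hUo.measurableSet fun x hx => ENNReal.ofReal_le_ofReal ?_
          gcongr
          rw [← hρα]
          refine le_trans ?_ (le_abs_self _)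
          exact Real.rpow_le_rpow hρ0.le (le_of_lt hx) hα₀.le
      _ ≤ _ := lintegral_mono_set (subset_univ _)
  have hmul := firstEigenvalue_mul_le hp hΩ hb
    (firstEigenvalue_ne_top hn hα₀ hα₁ hp0 hαp.le hΩ hne) hgC
  have hdp : 0 < (1 / d) ^ p := by positivity
  have h1 : firstEigenvalue Ω α p ≤ C / (ENNReal.ofReal ((1 / d) ^ p) * volume U) := by
    rw [ENNReal.le_div_iff_mul_le
      (Or.inl (mul_ne_zero (ENNReal.ofReal_pos.2 hdp).ne' hV0)) (Or.inl (by finiteness))]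
    calc _ ≤ firstEigenvalue Ω α p * powerIntegral univ p g := by gcongr
      _ ≤ C := hmul.trans hE'
  refine h1.trans ?_
  rw [← ENNReal.ofReal_toReal hC, ← ENNReal.ofReal_toReal hVf, ← ENNReal.ofReal_mul hdp.le,
    ← ENNReal.ofReal_div_of_pos (by positivity)]
  refine ENNReal.ofReal_le_ofReal ?_
  rw [Real.div_rpow zero_le_one hd0.le, Real.one_rpow, ENNReal.toReal_ofReal ENNReal.toReal_nonneg,
    ENNReal.toReal_ofReal ENNReal.toReal_nonneg]
  have hdp' : 0 < d ^ p := by positivity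
  calc C.toReal / (1 / d ^ p * (volume U).toReal) = C.toReal / (volume U).toReal * d ^ p := by
        field_simp
    _ ≤ _ := by gcongr; linarith

/-! ### Compactness and lower growth rate -/

/-- Compactness of equi-Hölder families with common compact support. -/
lemma exists_subseq_tendstoUniformly {K : Set 𝔼} (hK : IsCompact K) {f : ℕ → 𝔼 → ℝ}
    (hf : ∀ k, Continuous (f k)) (h0 : ∀ k x, x ∉ K → f k x = 0) {M A γ : ℝ} (hγ : 0 < γ)
    (hM : ∀ k x, |f k x| ≤ M)
    (hA : ∀ k x y, ‖y - x‖ ≤ 1 → |f k y - f k x| ≤ A * ‖y - x‖ ^ γ) :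
    ∃ (j : ℕ → ℕ) (w : 𝔼 → ℝ), StrictMono j ∧ TendstoUniformly (fun k => f (j k)) w atTop := by
  have : CompactSpace K := isCompact_iff_compactSpace.1 hK
  set F : ℕ → BoundedContinuousFunction K ℝ := fun k =>
    BoundedContinuousFunction.mkOfCompact ⟨fun x => f k x, (hf k).comp continuous_subtype_val⟩
    with hF
  have hFa : ∀ k x, F k x = f k x := fun k x => rfl
  have hcomp : IsCompact (closure (range F)) := by
    refine BoundedContinuousFunction.arzela_ascoli (Icc (-M) M) isCompact_Icc _ ?_ ?_
    · rintro _ x ⟨k, rfl⟩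
      exact abs_le.1 (hM k x)
    · intro x
      rw [Metric.equicontinuousAt_iff]
      intro ε hε
      have hlim : Tendsto (fun t : ℝ => A * t ^ γ) (𝓝 0) (𝓝 0) := by
        have := (Real.continuousAt_rpow_const 0 γ (Or.inr hγ.le)).tendsto.const_mul A
        rwa [Real.zero_rpow hγ.ne', mul_zero] at this
      obtain ⟨δ, hδ, h⟩ := Metric.eventually_nhds_iff.1 (hlim.eventually (gt_mem_nhds hε))
      refine ⟨min δ 1, by positivity, ?_⟩
      rintro y hy ⟨_, ⟨k, rfl⟩⟩
      have hn : ‖(x : 𝔼) - y‖ < min δ 1 := by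
        rw [norm_sub_rev, ← dist_eq_norm]; exact hy
      rw [Real.dist_eq]
      refine (hA k y x (hn.le.trans (min_le_right _ _))).trans_lt (h ?_)
      rw [Real.dist_eq, sub_zero, abs_norm]
      exact hn.trans_le (min_le_left _ _)
  obtain ⟨G, -, j, hj, hG⟩ := hcomp.tendsto_subseq fun k => subset_closure (mem_range_self (f := F) k)
  rw [BoundedContinuousFunction.tendsto_iff_tendstoUniformly, Metric.tendstoUniformly_iff] at hG
  classical
  refine ⟨j, fun x => if h : x ∈ K then G ⟨x, h⟩ else 0, hj, ?_⟩
  rw [Metric.tendstoUniformly_iff]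
  intro ε hε
  filter_upwards [hG ε hε] with k hk x
  by_cases hx : x ∈ K
  · simp only [hx, dite_true]
    exact hk ⟨x, hx⟩
  · simp only [hx, dite_false, h0 _ x hx, dist_self, hε]

/-- If max w < 1, then eventually v_k ≤ q on Ω with some q < 1, and the power integral is at most
q^(p_k)·|Ω| → 0, against the normalization. -/
lemma exists_one_le_of_tendstoUniformly {Ω : Set 𝔼} (hΩ : IsOpen Ω)
    (hb : Bornology.IsBounded Ω) {p : ℕ → ℝ} (hp : Tendsto p atTop atTop) {v : ℕ → 𝔼 → ℝ}
    {w : 𝔼 → ℝ} (hv : ∀ k, MemCZeroClosure Ω (v k)) (hv0 : ∀ k x, 0 ≤ v k x)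
    (hP : ∀ k, powerIntegral univ (p k) (v k) = 1) (hw : MemCZeroClosure Ω w)
    (hvw : TendstoUniformly v w atTop) : ∃ x, 1 ≤ w x := by
  by_contra! hlt
  obtain ⟨x₁, hx₁⟩ : ∃ x, ∀ y, w y ≤ w x := by
    by_cases hne : Ω.Nonempty
    · obtain ⟨x, -, hx⟩ := hb.isCompact_closure.exists_isMaxOn hne.closure hw.1.continuousOn
      by_cases hmx : ∀ y, w y ≤ w x
      · exact ⟨x, hmx⟩
      · push Not at hmx
        obtain ⟨y, hy⟩ := hmx
        refine ⟨y, fun z => ?_⟩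
        have hyΩ : y ∉ Ω := fun h => hy.not_ge (hx (subset_closure h))
        by_cases hz : z ∈ Ω
        · exact (hx (subset_closure hz)).trans hy.le
        · rw [hw.2 z hz, hw.2 y hyΩ]
    · exact ⟨0, fun y => by
        rw [hw.2 y fun h => hne ⟨y, h⟩, hw.2 0 fun h => hne ⟨0, h⟩]⟩
  have hw0 : 0 ≤ w x₁ :=
    ge_of_tendsto (hvw.tendsto_at x₁) (Eventually.of_forall fun k => hv0 k x₁)
  set q := (w x₁ + 1) / 2 with hq
  have hq1 : q < 1 := by linarith [hlt x₁]
  have hq0 : 0 < q := by linarith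
  have hev := (Metric.tendstoUniformly_iff.1 hvw) (q - w x₁) (by linarith [hlt x₁])
  have hVf : volume Ω ≠ ∞ := hb.measure_lt_top.ne
  have hlim : Tendsto (fun k => q ^ p k * (volume Ω).toReal) atTop (𝓝 0) := by
    have := ((tendsto_rpow_atTop_of_base_lt_one q (by linarith) hq1).comp hp).mul_const
      (volume Ω).toReal
    rwa [zero_mul] at this
  obtain ⟨k, hk1, hk2, hk3⟩ := (hev.and ((hlim.eventually (gt_mem_nhds one_pos)).and
    (hp.eventually (eventually_gt_atTop 0)))).exists
  have hle : powerIntegral univ (p k) (v k) ≤ ENNReal.ofReal (q ^ p k) * volume Ω := by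
    rw [← setLIntegral_const]
    unfold powerIntegral
    rw [Measure.restrict_univ, ← lintegral_indicator hΩ.measurableSet]
    refine lintegral_mono fun x => ?_
    by_cases hx : x ∈ Ω
    · rw [indicator_of_mem hx]
      refine ENNReal.ofReal_le_ofReal ?_
      gcongr
      rw [abs_of_nonneg (hv0 k x)]
      have h1 := hk1 x
      rw [Real.dist_eq] at h1
      have := (abs_lt.1 h1).1
      linarith [hx₁ x]
    · rw [(hv k).2 x hx, abs_zero, Real.zero_rpow hk3.ne', ENNReal.ofReal_zero]
      exact zero_le
  rw [hP k, ← ENNReal.ofReal_toReal hVf, ← ENNReal.ofReal_mul (by positivity),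
    ENNReal.one_le_ofReal] at hle
  linarith

/-- The exponential growth rate of the first eigenvalue is at least `Λ_∞^α`. -/
lemma exists_le_gagliardoEnergy (hn : 1 ≤ n) {Ω : Set 𝔼} (hΩ : IsOpen Ω)
    (hb : Bornology.IsBounded Ω) {α : ℝ} (hα₀ : 0 < α) {v : ℕ → 𝔼 → ℝ}
    {w : 𝔼 → ℝ} (hw : MemCZeroClosure Ω w)
    (hvw : TendstoUniformly v w atTop) (h1 : ∃ x, 1 ≤ w x) {d : ℝ} (hd0 : 0 < d)
    (hd : d < infinityEigenvalue Ω α) :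
    ∃ c : ℝ, 0 < c ∧ ∀ᶠ k in atTop, ∀ p : ℝ, 0 < p →
      ENNReal.ofReal (c * d ^ p) ≤ gagliardoEnergy univ p (α * p) (v k) := by
  obtain ⟨x₁, hx₁⟩ := h1
  have hx₁Ω : x₁ ∈ Ω := by
    by_contra h
    rw [hw.2 x₁ h] at hx₁
    linarith
  have hR := inradius_pos hn hΩ ⟨x₁, hx₁Ω⟩ hb
  set R := inradius Ω with hRdef
  obtain ⟨z, hz, hzd⟩ := hΩ.isClosed_compl.exists_infDist_eq_dist
    (nonempty_compl_of_isBounded hn hb) x₁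
  have hzR : dist x₁ z ≤ R := hzd ▸ infDist_compl_le_inradius hn hΩ ⟨x₁, hx₁Ω⟩ hb x₁
  have hdR : d * R ^ α < 1 := by
    rw [infinityEigenvalue, Real.div_rpow zero_le_one hR.le, Real.one_rpow,
      lt_div_iff₀ (by positivity)] at hd
    exact hd
  obtain ⟨t, ht1, ht2⟩ := exists_between hdR
  have ht0 : 0 < t := lt_trans (by positivity) ht1
  have hcont : Tendsto (fun ρ : ℝ => d * (R + 2 * ρ) ^ α) (𝓝 0) (𝓝 (d * R ^ α)) := by
    have : ContinuousAt (fun ρ : ℝ => d * (R + 2 * ρ) ^ α) 0 := by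
      refine ContinuousAt.mul continuousAt_const (ContinuousAt.rpow_const (by fun_prop) ?_)
      exact Or.inr hα₀.le
    simpa [ContinuousAt] using this
  obtain ⟨δ₁, hδ₁, hρ₁⟩ := Metric.eventually_nhds_iff.1 (hcont.eventually (gt_mem_nhds ht1))
  -- Near x₁ the functions v_k exceed 1 - 2s and near z they are below 2s, which leaves a difference
  -- of at least 1 - 4s = t. The ratio of t to (R + 2ρ)^α then exceeds d.
  set s := (1 - t) / 4 with hs
  have hs0 : 0 < s := by linarith
  obtain ⟨δ₂, hδ₂, hρ₂⟩ := Metric.continuousAt_iff.1 (hw.1.continuousAt (x := x₁)) s hs0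
  obtain ⟨δ₃, hδ₃, hρ₃⟩ := Metric.continuousAt_iff.1 (hw.1.continuousAt (x := z)) s hs0
  set ρ := min (δ₁ / 2) (min δ₂ δ₃) with hρ
  have hρ0 : 0 < ρ := by positivity
  have hρle1 : ρ < δ₁ := (min_le_left _ _).trans_lt (by linarith)
  have hρle2 : ρ ≤ δ₂ := (min_le_right _ _).trans (min_le_left _ _)
  have hρle3 : ρ ≤ δ₃ := (min_le_right _ _).trans (min_le_right _ _)
  have hdρ : d * (R + 2 * ρ) ^ α < t := hρ₁ (by
    rw [Real.dist_eq, sub_zero, abs_of_pos hρ0]; exact hρle1)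
  have hV := volume_ball_toReal_pos (n := n)
  set V := ρ ^ n * (volume (Metric.ball (0 : 𝔼) 1)).toReal with hVdef
  refine ⟨V * V, by positivity, ?_⟩
  filter_upwards [(Metric.tendstoUniformly_iff.1 hvw) s hs0] with k hk p hp
  have hlow : ∀ x ∈ Metric.ball x₁ ρ, ∀ y ∈ Metric.ball z ρ,
      d ^ p ≤ |v k y - v k x| ^ p / ‖y - x‖ ^ (α * p) := by
    intro x hx y hy
    have a1 := hρ₂ (lt_of_lt_of_le hx hρle2)
    have a2 := hρ₃ (lt_of_lt_of_le hy hρle3)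
    have a3 := hk x
    have a4 := hk y
    rw [hw.2 z hz] at a2
    rw [Real.dist_eq] at a1 a2 a3 a4
    have b1 := abs_lt.1 a1
    have b2 := abs_lt.1 a2
    have b3 := abs_lt.1 a3
    have b4 := abs_lt.1 a4
    have hdiff : t ≤ |v k y - v k x| := by
      rw [abs_sub_comm]
      refine le_trans ?_ (le_abs_self _)
      linarith
    have hdist : ‖y - x‖ ≤ R + 2 * ρ := by
      rw [← dist_eq_norm]
      have hx' : dist x₁ x < ρ := by rw [dist_comm]; exact hx
      have hy' : dist y z < ρ := hy
      have t1 := dist_triangle4 y z x₁ x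
      rw [dist_comm z x₁] at t1
      linarith
    have hpos : 0 < ‖y - x‖ := by
      refine norm_pos_iff.2 (sub_ne_zero.2 fun h => ?_)
      rw [h, sub_self, abs_zero] at hdiff
      linarith
    rw [Real.rpow_mul hpos.le, ← Real.div_rpow (abs_nonneg _) (by positivity)]
    refine Real.rpow_le_rpow hd0.le ?_ hp.le
    rw [le_div_iff₀ (by positivity)]
    calc d * ‖y - x‖ ^ α ≤ d * (R + 2 * ρ) ^ α := by gcongr
      _ ≤ _ := hdρ.le.trans hdiff
  have h := mul_volume_mul_volume_le_gagliardoEnergy (subset_univ _) (subset_univ _)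
    measurableSet_ball measurableSet_ball hlow
  refine le_trans (le_of_eq ?_) h
  rw [volume_ball_eq x₁ hρ0, volume_ball_eq z hρ0, ← hVdef, ← ENNReal.ofReal_mul (by positivity),
    ← ENNReal.ofReal_mul (by positivity)]
  congr 1
  ring

/-! ### The weak inequality for minimizers -/

/-- `u` attains the minimum `lam` of the Rayleigh quotient in `C_0(closure Ω)`. -/
def IsRayleighMinimizer {n : ℕ} (Ω : Set (EuclideanSpace ℝ (Fin n))) (α p lam : ℝ)
    (u : EuclideanSpace ℝ (Fin n) → ℝ) : Prop :=
  MemCZeroClosure Ω u ∧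
    gagliardoEnergy univ p (α * p) u = ENNReal.ofReal lam * powerIntegral univ p u ∧
    ∀ v, MemCZeroClosure Ω v →
      ENNReal.ofReal lam * powerIntegral univ p v ≤ gagliardoEnergy univ p (α * p) v

/-- The Rayleigh quotient is even. This is why one comparison from below serves both viscosity
inequalities. -/
lemma IsRayleighMinimizer.neg {Ω : Set 𝔼} {α p lam : ℝ} {u : 𝔼 → ℝ}
    (h : IsRayleighMinimizer Ω α p lam u) : IsRayleighMinimizer Ω α p lam (-u) :=
  ⟨⟨h.1.1.neg, fun x hx => by simp [h.1.2 x hx]⟩, by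
    rw [gagliardoEnergy_neg, powerIntegral_neg, h.2.1], h.2.2⟩

/-- The kernel `|Φ(y) - Φ(x)|^(p-2) (Φ(y) - Φ(x)) / |y - x|^(α p)` as a function of `(x, y)`. -/
noncomputable def flux (α p : ℝ) (Φ : 𝔼 → ℝ) (x y : 𝔼) : ℝ :=
  oddPow p (Φ y - Φ x) / ‖y - x‖ ^ (α * p)

lemma flux_swap (α p : ℝ) (Φ : 𝔼 → ℝ) (x y : 𝔼) : flux α p Φ y x = -flux α p Φ x y := by
  unfold flux
  rw [← neg_sub (Φ y), oddPow_neg, norm_sub_rev, neg_div]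

lemma measurable_flux {α p : ℝ} (hp : 2 < p) {Φ : 𝔼 → ℝ} (hΦ : Measurable Φ) :
    Measurable fun z : 𝔼 × 𝔼 => flux α p Φ z.1 z.2 := by
  unfold flux
  have h1 : Measurable (fun z : 𝔼 × 𝔼 => oddPow p (Φ z.2 - Φ z.1)) :=
    (continuous_oddPow hp).measurable.comp
      ((hΦ.comp measurable_snd).sub (hΦ.comp measurable_fst))
  have h3 : Measurable (fun z : 𝔼 × 𝔼 => ‖z.2 - z.1‖) := by fun_prop
  exact h1.div (h3.pow_const _)

lemma abs_flux_mul_le {α p : ℝ} (hp : 1 < p) (Φ h : 𝔼 → ℝ) (z : 𝔼 × 𝔼) :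
    |flux α p Φ z.1 z.2 * (h z.2 - h z.1)| ≤
      energyDensity p (α * p) Φ z + energyDensity p (α * p) h z := by
  unfold flux energyDensity
  have h0 : 0 ≤ ‖z.2 - z.1‖ ^ (α * p) := by positivity
  rw [div_mul_eq_mul_div, abs_div, abs_of_nonneg h0, ← add_div]
  gcongr
  exact abs_rpow_mul_le hp _ _

lemma integrable_flux_mul {α p : ℝ} (hp : 2 < p) {Φ h : 𝔼 → ℝ} (hΦ : Measurable Φ)
    (hh : Measurable h) (hΦE : gagliardoEnergy univ p (α * p) Φ ≠ ∞)
    (hhE : gagliardoEnergy univ p (α * p) h ≠ ∞) :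
    Integrable (fun z : 𝔼 × 𝔼 => flux α p Φ z.1 z.2 * (h z.2 - h z.1))
      (volume.prod volume) := by
  refine ((integrable_energyDensity hΦ hΦE).add (integrable_energyDensity hh hhE)).mono' ?_ ?_
  · exact ((measurable_flux hp hΦ).mul
      ((hh.comp measurable_snd).sub (hh.comp measurable_fst))).aestronglyMeasurable
  · exact Eventually.of_forall fun z => by
      rw [Real.norm_eq_abs]; exact abs_flux_mul_le (by linarith) Φ h z

/-- The tangent inequality at v = max(Φ, u) gives this bound with the increment of v in place of
that of Φ. The exchange goes in the right direction: where h = v - u grows from x to y, v(y) = Φ(y)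
and v(x) ≥ Φ(x), so the increment of v is at most that of Φ; where h decreases, the inequality is
reversed. `oddPow` is monotone. -/
lemma energyDensity_max_sub_le {α p : ℝ} (hp : 2 < p) (u Φ : 𝔼 → ℝ) (z : 𝔼 × 𝔼) :
    energyDensity p (α * p) (fun x => max (Φ x) (u x)) z - energyDensity p (α * p) u z ≤
      p * (flux α p Φ z.1 z.2 * (max (Φ z.2 - u z.2) 0 - max (Φ z.1 - u z.1) 0)) := by
  obtain ⟨x, y⟩ := z
  unfold energyDensity flux
  simp only
  rw [← sub_div, div_mul_eq_mul_div, ← mul_div_assoc]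
  refine div_le_div_of_nonneg_right ?_ (by positivity)
  have e : ∀ x, max (Φ x - u x) 0 = max (Φ x) (u x) - u x := fun x => by
    rw [← sub_self (u x), max_sub_sub_right]
  have h1 := abs_rpow_sub_le (show 1 < p by linarith) (u y - u x)
    (max (Φ y) (u y) - max (Φ x) (u x))
  refine h1.trans (mul_le_mul_of_nonneg_left ?_ (by linarith))
  have hm := monotone_oddPow (show 1 < p by linarith)
  have e2 : max (Φ y) (u y) - max (Φ x) (u x) - (u y - u x) =
      max (Φ y - u y) 0 - max (Φ x - u x) 0 := by rw [e, e]; ring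
  rw [e2]
  rcases le_total (max (Φ x - u x) 0) (max (Φ y - u y) 0) with h | h
  · rcases h.eq_or_lt with h | h
    · rw [h, sub_self, mul_zero, mul_zero]
    · have hy : u y < Φ y := by
        by_contra hc
        rw [max_eq_right (a := Φ y - u y) (by linarith)] at h
        exact absurd h (le_max_right _ _).not_gt
      refine mul_le_mul_of_nonneg_right (hm ?_) (by linarith)
      rw [max_eq_left hy.le]
      exact sub_le_sub_left (le_max_left _ _) _
  · rcases h.eq_or_lt with h | h
    · rw [h, sub_self, mul_zero, mul_zero]
    · have hx : u x < Φ x := by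
        by_contra hc
        rw [max_eq_right (a := Φ x - u x) (by linarith)] at h
        exact absurd h (le_max_right _ _).not_gt
      refine mul_le_mul_of_nonpos_right (hm ?_) (by linarith)
      rw [max_eq_left hx.le]
      exact sub_le_sub_right (le_max_left _ _) _

/-- The weak inequality satisfied by a minimizer on the set where a competitor is larger. -/
lemma IsRayleighMinimizer.integral_le_integral_flux {Ω : Set 𝔼} (hb : Bornology.IsBounded Ω)
    {α p lam : ℝ} (hlam : 0 ≤ lam) (hp : 2 < p) {u Φ : 𝔼 → ℝ}
    (hu : IsRayleighMinimizer Ω α p lam u) (hΦc : Continuous Φ)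
    (hΦE : gagliardoEnergy univ p (α * p) Φ ≠ ∞) (hΦu : ∀ x, x ∉ Ω → Φ x ≤ 0) :
    Integrable (fun z : 𝔼 × 𝔼 =>
      flux α p Φ z.1 z.2 * (max (Φ z.2 - u z.2) 0 - max (Φ z.1 - u z.1) 0))
      (volume.prod volume) ∧
    lam * ∫ x, oddPow p (u x) * max (Φ x - u x) 0 ≤
      ∫ z : 𝔼 × 𝔼, flux α p Φ z.1 z.2 * (max (Φ z.2 - u z.2) 0 - max (Φ z.1 - u z.1) 0)
        ∂(volume.prod volume) := by
  have hp1 : 1 < p := by linarith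
  have hp0 : 0 < p := by linarith
  obtain ⟨huC, huE, hmin⟩ := hu
  have hucs := huC.hasCompactSupport hb
  -- Since Φ ≤ 0 = u off Ω, the maximum is an admissible competitor even though Φ need not be one.
  set v : 𝔼 → ℝ := fun x => max (Φ x) (u x) with hv
  have hvC : MemCZeroClosure Ω v := ⟨hΦc.max huC.1, fun x hx => by
    simp only [hv, huC.2 x hx, max_eq_right (hΦu x hx)]⟩
  have hvcs := hvC.hasCompactSupport hb
  have hEu : gagliardoEnergy univ p (α * p) u ≠ ∞ := by
    rw [huE]
    exact ENNReal.mul_ne_top ENNReal.ofReal_ne_top (powerIntegral_ne_top hp0 huC.1 hucs)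
  have hEv : gagliardoEnergy univ p (α * p) v ≠ ∞ := by
    have h : gagliardoEnergy univ p (α * p) v ≤
        ENNReal.ofReal 1 * (gagliardoEnergy univ p (α * p) Φ + gagliardoEnergy univ p (α * p) u) := by
      rw [gagliardoEnergy_eq_lintegral_prod hvC.1.measurable.aemeasurable,
        gagliardoEnergy_eq_lintegral_prod hΦc.measurable.aemeasurable,
        gagliardoEnergy_eq_lintegral_prod huC.1.measurable.aemeasurable,
        ← lintegral_add_left (measurable_energyDensity hΦc.measurable).ennreal_ofReal,
        ENNReal.ofReal_one, one_mul]
      refine lintegral_mono fun z => ?_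
      rw [← ENNReal.ofReal_add (energyDensity_nonneg _ _ _ _) (energyDensity_nonneg _ _ _ _)]
      refine ENNReal.ofReal_le_ofReal ?_
      unfold energyDensity
      rw [← add_div]
      gcongr
      have h1 := abs_max_sub_max_le_max (Φ z.2) (u z.2) (Φ z.1) (u z.1)
      calc |v z.2 - v z.1| ^ p ≤ (max |Φ z.2 - Φ z.1| |u z.2 - u z.1|) ^ p := by gcongr
        _ ≤ _ := by
          rcases max_choice |Φ z.2 - Φ z.1| |u z.2 - u z.1| with h | h <;> rw [h]
          · linarith [Real.rpow_nonneg (abs_nonneg (u z.2 - u z.1)) p]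
          · linarith [Real.rpow_nonneg (abs_nonneg (Φ z.2 - Φ z.1)) p]
    exact ne_top_of_le_ne_top (by finiteness) h
  set h : 𝔼 → ℝ := fun x => max (Φ x - u x) 0 with hh
  have hhc : Continuous h := (hΦc.sub huC.1).max continuous_const
  have hhv : h = v - u := by
    ext x
    simp only [hh, hv, Pi.sub_apply]
    rw [← sub_self (u x), max_sub_sub_right]
  have hEh : gagliardoEnergy univ p (α * p) h ≠ ∞ := by
    rw [hhv]
    exact ne_top_of_le_ne_top (by finiteness) (gagliardoEnergy_sub_le hp0.le
      hvC.1.measurable.aemeasurable huC.1.measurable.aemeasurable)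
  have hI := integrable_flux_mul hp hΦc.measurable hhc.measurable hΦE hEh
  refine ⟨hI, ?_⟩
  have iv := integrable_energyDensity hvC.1.measurable hEv
  have iu := integrable_energyDensity huC.1.measurable hEu
  have h1 : ∫ z, energyDensity p (α * p) v z ∂(volume.prod volume) -
      ∫ z, energyDensity p (α * p) u z ∂(volume.prod volume) ≤
      p * ∫ z : 𝔼 × 𝔼, flux α p Φ z.1 z.2 * (h z.2 - h z.1) ∂(volume.prod volume) := by
    rw [← integral_sub iv iu, ← integral_const_mul]
    exact integral_mono (iv.sub iu) (hI.const_mul p) fun z => energyDensity_max_sub_le hp u Φ z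
  have h2 : lam * ∫ x, |v x| ^ p ≤ ∫ z, energyDensity p (α * p) v z ∂(volume.prod volume) := by
    have := hmin v hvC
    rw [← ofReal_integral_abs_rpow hp0 hvC.1 hvcs, ← ofReal_integral_energyDensity
      hvC.1.measurable hEv, ← ENNReal.ofReal_mul hlam] at this
    exact (ENNReal.ofReal_le_ofReal_iff
      (integral_nonneg fun z => energyDensity_nonneg _ _ _ _)).1 this
  have h3 : ∫ z, energyDensity p (α * p) u z ∂(volume.prod volume) = lam * ∫ x, |u x| ^ p := by
    rw [← ofReal_integral_abs_rpow hp0 huC.1 hucs, ← ofReal_integral_energyDensity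
      huC.1.measurable hEu, ← ENNReal.ofReal_mul hlam] at huE
    exact (ENNReal.ofReal_eq_ofReal_iff (integral_nonneg fun z => energyDensity_nonneg _ _ _ _)
      (mul_nonneg hlam (integral_nonneg fun x => by positivity))).1 huE
  have jv := integrable_abs_rpow hp0 hvC.1 hvcs
  have ju := integrable_abs_rpow hp0 huC.1 hucs
  have jh : Integrable fun x => oddPow p (u x) * h x := by
    refine (((continuous_oddPow hp).comp huC.1).mul hhc).integrable_of_hasCompactSupport ?_
    exact HasCompactSupport.mul_right (f := fun x => oddPow p (u x))
      (hucs.comp_left (oddPow_zero p))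
  -- Convexity again, this time as the tangent inequality at u, for the lower-order term.
  have h4 : p * ∫ x, oddPow p (u x) * h x ≤ (∫ x, |v x| ^ p) - ∫ x, |u x| ^ p := by
    rw [← integral_const_mul, ← integral_sub jv ju]
    refine integral_mono (jh.const_mul p) (jv.sub ju) fun x => ?_
    have := abs_rpow_sub_le hp1 (v x) (u x)
    have e : h x = v x - u x := by rw [hhv]; rfl
    simp only [e]
    linarith
  have h5 := mul_le_mul_of_nonneg_left h4 hlam
  have h6 : p * (lam * ∫ x, oddPow p (u x) * h x) ≤
      p * ∫ z : 𝔼 × 𝔼, flux α p Φ z.1 z.2 * (h z.2 - h z.1) ∂(volume.prod volume) := by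
    rw [mul_sub] at h5
    linarith
  exact le_of_mul_le_mul_left h6 hp0

/-! ### Truncation, symmetrization and the comparison principle -/

/-- The truncated kernel `|z|^(-b)` for `|z| > η`. -/
noncomputable def tailKernel (b η : ℝ) (z : 𝔼) : ℝ :=
  {z : 𝔼 | η < ‖z‖}.indicator (fun z => ‖z‖ ^ (-b)) z

lemma measurableSet_norm_gt (η : ℝ) : MeasurableSet {z : 𝔼 | η < ‖z‖} :=
  (isOpen_lt continuous_const continuous_norm).measurableSet

lemma tailKernel_nonneg (b η : ℝ) (z : 𝔼) : 0 ≤ tailKernel b η z :=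
  indicator_nonneg (fun z _ => by positivity) z

lemma integrable_tailKernel {b η : ℝ} (hb : (n : ℝ) < b) (hη : 0 < η) :
    Integrable (tailKernel (n := n) b η) := by
  refine ((integrable_one_add_norm_rpow hb).const_mul ((1 + 1 / η) ^ b)).mono' ?_ ?_
  · exact ((measurable_norm.pow_const _).indicator (measurableSet_norm_gt η)).aestronglyMeasurable
  · refine Eventually.of_forall fun z => ?_
    rw [Real.norm_of_nonneg (tailKernel_nonneg b η z)]
    unfold tailKernel
    by_cases hz : η < ‖z‖
    · have hz0 : 0 < ‖z‖ := hη.trans hz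
      rw [indicator_of_mem (show z ∈ {z : 𝔼 | η < ‖z‖} from hz), Real.rpow_neg hz0.le,
        Real.rpow_neg (by positivity), ← div_eq_mul_inv, ← Real.div_rpow (by positivity)
        (by positivity), ← Real.inv_rpow hz0.le]
      have hb0 : 0 ≤ b := (Nat.cast_nonneg n).trans hb.le
      refine Real.rpow_le_rpow (by positivity) ?_ hb0
      rw [le_div_iff₀ (by positivity), inv_mul_eq_div, div_le_iff₀ hz0]
      have : 1 ≤ 1 / η * ‖z‖ := by rw [one_div_mul_eq_div, one_le_div hη]; exact hz.le
      linarith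
    · rw [indicator_of_notMem (show z ∉ {z : 𝔼 | η < ‖z‖} from hz)]
      positivity

/-- The flux kernel with the singularity on the diagonal removed. -/
noncomputable def truncFlux (α p η : ℝ) (Φ : 𝔼 → ℝ) (x y : 𝔼) : ℝ :=
  {z : 𝔼 | η < ‖z‖}.indicator (fun _ => flux α p Φ x y) (y - x)

lemma truncFlux_swap (α p η : ℝ) (Φ : 𝔼 → ℝ) (x y : 𝔼) :
    truncFlux α p η Φ y x = -truncFlux α p η Φ x y := by
  unfold truncFlux
  by_cases h : η < ‖y - x‖
  · rw [indicator_of_mem (show y - x ∈ {z : 𝔼 | η < ‖z‖} from h),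
      indicator_of_mem (show x - y ∈ {z : 𝔼 | η < ‖z‖} by rwa [mem_ofPred_eq, norm_sub_rev]),
      flux_swap]
  · rw [indicator_of_notMem (show y - x ∉ {z : 𝔼 | η < ‖z‖} from h),
      indicator_of_notMem (show x - y ∉ {z : 𝔼 | η < ‖z‖} by
        rwa [mem_ofPred_eq, norm_sub_rev]), neg_zero]

lemma measurable_truncFlux {α p η : ℝ} (hp : 2 < p) {Φ : 𝔼 → ℝ} (hΦ : Measurable Φ) :
    Measurable fun z : 𝔼 × 𝔼 => truncFlux α p η Φ z.1 z.2 := by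
  have hs : MeasurableSet {z : 𝔼 × 𝔼 | η < ‖z.2 - z.1‖} :=
    (isOpen_lt continuous_const (by fun_prop)).measurableSet
  exact (measurable_flux hp hΦ).indicator hs

lemma abs_truncFlux_le {α p η S : ℝ} (hp : 1 < p) {Φ : 𝔼 → ℝ}
    (hS : ∀ x y, |Φ y - Φ x| ≤ S) (x y : 𝔼) :
    |truncFlux α p η Φ x y| ≤ S ^ (p - 1) * tailKernel (α * p) η (y - x) := by
  unfold truncFlux tailKernel
  by_cases h : y - x ∈ {z : 𝔼 | η < ‖z‖}
  · rw [indicator_of_mem h, indicator_of_mem h, flux, abs_div, abs_oddPow hp,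
      Real.rpow_neg (norm_nonneg _), ← div_eq_mul_inv,
      abs_of_nonneg (show 0 ≤ ‖y - x‖ ^ (α * p) by positivity)]
    gcongr
    exact hS x y
  · rw [indicator_of_notMem h, indicator_of_notMem h, abs_zero, mul_zero]

/-- Off the diagonal the flux is dominated by an integrable kernel of y - x, so the product is
dominated by a convolution integrand. -/
lemma integrable_truncFlux_mul {α p η S : ℝ} (hη : 0 < η) (hp : 2 < p) (hαp : (n : ℝ) < α * p)
    {Φ h : 𝔼 → ℝ} (hΦ : Measurable Φ) (hS : ∀ x y, |Φ y - Φ x| ≤ S) (hh : Integrable h)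
    (hhm : Measurable h) :
    Integrable (fun z : 𝔼 × 𝔼 => truncFlux α p η Φ z.1 z.2 * h z.1) (volume.prod volume) := by
  have h1 : Integrable (fun z : 𝔼 × 𝔼 => h z.2 * tailKernel (α * p) η (z.1 - z.2))
      (volume.prod volume) :=
    hh.convolution_integrand (ContinuousLinearMap.mul ℝ ℝ) (integrable_tailKernel hαp hη)
  have h2 := (h1.swap.norm).const_mul (S ^ (p - 1))
  refine h2.mono' ((measurable_truncFlux hp hΦ).mul
    (hhm.comp measurable_fst)).aestronglyMeasurable (Eventually.of_forall fun z => ?_)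
  simp only [Function.comp_apply, Prod.fst_swap, Prod.snd_swap, norm_mul, Real.norm_eq_abs,
    abs_of_nonneg (tailKernel_nonneg _ _ _)]
  calc |truncFlux α p η Φ z.1 z.2| * |h z.1|
      ≤ S ^ (p - 1) * tailKernel (α * p) η (z.2 - z.1) * |h z.1| := by
        gcongr
        exact abs_truncFlux_le (by linarith) hS _ _
    _ = _ := by ring

lemma integrable_truncFlux_right {α p η S : ℝ} (hη : 0 < η) (hp : 2 < p) (hαp : (n : ℝ) < α * p)
    {Φ : 𝔼 → ℝ} (hΦ : Measurable Φ) (hS : ∀ x y, |Φ y - Φ x| ≤ S) (x : 𝔼) :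
    Integrable fun z => truncFlux α p η Φ x (x + z) := by
  refine ((integrable_tailKernel hαp hη).const_mul (S ^ (p - 1))).mono' ?_ ?_
  · exact ((measurable_truncFlux hp hΦ).comp
      (measurable_const.prodMk (measurable_const_add x))).aestronglyMeasurable
  · refine Eventually.of_forall fun z => ?_
    rw [Real.norm_eq_abs]
    have := abs_truncFlux_le (α := α) (η := η) (show 1 < p by linarith) hS x (x + z)
    rwa [add_sub_cancel_left] at this

/-- Antisymmetry of the kernel: exchanging x and y turns the h(y) term into the h(x) term. Splitting
the two is legitimate only after truncation, which makes each of them integrable. -/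
lemma integral_truncFlux_mul_sub {α p η S : ℝ} (hη : 0 < η) (hp : 2 < p)
    (hαp : (n : ℝ) < α * p) {Φ h : 𝔼 → ℝ} (hΦ : Measurable Φ) (hS : ∀ x y, |Φ y - Φ x| ≤ S)
    (hh : Integrable h) (hhm : Measurable h) :
    Integrable (fun x => h x * (2 * ∫ z, truncFlux α p η Φ x (x + z))) ∧
    ∫ z : 𝔼 × 𝔼, truncFlux α p η Φ z.1 z.2 * (h z.2 - h z.1) ∂(volume.prod volume) =
      -∫ x, h x * (2 * ∫ z, truncFlux α p η Φ x (x + z)) := by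
  have i1 := integrable_truncFlux_mul hη hp hαp hΦ hS hh hhm
  have e1 : ∀ x, ∫ y, truncFlux α p η Φ x y * h x = h x * ∫ z, truncFlux α p η Φ x (x + z) :=
    fun x => by
      rw [integral_mul_const, mul_comm,
        integral_add_left_eq_self (fun y => truncFlux α p η Φ x y) x]
  have e2 : (fun z : 𝔼 × 𝔼 => truncFlux α p η Φ z.1 z.2 * (h z.2 - h z.1)) = fun z =>
      -(((fun z : 𝔼 × 𝔼 => truncFlux α p η Φ z.1 z.2 * h z.1) ∘ Prod.swap) z +
        truncFlux α p η Φ z.1 z.2 * h z.1) := by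
    ext z
    simp only [Function.comp_apply, Prod.fst_swap, Prod.snd_swap]
    rw [truncFlux_swap]
    ring
  have i2 : Integrable fun x => h x * ∫ z, truncFlux α p η Φ x (x + z) := by
    have := i1.integral_prod_left
    simpa only [e1] using this
  constructor
  · refine (i2.const_mul 2).congr (Eventually.of_forall fun x => ?_)
    simp only
    ring
  · rw [e2, integral_neg, integral_add i1.swap i1]
    congr 1
    have e3 : ∫ z : 𝔼 × 𝔼, ((fun z : 𝔼 × 𝔼 => truncFlux α p η Φ z.1 z.2 * h z.1) ∘ Prod.swap) z
        ∂(volume.prod volume) =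
        ∫ z : 𝔼 × 𝔼, truncFlux α p η Φ z.1 z.2 * h z.1 ∂(volume.prod volume) :=
      integral_prod_swap (fun z : 𝔼 × 𝔼 => truncFlux α p η Φ z.1 z.2 * h z.1)
    rw [e3, integral_prod _ i1, ← integral_add i1.integral_prod_left i1.integral_prod_left]
    refine integral_congr_ae (Eventually.of_forall fun x => ?_)
    simp only [e1]
    ring

/-- Averaging over z and -z turns twice the flux integral into the integral of the symmetrized flux,
which has a lower bound integrable up to the origin. -/
lemma setIntegral_le_two_mul_integral_truncFlux {α p η S : ℝ} (hη : 0 < η) (hp : 2 < p)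
    (hαp : (n : ℝ) < α * p) {Φ W : 𝔼 → ℝ} (hΦ : Measurable Φ) (hS : ∀ x y, |Φ y - Φ x| ≤ S)
    (hW : Integrable W) (x : 𝔼)
    (hx : ∀ z, W z ≤ flux α p Φ x (x + z) + flux α p Φ x (x - z)) :
    ∫ z in {z : 𝔼 | η < ‖z‖}, W z ≤ 2 * ∫ z, truncFlux α p η Φ x (x + z) := by
  have i1 := integrable_truncFlux_right (α := α) hη hp hαp hΦ hS x
  have e1 : 2 * ∫ z, truncFlux α p η Φ x (x + z) =
      ∫ z, (truncFlux α p η Φ x (x + z) + truncFlux α p η Φ x (x + -z)) := by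
    rw [integral_add i1 i1.comp_neg,
      integral_neg_eq_self (fun z => truncFlux α p η Φ x (x + z)), two_mul]
  rw [e1, ← integral_indicator (measurableSet_norm_gt η)]
  refine integral_mono (hW.indicator (measurableSet_norm_gt η)) (i1.add i1.comp_neg) fun z => ?_
  simp only [truncFlux, add_sub_cancel_left]
  by_cases hz : z ∈ {z : 𝔼 | η < ‖z‖}
  · rw [indicator_of_mem hz, indicator_of_mem hz, indicator_of_mem (by simpa using hz),
      ← sub_eq_add_neg]
    exact hx z
  · rw [indicator_of_notMem hz, indicator_of_notMem hz, indicator_of_notMem (by simpa using hz),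
      add_zero]

/-- Removes the truncation by dominated convergence. The sets 1/(i+1) < N exhaust only N > 0, so F
has to vanish where N ≤ 0. -/
lemma tendsto_setIntegral_norm_gt {X : Type*} [MeasurableSpace X] {μ : Measure X} {F : X → ℝ}
    (hF : Integrable F μ) {N : X → ℝ} (hN : Measurable N) (h0 : ∀ z, N z ≤ 0 → F z = 0) :
    Tendsto (fun i : ℕ => ∫ z, {z | 1 / ((i : ℝ) + 1) < N z}.indicator F z ∂μ) atTop
      (𝓝 (∫ z, F z ∂μ)) := by
  refine tendsto_integral_of_dominated_convergence (fun z => ‖F z‖) (fun i => ?_) hF.norm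
    (fun i => Eventually.of_forall fun z => norm_indicator_le_norm_self F z)
    (Eventually.of_forall fun z => ?_)
  · exact (hF.indicator (measurableSet_lt measurable_const hN)).aestronglyMeasurable
  · by_cases hz : N z ≤ 0
    · have : ∀ i : ℕ, {z | 1 / ((i : ℝ) + 1) < N z}.indicator F z = F z := fun i => by
        rw [h0 z hz, indicator_apply, h0 z hz, ite_self]
      simp only [this, tendsto_const_nhds]
    · refine tendsto_const_nhds.congr' ?_
      filter_upwards [(tendsto_one_div_add_atTop_nhds_zero_nat (𝕜 := ℝ)).eventually
        (gt_mem_nhds (not_le.1 hz))] with i hi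
      rw [indicator_of_mem (show z ∈ {z | 1 / ((i : ℝ) + 1) < N z} from hi)]

/-- Comparison principle: a competitor whose nonlinear nonlocal operator is too large at every
point where it exceeds the minimizer does not exceed the minimizer anywhere. -/
lemma IsRayleighMinimizer.le_of_flux_lower_bound {Ω : Set 𝔼} (hb : Bornology.IsBounded Ω)
    {α p lam c S : ℝ} (hlam : 0 ≤ lam) (hp : 2 < p) (hαp : (n : ℝ) < α * p) {u Φ W : 𝔼 → ℝ}
    (hu : IsRayleighMinimizer Ω α p lam u) (hΦc : Continuous Φ)
    (hΦE : gagliardoEnergy univ p (α * p) Φ ≠ ∞) (hS : ∀ x y, |Φ y - Φ x| ≤ S)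
    (hΦu : ∀ x, x ∉ Ω → Φ x ≤ 0)
    (hW : Integrable W) (hW0 : W 0 = 0) (hc : 0 < c)
    (hx : ∀ x, u x < Φ x → (∀ z, W z ≤ flux α p Φ x (x + z) + flux α p Φ x (x - z)) ∧
      c ≤ lam * oddPow p (u x) + ∫ z, W z) (x : 𝔼) : Φ x ≤ u x := by
  obtain ⟨hI, hweak⟩ := hu.integral_le_integral_flux hb hlam hp hΦc hΦE hΦu
  set h : 𝔼 → ℝ := fun x => max (Φ x - u x) 0 with hh
  have hhc : Continuous h := (hΦc.sub hu.1.1).max continuous_const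
  have hh0 : ∀ x, 0 ≤ h x := fun x => le_max_right _ _
  have hhcs : HasCompactSupport h :=
    MemCZeroClosure.hasCompactSupport ⟨hhc, fun x hx => by
      simp only [hh, hu.1.2 x hx, sub_zero, max_eq_right (hΦu x hx)]⟩ hb
  have hhi : Integrable h := hhc.integrable_of_hasCompactSupport hhcs
  have jh : Integrable fun x => oddPow p (u x) * h x := by
    refine (((continuous_oddPow hp).comp hu.1.1).mul hhc).integrable_of_hasCompactSupport ?_
    exact hhcs.mul_left
  have hlimW := tendsto_setIntegral_norm_gt hW measurable_norm (fun z hz => by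
    rw [norm_le_zero_iff.1 hz, hW0])
  have hlimI := tendsto_setIntegral_norm_gt hI
    (N := fun z : 𝔼 × 𝔼 => ‖z.2 - z.1‖) (by fun_prop) (fun z hz => by
      rw [norm_le_zero_iff, sub_eq_zero] at hz
      simp [flux, hz])
  have hev : ∀ᶠ i : ℕ in atTop,
      ∫ z, {z : 𝔼 × 𝔼 | 1 / ((i : ℝ) + 1) < ‖z.2 - z.1‖}.indicator
        (fun z => flux α p Φ z.1 z.2 * (h z.2 - h z.1)) z ∂(volume.prod volume) ≤
      lam * (∫ x, oddPow p (u x) * h x) - c / 2 * ∫ x, h x := by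
    -- Half of the margin c is spent on the part of ∫ W lost to truncation; the other half survives
    -- the limit and forces ∫ h ≤ 0.
    filter_upwards [hlimW.eventually (lt_mem_nhds (show (∫ z, W z) - c / 2 < ∫ z, W z by linarith))]
      with i hi
    rw [integral_indicator (measurableSet_norm_gt _)] at hi
    have hη : (0 : ℝ) < 1 / ((i : ℝ) + 1) := by positivity
    obtain ⟨j1, j2⟩ := integral_truncFlux_mul_sub hη hp hαp hΦc.measurable hS hhi hhc.measurable
    have e : ∀ z : 𝔼 × 𝔼, {z : 𝔼 × 𝔼 | 1 / ((i : ℝ) + 1) < ‖z.2 - z.1‖}.indicator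
        (fun z => flux α p Φ z.1 z.2 * (h z.2 - h z.1)) z =
        truncFlux α p (1 / ((i : ℝ) + 1)) Φ z.1 z.2 * (h z.2 - h z.1) := fun z => by
      unfold truncFlux
      simp only [indicator_apply, mem_ofPred_eq]
      split_ifs <;> simp
    simp only [e]
    rw [j2, ← integral_const_mul, ← integral_const_mul, ← integral_neg,
      ← integral_sub (jh.const_mul lam) (hhi.const_mul _)]
    refine integral_mono j1.neg ((jh.const_mul lam).sub (hhi.const_mul _)) fun x => ?_
    simp only
    rcases (hh0 x).eq_or_lt with h0 | h0
    · simp [← h0]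
    · have hux : u x < Φ x := by
        by_contra hcon
        have : h x = 0 := max_eq_right (by linarith)
        linarith
      obtain ⟨hx1, hx2⟩ := hx x hux
      have := setIntegral_le_two_mul_integral_truncFlux hη hp hαp hΦc.measurable hS hW x hx1
      have h3 : c / 2 - lam * oddPow p (u x) ≤
          2 * ∫ z, truncFlux α p (1 / ((i : ℝ) + 1)) Φ x (x + z) := by linarith
      have h4 := mul_le_mul_of_nonneg_left h3 h0.le
      linarith
  have hle := le_of_tendsto hlimI hev
  have hint : ∫ x, h x ≤ 0 := by
    have : c / 2 * ∫ x, h x ≤ 0 := by linarith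
    by_contra hcon
    have := mul_pos (half_pos hc) (not_le.1 hcon)
    linarith
  have hz := (integral_eq_zero_iff_of_nonneg hh0 hhi).1
    (le_antisymm hint (integral_nonneg hh0))
  have hz' : h = fun _ => 0 := (Continuous.ae_eq_iff_eq volume hhc continuous_const).1 hz
  have : h x = 0 := congrFun hz' x
  have h5 : Φ x - u x ≤ h x := le_max_left _ _
  linarith

/-! ### Pointwise lower bounds for the symmetrized flux -/

/-- An integrable weight, with its value at the origin removed. -/
noncomputable def decayWeight (α : ℝ) (z : 𝔼) : ℝ :=
  ({0}ᶜ : Set 𝔼).indicator (fun z => (1 + ‖z‖) ^ (-((n : ℝ) + α))) z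

lemma integrable_decayWeight {α : ℝ} (hα : 0 < α) : Integrable (decayWeight (n := n) α) :=
  (integrable_one_add_norm_rpow (by linarith)).indicator (measurableSet_singleton 0).compl

@[simp] lemma decayWeight_zero (α : ℝ) : decayWeight α (0 : 𝔼) = 0 := by simp [decayWeight]

lemma decayWeight_nonneg (α : ℝ) (z : 𝔼) : 0 ≤ decayWeight α z :=
  indicator_nonneg (fun z _ => by positivity) z

lemma decayWeight_of_ne {α : ℝ} {z : 𝔼} (hz : z ≠ 0) :
    decayWeight α z = (1 + ‖z‖) ^ (-((n : ℝ) + α)) := by simp [decayWeight, hz]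

lemma one_le_mul_decayWeight {α : ℝ} (hα : 0 < α) {z : 𝔼} (hz : z ≠ 0) (hz1 : ‖z‖ ≤ 1) :
    1 ≤ 2 ^ ((n : ℝ) + α) * decayWeight α z := by
  rw [decayWeight_of_ne hz, Real.rpow_neg (by positivity), ← div_eq_mul_inv,
    ← Real.div_rpow (by norm_num) (by positivity)]
  refine Real.one_le_rpow ?_ (by positivity)
  rw [one_le_div (by positivity)]
  linarith

lemma rpow_neg_le_mul_decayWeight {α ε : ℝ} (hα : 0 < α) (hε : 0 < ε) {z : 𝔼} (hz : ε ≤ ‖z‖) :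
    ‖z‖ ^ (-((n : ℝ) + α)) ≤ (1 + 1 / ε) ^ ((n : ℝ) + α) * decayWeight α z := by
  have hz0 : 0 < ‖z‖ := hε.trans_le hz
  rw [decayWeight_of_ne (norm_pos_iff.1 hz0), Real.rpow_neg hz0.le, Real.rpow_neg (by positivity),
    ← div_eq_mul_inv, ← Real.div_rpow (by positivity) (by positivity), ← Real.inv_rpow hz0.le]
  refine Real.rpow_le_rpow (by positivity) ?_ (by positivity)
  rw [le_div_iff₀ (by positivity), inv_mul_eq_div, div_le_iff₀ hz0]
  have : 1 ≤ 1 / ε * ‖z‖ := by rw [one_div_mul_eq_div, one_le_div hε]; exact hz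
  linarith

/-- The constant in the lower bound for the flux. -/
noncomputable def fluxConst (n : ℕ) (α b ε M S : ℝ) : ℝ :=
  b ^ (-(2 : ℝ)) * M * 2 ^ ((n : ℝ) + α) +
    b ^ (-(1 + n / α)) * S ^ (n / α) * (1 + 1 / ε) ^ ((n : ℝ) + α)

/-- A decrement is at most q = min(b|z|^α, S). Using S in only n/α of the p - 1 factors of q gives
the integrable decay |z|^(-(n+α)) and keeps b as the base of the exponential growth; S enters to a
power independent of p. -/
lemma flux_far_lower_bound {α b ε S p : ℝ} (hα : 0 < α) (hb : 0 < b) (hε : 0 < ε)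
    (hp : 1 < p) (hpm : 1 + n / α ≤ p) {Φ : 𝔼 → ℝ} {x z : 𝔼} (hz : ε ≤ ‖z‖)
    (h1 : -(Φ (x + z) - Φ x) ≤ b * ‖z‖ ^ α) (hS : |Φ (x + z) - Φ x| ≤ S) :
    -(b ^ (-(1 + n / α)) * S ^ (n / α) * (1 + 1 / ε) ^ ((n : ℝ) + α) *
      (p * b ^ p) * decayWeight α z) ≤ flux α p Φ x (x + z) := by
  have hz0 : 0 < ‖z‖ := hε.trans_le hz
  have hS0 : 0 ≤ S := (abs_nonneg _).trans hS
  set a := Φ (x + z) - Φ x with ha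
  set q := min (b * ‖z‖ ^ α) S with hq
  have hq0 : 0 ≤ q := by positivity
  have hm0 : 0 ≤ (n : ℝ) / α := by positivity
  have hqa : -q ≤ a := by
    have : -a ≤ q := le_min h1 ((neg_le_abs a).trans hS)
    linarith
  have hf : -(q ^ (p - 1)) ≤ oddPow p a := by
    rw [← oddPow_of_nonneg hp hq0, ← oddPow_neg]
    exact monotone_oddPow hp hqa
  have hqb : q ^ (p - 1) ≤ b ^ (p - 1 - n / α) * ‖z‖ ^ (α * (p - 1 - n / α)) * S ^ (n / α) := by
    have e : q ^ (p - 1) = q ^ (p - 1 - n / α) * q ^ ((n : ℝ) / α) := by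
      rw [← Real.rpow_add_of_nonneg hq0 (by linarith) hm0]; congr 1; ring
    rw [e, Real.rpow_mul hz0.le, ← Real.mul_rpow hb.le (by positivity)]
    gcongr
    · linarith
    · exact min_le_left _ _
    · exact min_le_right _ _
  have key : q ^ (p - 1) / ‖z‖ ^ (α * p) ≤
      b ^ (-(1 + n / α)) * S ^ (n / α) * (1 + 1 / ε) ^ ((n : ℝ) + α) *
      (p * b ^ p) * decayWeight α z := by
    calc q ^ (p - 1) / ‖z‖ ^ (α * p)
        ≤ b ^ (p - 1 - n / α) * ‖z‖ ^ (α * (p - 1 - n / α)) * S ^ (n / α) / ‖z‖ ^ (α * p) := by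
          gcongr
      _ = b ^ (-(1 + n / α)) * S ^ (n / α) * (1 * b ^ p) * ‖z‖ ^ (-((n : ℝ) + α)) := by
          have e1 : b ^ (p - 1 - n / α) = b ^ (-(1 + n / α)) * b ^ p := by
            rw [← Real.rpow_add hb]; congr 1; ring
          have e2 : ‖z‖ ^ (α * (p - 1 - n / α)) = ‖z‖ ^ (-((n : ℝ) + α)) * ‖z‖ ^ (α * p) := by
            rw [← Real.rpow_add hz0]; congr 1; field_simp; ring
          rw [e1, e2]
          have : 0 < ‖z‖ ^ (α * p) := by positivity
          field_simp
      _ ≤ b ^ (-(1 + n / α)) * S ^ (n / α) * (p * b ^ p) *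
          ((1 + 1 / ε) ^ ((n : ℝ) + α) * decayWeight α z) := by
          have := rpow_neg_le_mul_decayWeight hα hε hz
          gcongr
      _ = _ := by ring
  unfold flux
  rw [add_sub_cancel_left, ← ha]
  calc _ ≤ -(q ^ (p - 1) / ‖z‖ ^ (α * p)) := neg_le_neg key
    _ = -(q ^ (p - 1)) / ‖z‖ ^ (α * p) := (neg_div _ _).symm
    _ ≤ _ := by gcongr

/-- The two fluxes nearly cancel. What remains is (p - 1)(b|z|^α)^(p-2) times a second difference of
order |z|², and division by |z|^(αp) leaves |z|^(2-2α) ≤ 1. This uses that the competitor is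
smoother than C¹; its constant M enters only linearly. -/
lemma flux_near_lower_bound {α b M p : ℝ} (hα : 0 < α) (hα₁ : α ≤ 1) (hb : 0 < b)
    (hp : 2 < p) (hM : 0 ≤ M) {Φ : 𝔼 → ℝ} {x z : 𝔼} (hz1 : ‖z‖ ≤ 1)
    (h1 : |Φ (x + z) - Φ x| ≤ b * ‖z‖ ^ α) (h2 : |Φ (x - z) - Φ x| ≤ b * ‖z‖ ^ α)
    (h3 : |Φ (x + z) + Φ (x - z) - 2 * Φ x| ≤ M * ‖z‖ ^ 2) :
    -(b ^ (-(2 : ℝ)) * M * 2 ^ ((n : ℝ) + α) * (p * b ^ p) * decayWeight α z) ≤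
      flux α p Φ x (x + z) + flux α p Φ x (x - z) := by
  by_cases hz : z = 0
  · simp [hz, flux]
  have hz0 : 0 < ‖z‖ := norm_pos_iff.2 hz
  unfold flux
  have e0 : x - z - x = -z := by abel
  rw [add_sub_cancel_left, e0, norm_neg, ← add_div]
  have h4 := abs_oddPow_add_le hp h1 h2
  have e1 : Φ (x + z) - Φ x + (Φ (x - z) - Φ x) = Φ (x + z) + Φ (x - z) - 2 * Φ x := by ring
  rw [e1] at h4
  set A := oddPow p (Φ (x + z) - Φ x) + oddPow p (Φ (x - z) - Φ x)
  have key : |A| / ‖z‖ ^ (α * p) ≤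
      b ^ (-(2 : ℝ)) * M * 2 ^ ((n : ℝ) + α) * (p * b ^ p) * decayWeight α z := by
    calc |A| / ‖z‖ ^ (α * p)
        ≤ (p - 1) * (b * ‖z‖ ^ α) ^ (p - 2) * (M * ‖z‖ ^ 2) / ‖z‖ ^ (α * p) := by
          gcongr
          refine h4.trans ?_
          have : 0 ≤ p - 1 := by linarith
          gcongr
      _ = (p - 1) * b ^ (p - 2) * M * ‖z‖ ^ (2 - 2 * α) := by
          have e2 : (b * ‖z‖ ^ α) ^ (p - 2) = b ^ (p - 2) * ‖z‖ ^ (α * (p - 2)) := by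
            rw [Real.mul_rpow hb.le (by positivity), ← Real.rpow_mul hz0.le]
          have e3 : ‖z‖ ^ (α * (p - 2)) * ‖z‖ ^ 2 = ‖z‖ ^ (2 - 2 * α) * ‖z‖ ^ (α * p) := by
            rw [← Real.rpow_natCast, ← Real.rpow_add hz0, ← Real.rpow_add hz0]
            congr 1; push_cast; ring
          have : 0 < ‖z‖ ^ (α * p) := by positivity
          rw [e2, div_eq_iff this.ne']
          linear_combination (p - 1) * b ^ (p - 2) * M * e3
      _ ≤ p * b ^ (p - 2) * M * 1 := by
          have : ‖z‖ ^ (2 - 2 * α) ≤ 1 :=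
            Real.rpow_le_one hz0.le hz1 (by linarith)
          gcongr
          linarith
      _ ≤ p * b ^ (p - 2) * M * (2 ^ ((n : ℝ) + α) * decayWeight α z) := by
          have := one_le_mul_decayWeight hα hz hz1
          gcongr
      _ = _ := by
          have : b ^ (p - 2) = b ^ (-(2 : ℝ)) * b ^ p := by
            rw [← Real.rpow_add hb]; congr 1; ring
          rw [this]; ring
  have h5 : -|A| / ‖z‖ ^ (α * p) ≤ A / ‖z‖ ^ (α * p) := by
    gcongr
    exact neg_abs_le A
  rw [neg_div] at h5
  linarith

/-- The symmetrized flux is bounded below; it is large on the set `G` where `Φ` increases fast. -/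
lemma flux_add_flux_lower_bound {α a b ε D M S p : ℝ} (hα : 0 < α) (hα₁ : α ≤ 1) (ha : 0 < a)
    (hb : 0 < b) (hε : 0 < ε) (hε1 : ε ≤ 1) (hp : 2 < p) (hpm : 1 + n / α ≤ p) (hM : 0 ≤ M)
    {Φ : 𝔼 → ℝ} {x : 𝔼}
    (h1 : ∀ z, -(Φ (x + z) - Φ x) ≤ b * ‖z‖ ^ α)
    (h2 : ∀ z, ‖z‖ ≤ ε → |Φ (x + z) - Φ x| ≤ b * ‖z‖ ^ α)
    (h3 : ∀ z, |Φ (x + z) + Φ (x - z) - 2 * Φ x| ≤ M * ‖z‖ ^ 2)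
    (hS : ∀ x y, |Φ y - Φ x| ≤ S) {G : Set 𝔼} (hGε : ∀ z ∈ G, ε ≤ ‖z‖) (hGD : ∀ z ∈ G, ‖z‖ ≤ D)
    (hG : ∀ z ∈ G, a * ‖z‖ ^ α ≤ Φ (x + z) - Φ x) (z : 𝔼) :
    G.indicator (fun _ => a ^ p / (a * D ^ α)) z -
      2 * fluxConst n α b ε M S * (p * b ^ p) * decayWeight α z ≤
      flux α p Φ x (x + z) + flux α p Φ x (x - z) := by
  have hS0 : 0 ≤ S := (abs_nonneg _).trans (hS x x)
  have hw := decayWeight_nonneg α z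
  have hpb : 0 ≤ p * b ^ p := by positivity
  have hA : 0 ≤ b ^ (-(2 : ℝ)) * M * 2 ^ ((n : ℝ) + α) * (p * b ^ p) * decayWeight α z := by
    positivity
  have hB : 0 ≤ b ^ (-(1 + n / α)) * S ^ (n / α) * (1 + 1 / ε) ^ ((n : ℝ) + α) *
      (p * b ^ p) * decayWeight α z := by
    positivity
  have e : 2 * fluxConst n α b ε M S * (p * b ^ p) * decayWeight α z =
      2 * (b ^ (-(2 : ℝ)) * M * 2 ^ ((n : ℝ) + α) * (p * b ^ p) * decayWeight α z) +
      2 * (b ^ (-(1 + n / α)) * S ^ (n / α) * (1 + 1 / ε) ^ ((n : ℝ) + α) *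
        (p * b ^ p) * decayWeight α z) := by
    unfold fluxConst; ring
  have hfar : ∀ z : 𝔼, ε ≤ ‖z‖ → _ := fun z hz =>
    flux_far_lower_bound hα hb hε (by linarith) hpm hz (h1 z) (hS x (x + z))
  have hneg : x - z = x + -z := sub_eq_add_neg x z
  have hwneg : decayWeight α (-z) = decayWeight α z := by
    simp [decayWeight, indicator_apply]
  by_cases hzG : z ∈ G
  · rw [indicator_of_mem hzG, e]
    have f2 := hfar (-z) (by rw [norm_neg]; exact hGε z hzG)
    rw [hwneg, ← hneg] at f2
    have hz0 : 0 < ‖z‖ := hε.trans_le (hGε z hzG)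
    -- On G the flux towards x + z is at least a^(p-1)|z|^(-α), and |z| ≤ D there.
    have f1 : a ^ p / (a * D ^ α) ≤ flux α p Φ x (x + z) := by
      unfold flux
      rw [add_sub_cancel_left]
      have g1 := monotone_oddPow (show 1 < p by linarith) (hG z hzG)
      rw [oddPow_of_nonneg (by linarith) (by positivity)] at g1
      calc a ^ p / (a * D ^ α) ≤ a ^ p / (a * ‖z‖ ^ α) := by
            have := hGD z hzG
            gcongr
        _ = (a * ‖z‖ ^ α) ^ (p - 1) / ‖z‖ ^ (α * p) := by
            rw [Real.mul_rpow ha.le (by positivity), Real.rpow_sub_one ha.ne',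
              Real.rpow_sub_one (by positivity), ← Real.rpow_mul hz0.le]
            have : 0 < ‖z‖ ^ (α * p) := by positivity
            field_simp
        _ ≤ _ := by gcongr
    linarith
  · rw [indicator_of_notMem hzG, e]
    rcases le_total ε ‖z‖ with h | h
    · have f1 := hfar z h
      have f2 := hfar (-z) (by rwa [norm_neg])
      rw [hwneg, ← hneg] at f2
      linarith
    · have h2' := h2 (-z) (by rwa [norm_neg])
      rw [norm_neg, ← hneg] at h2'
      have f := flux_near_lower_bound hα hα₁ hb hp hM (h.trans hε1) (h2 z h) h2' (h3 z)
      linarith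

/-! ### Smooth perturbations of test functions and stability of Hölder bounds -/

lemma abs_second_difference_le {φ : 𝔼 → ℝ} (hφ : Differentiable ℝ φ) {t : 𝔼} {ε : ℝ}
    (h : ∀ x, ‖fderiv ℝ φ (x + t) - fderiv ℝ φ x‖ ≤ ε) (x y : 𝔼) :
    |(φ (y + t) - φ y) - (φ (x + t) - φ x)| ≤ ε * ‖y - x‖ := by
  have hd : ∀ x, HasFDerivAt (fun x => φ (x + t) - φ x)
      (fderiv ℝ φ (x + t) - fderiv ℝ φ x) x := fun x =>
    ((hasFDerivAt_comp_add_right t).2 (hφ (x + t)).hasFDerivAt).sub (hφ x).hasFDerivAt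
  have := Convex.norm_image_sub_le_of_norm_fderiv_le (f := fun x => φ (x + t) - φ x) (C := ε)
    (s := univ) (fun x _ => (hd x).differentiableAt)
    (fun x _ => by rw [(hd x).fderiv]; exact h x) convex_univ (mem_univ x) (mem_univ y)
  rwa [Real.norm_eq_abs] at this

lemma exists_second_difference_bound {Φ : 𝔼 → ℝ} (h : ContDiff ℝ ((⊤ : ℕ∞) : WithTop ℕ∞) Φ)
    (hc : HasCompactSupport Φ) :
    ∃ M, 0 ≤ M ∧ ∀ x z, |Φ (x + z) + Φ (x - z) - 2 * Φ x| ≤ M * ‖z‖ ^ 2 := by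
  have hd : ContDiff ℝ 1 (fderiv ℝ Φ) := h.fderiv_right (by norm_cast)
  obtain ⟨M, hM⟩ := hd.lipschitzWith_of_hasCompactSupport (hc.fderiv (𝕜 := ℝ)) one_ne_zero
  refine ⟨M, M.2, fun x z => ?_⟩
  have h1 := abs_second_difference_le (h.differentiable (by simp)) (t := z) (ε := M * ‖z‖)
    (fun x => by simpa [dist_eq_norm] using hM.dist_le_mul (x + z) x) (x - z) x
  rw [sub_add_cancel, sub_sub_cancel] at h1
  calc _ = |Φ (x + z) - Φ x - (Φ x - Φ (x - z))| := by congr 1; ring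
    _ ≤ _ := h1
    _ = _ := by ring

lemma MemCOneZero.exists_lipschitz {φ : 𝔼 → ℝ} (h : MemCOneZero φ) : ∃ L, LipschitzWith L φ :=
  h.1.lipschitzWith_of_hasCompactSupport h.2 one_ne_zero

/-- Mollifications of a `C^1` function are close to it in the Hölder seminorm. -/
lemma eventually_mollify_close {α τ : ℝ} (hα₀ : 0 < α) (hα₁ : α ≤ 1) (hτ : 0 < τ) {φ : 𝔼 → ℝ}
    (hφ : MemCOneZero φ) :
    ∀ᶠ i : ℕ in atTop, (∀ x, |mollify (shrinkingBump i) φ x - φ x| ≤ τ) ∧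
      ∀ x y, |(mollify (shrinkingBump i) φ y - φ y) - (mollify (shrinkingBump i) φ x - φ x)| ≤
        2 * τ * ‖y - x‖ ^ α := by
  have hφc := hφ.1.continuous
  have hu1 := Metric.uniformContinuous_iff.1 (hφ.2.uniformContinuous_of_continuous hφc) τ hτ
  have hu2 := Metric.uniformContinuous_iff.1
    ((hφ.2.fderiv (𝕜 := ℝ)).uniformContinuous_of_continuous (hφ.1.continuous_fderiv one_ne_zero)) τ hτ
  obtain ⟨δ₁, hδ₁, h1⟩ := hu1
  obtain ⟨δ₂, hδ₂, h2⟩ := hu2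
  filter_upwards [(tendsto_rOut_shrinkingBump (n := n)).eventually (gt_mem_nhds hδ₁),
    (tendsto_rOut_shrinkingBump (n := n)).eventually (gt_mem_nhds hδ₂)] with i hi1 hi2
  set η := shrinkingBump (n := n) i
  have hsup : ∀ x, |mollify η φ x - φ x| ≤ τ := fun x =>
    abs_mollify_sub_le η hφc fun y hy => (h1 (hy.trans hi1)).le
  refine ⟨hsup, fun x y => ?_⟩
  have hlip : |(mollify η φ y - φ y) - (mollify η φ x - φ x)| ≤ τ * ‖y - x‖ := by
    -- The increment of the mollification is the mollification of the increment Ψ. By uniform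
    -- continuity of the gradient, Ψ varies by at most τ|y - x| over the radius of the bump.
    set Ψ : 𝔼 → ℝ := fun s => φ (s + (y - x)) - φ s with hΨ
    have hΨc : Continuous Ψ := by fun_prop
    have e : mollify η φ y - mollify η φ x = mollify η Ψ x := by
      rw [mollify_sub_mollify η hφc]
      unfold mollify
      refine integral_congr_ae (Eventually.of_forall fun t => ?_)
      simp only [hΨ]
      rw [show x - t + (y - x) = y - t by abel]
    have e2 : Ψ x = φ y - φ x := by simp [hΨ]
    have := abs_mollify_sub_le η hΨc (x := x) (ε := τ * ‖y - x‖) fun s hs => ?_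
    · rw [← e, e2] at this
      calc _ = |mollify η φ y - mollify η φ x - (φ y - φ x)| := by congr 1; ring
        _ ≤ _ := this
    · have h3 := abs_second_difference_le (hφ.1.differentiable one_ne_zero) (t := s - x) (ε := τ)
        (fun x' => by
          rw [← dist_eq_norm]
          refine (h2 ?_).le
          rw [dist_eq_norm, add_sub_cancel_left, ← dist_eq_norm]
          exact hs.trans hi2) x y
      rw [add_sub_cancel] at h3
      calc |Ψ s - Ψ x| = |φ (y + (s - x)) - φ y - (φ s - φ x)| := by
            simp only [hΨ]
            rw [show s + (y - x) = y + (s - x) by abel, show x + (y - x) = y by abel]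
            congr 1; ring
        _ ≤ _ := h3
  rcases le_total ‖y - x‖ 1 with h | h
  · refine hlip.trans ?_
    have : ‖y - x‖ ≤ ‖y - x‖ ^ α := by
      rcases (norm_nonneg (y - x)).eq_or_lt with h0 | h0
      · rw [← h0, Real.zero_rpow hα₀.ne']
      · simpa using Real.rpow_le_rpow_of_exponent_ge h0 h hα₁
    have h0 := norm_nonneg (y - x)
    nlinarith
  · have hx := hsup x
    have hy := hsup y
    calc _ ≤ |mollify η φ y - φ y| + |mollify η φ x - φ x| := abs_sub _ _
      _ ≤ 2 * τ * 1 := by linarith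
      _ ≤ _ := by
        gcongr
        exact Real.one_le_rpow h hα₀.le

/-- A smooth function close to `φ` that exceeds it at `x₀` and lies below it away from `x₀`. -/
lemma exists_smooth_perturbation {α τ r : ℝ} (hα₀ : 0 < α) (hα₁ : α ≤ 1) (hτ : 0 < τ) (hr : 0 < r)
    {φ : 𝔼 → ℝ} (hφ : MemCOneZero φ) {Ω : Set 𝔼} (hb : Bornology.IsBounded Ω) (x₀ : 𝔼) :
    ∃ Φ : 𝔼 → ℝ, ContDiff ℝ ((⊤ : ℕ∞) : WithTop ℕ∞) Φ ∧ HasCompactSupport Φ ∧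
      (∀ x y, |(Φ y - φ y) - (Φ x - φ x)| ≤ τ * ‖y - x‖ ^ α) ∧
      ∃ δ, 0 < δ ∧ φ x₀ + δ ≤ Φ x₀ ∧
        (∀ x ∈ Ω, x ∉ Metric.ball x₀ r → Φ x ≤ φ x - δ) ∧
        ∀ x, x ∉ Metric.ball x₀ r → Φ x ≤ max (φ x) 0 := by
  obtain ⟨R₁, hR₁⟩ := (hb.union (hφ.2.isCompact.cthickening (r := 1)).isBounded).subset_closedBall x₀
  set R := max R₁ 1 with hR
  have hR0 : 0 < R := lt_max_of_lt_right one_pos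
  set χ₁ : ContDiffBump x₀ := ⟨r / 2, r, by positivity, by linarith⟩ with hχ₁
  set χ₂ : ContDiffBump x₀ := ⟨R, R + 1, hR0, by linarith⟩ with hχ₂
  -- The profile is 1 at x₀, -1 in the large ball outside the small one, and nonpositive everywhere
  -- outside the small ball. It turns mere touching into strict separation.
  set θ : 𝔼 → ℝ := fun x => 2 * χ₁ x - χ₂ x with hθ
  have hθd : ContDiff ℝ ((⊤ : ℕ∞) : WithTop ℕ∞) θ :=
    (contDiff_const.mul χ₁.contDiff).sub χ₂.contDiff
  have hθc : HasCompactSupport θ :=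
    (χ₁.hasCompactSupport.mul_left (f := fun _ => (2 : ℝ))).sub χ₂.hasCompactSupport
  obtain ⟨L, hL⟩ := hθd.lipschitzWith_of_hasCompactSupport hθc (by simp)
  obtain ⟨H, hH0, hH, -⟩ := exists_holder_of_lipschitz hα₀ hα₁ hL hθc
  -- Half of the Hölder budget τ pays for δ₀θ and half for mollification, whose pointwise error is
  -- kept below δ₀/4.
  set δ₀ := τ / (2 * (H + 1)) with hδ₀
  have hδ₀pos : 0 < δ₀ := by positivity
  have hδH : δ₀ * H ≤ τ / 2 := by
    rw [hδ₀, div_mul_eq_mul_div, div_le_div_iff₀ (by positivity) (by positivity)]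
    nlinarith
  obtain ⟨i, hi⟩ := (eventually_mollify_close hα₀ hα₁
    (show 0 < min (δ₀ / 4) (τ / 4) by positivity) hφ).exists
  obtain ⟨hi1, hi2⟩ := hi
  set φi := mollify (shrinkingBump i) φ with hφi
  have hi1' : ∀ x, |φi x - φ x| ≤ δ₀ / 4 := fun x => (hi1 x).trans (min_le_left _ _)
  have hθ0 : θ x₀ = 1 := by
    simp only [hθ]
    rw [χ₁.one_of_mem_closedBall (Metric.mem_closedBall_self (by positivity)),
      χ₂.one_of_mem_closedBall (Metric.mem_closedBall_self hR0.le)]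
    norm_num
  have hθneg : ∀ x, x ∉ Metric.ball x₀ r → θ x ≤ 0 := fun x hx => by
    simp only [hθ]
    rw [χ₁.zero_of_le_dist (not_lt.1 hx)]
    have := χ₂.nonneg (x := x)
    linarith
  have hθbig : ∀ x ∈ Metric.closedBall x₀ R, x ∉ Metric.ball x₀ r → θ x = -1 := fun x hx hxr => by
    simp only [hθ]
    rw [χ₁.zero_of_le_dist (not_lt.1 hxr), χ₂.one_of_mem_closedBall hx]
    norm_num
  have hφiout : ∀ x, x ∉ Metric.closedBall x₀ R → φi x = 0 := fun x hx => by
    refine image_eq_zero_of_notMem_tsupport fun h => hx ?_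
    have h1 : x ∈ Metric.cthickening 1 (tsupport φ) := by
      refine Metric.cthickening_mono ?_ _ (tsupport_mollify_subset _ _ h)
      change 1 / ((i : ℝ) + 1) ≤ 1
      rw [div_le_one (by positivity)]
      have : (0 : ℝ) ≤ i := by positivity
      linarith
    exact Metric.closedBall_subset_closedBall (le_max_left _ _) (hR₁ (Or.inr h1))
  have hin : ∀ x ∈ Metric.closedBall x₀ R, x ∉ Metric.ball x₀ r →
      φi x + δ₀ * θ x ≤ φ x - δ₀ / 2 := fun x hx hxr => by
    have := (abs_le.1 (hi1' x)).2
    rw [hθbig x hx hxr]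
    linarith
  refine ⟨fun x => φi x + δ₀ * θ x, (contDiff_mollify _ hφ.1.continuous).add
    (contDiff_const.mul hθd), (hasCompactSupport_mollify _ hφ.2).add
    (hθc.mul_left (f := fun _ => δ₀)), ?_, δ₀ / 2, by positivity, ?_, ?_, ?_⟩
  · intro x y
    have h1 := hi2 x y
    have h2 := hH x y
    have h3 : 2 * min (δ₀ / 4) (τ / 4) ≤ τ / 2 := by
      have := min_le_right (δ₀ / 4) (τ / 4)
      linarith
    have hpow : 0 ≤ ‖y - x‖ ^ α := by positivity
    calc |φi y + δ₀ * θ y - φ y - (φi x + δ₀ * θ x - φ x)|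
        = |(φi y - φ y - (φi x - φ x)) + δ₀ * (θ y - θ x)| := by congr 1; ring
      _ ≤ |φi y - φ y - (φi x - φ x)| + δ₀ * |θ y - θ x| := by
          refine (abs_add_le _ _).trans_eq ?_
          rw [abs_mul, abs_of_pos hδ₀pos]
      _ ≤ τ / 2 * ‖y - x‖ ^ α + δ₀ * (H * ‖y - x‖ ^ α) := by
          gcongr
          exact h1.trans (by gcongr)
      _ = (τ / 2 + δ₀ * H) * ‖y - x‖ ^ α := by ring
      _ ≤ _ := by gcongr; linarith
  · simp only [hθ0]
    have := (abs_le.1 (hi1' x₀)).1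
    linarith
  · intro x hx hxr
    exact hin x (Metric.closedBall_subset_closedBall (le_max_left _ _) (hR₁ (Or.inl hx))) hxr
  · intro x hxr
    by_cases hx : x ∈ Metric.closedBall x₀ R
    · exact ((hin x hx hxr).trans (by linarith)).trans (le_max_left _ _)
    · refine le_trans ?_ (le_max_right _ _)
      simp only [hφiout x hx, zero_add]
      exact mul_nonpos_of_nonneg_of_nonpos hδ₀pos.le (hθneg x hxr)

/-- A one-sided bound for difference quotients at a point bounds the derivative. -/
lemma norm_fderiv_le_of_one_sided {φ : 𝔼 → ℝ} {x₀ : 𝔼} (hd : DifferentiableAt ℝ φ x₀) {b : ℝ}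
    (hb : 0 ≤ b) (h : ∀ z, -(φ (x₀ + z) - φ x₀) ≤ b * ‖z‖) : ‖fderiv ℝ φ x₀‖ ≤ b := by
  have key : ∀ e : 𝔼, -(b * ‖e‖) ≤ fderiv ℝ φ x₀ e := by
    intro e
    have h1 : HasDerivAt (fun t : ℝ => φ (x₀ + t • e)) (fderiv ℝ φ x₀ e) 0 := by
      have h2 : HasDerivAt (fun t : ℝ => x₀ + t • e) e 0 := by
        simpa using ((hasDerivAt_id (0 : ℝ)).smul_const e).const_add x₀
      have h3 : HasFDerivAt φ (fderiv ℝ φ x₀) (x₀ + (0 : ℝ) • e) := by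
        simpa using hd.hasFDerivAt
      exact h3.comp_hasDerivAt 0 h2
    have h4 := h1.tendsto_slope_zero_right
    refine ge_of_tendsto h4 ?_
    filter_upwards [self_mem_nhdsWithin] with t ht
    have ht0 : 0 < t := ht
    have h5 := h (t • e)
    rw [norm_smul, Real.norm_of_nonneg ht0.le] at h5
    simp only [zero_add, zero_smul, add_zero, smul_eq_mul]
    rw [inv_mul_eq_div, le_div_iff₀ ht0]
    linarith
  refine ContinuousLinearMap.opNorm_le_bound _ hb fun e => ?_
  rw [Real.norm_eq_abs, abs_le]
  refine ⟨key e, ?_⟩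
  have := key (-e)
  rw [norm_neg, map_neg] at this
  linarith

/-- Only decrements at x₀ are controlled, yet nearby the bound becomes two-sided. For α < 1,
Lipschitz continuity makes local α-Hölder quotients arbitrarily small. For α = 1, the bound in the
directions e and -e controls the gradient at x₀, and strict differentiability spreads it to a
neighbourhood. -/
lemma exists_local_holder {α b₀ b : ℝ} (hα₀ : 0 < α) (hα₁ : α ≤ 1) (hb₀ : 0 ≤ b₀) (hb : b₀ < b)
    {φ : 𝔼 → ℝ} (hφ : MemCOneZero φ) {x₀ : 𝔼}
    (h : ∀ z, -(φ (x₀ + z) - φ x₀) ≤ b₀ * ‖z‖ ^ α) :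
    ∃ ε, 0 < ε ∧ ∀ x ∈ Metric.ball x₀ ε, ∀ y ∈ Metric.ball x₀ ε,
      |φ y - φ x| ≤ b * ‖y - x‖ ^ α := by
  rcases hα₁.eq_or_lt with rfl | hlt
  · simp only [Real.rpow_one] at h ⊢
    have h1 := norm_fderiv_le_of_one_sided (hφ.1.differentiable one_ne_zero x₀) hb₀ h
    have h2 := hφ.1.contDiffAt.hasStrictFDerivAt (x := x₀) one_ne_zero
    obtain ⟨s, hs, hl⟩ := h2.exists_lipschitzOnWith_of_nnnorm_lt ⟨b, hb₀.trans hb.le⟩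
      (show ‖fderiv ℝ φ x₀‖ < b by linarith)
    obtain ⟨ε, hε, hεs⟩ := Metric.mem_nhds_iff.1 hs
    refine ⟨ε, hε, fun x hx y hy => ?_⟩
    have := hl.dist_le_mul y (hεs hy) x (hεs hx)
    rwa [Real.dist_eq, dist_eq_norm] at this
  · obtain ⟨L, hL⟩ := hφ.exists_lipschitz
    have hlim : Tendsto (fun t : ℝ => L * (2 * t) ^ (1 - α)) (𝓝 0) (𝓝 0) := by
      have : ContinuousAt (fun t : ℝ => (L : ℝ) * (2 * t) ^ (1 - α)) 0 := by
        refine ContinuousAt.mul continuousAt_const (ContinuousAt.rpow_const (by fun_prop) ?_)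
        exact Or.inr (by linarith)
      simpa [ContinuousAt, Real.zero_rpow (by linarith : 1 - α ≠ 0)] using this
    obtain ⟨δ, hδ, hδ'⟩ := Metric.eventually_nhds_iff.1
      (hlim.eventually (gt_mem_nhds (hb₀.trans_lt hb)))
    refine ⟨δ / 2, by positivity, fun x hx y hy => ?_⟩
    have h1 : |φ y - φ x| ≤ L * ‖y - x‖ := by
      have := hL.dist_le_mul y x
      rwa [Real.dist_eq, dist_eq_norm] at this
    rcases (norm_nonneg (y - x)).eq_or_lt with h0 | h0
    · rw [← h0, Real.zero_rpow hα₀.ne', mul_zero]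
      simpa [← h0] using h1
    have hd2 : ‖y - x‖ ≤ 2 * (δ / 2) := by
      rw [← dist_eq_norm]
      have := dist_triangle_right y x x₀
      rw [Metric.mem_ball] at hx hy
      linarith
    have h2 : L * (2 * (δ / 2)) ^ (1 - α) < b := hδ' (by
      rw [Real.dist_eq, sub_zero, abs_of_pos (by positivity)]; linarith)
    calc |φ y - φ x| ≤ L * ‖y - x‖ := h1
      _ = L * ‖y - x‖ ^ (1 - α) * ‖y - x‖ ^ α := by
          rw [mul_assoc, ← Real.rpow_add h0]; simp
      _ ≤ L * (2 * (δ / 2)) ^ (1 - α) * ‖y - x‖ ^ α := by gcongr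
      _ ≤ _ := by gcongr

/-- Stability of one-sided Hölder bounds under small perturbations of the function and the point. -/
lemma exists_stable_holder_bounds {α b₀ b : ℝ} (hα₀ : 0 < α) (hα₁ : α ≤ 1) (hb₀ : 0 ≤ b₀)
    (hb : b₀ < b) {φ : 𝔼 → ℝ} (hφ : MemCOneZero φ) {x₀ : 𝔼}
    (h : ∀ z, -(φ (x₀ + z) - φ x₀) ≤ b₀ * ‖z‖ ^ α) :
    ∃ ε ρ τ, 0 < ε ∧ ε ≤ 1 ∧ 0 < ρ ∧ 0 < τ ∧ ∀ Φ : 𝔼 → ℝ,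
      (∀ x y, |(Φ y - φ y) - (Φ x - φ x)| ≤ τ * ‖y - x‖ ^ α) → ∀ x ∈ Metric.ball x₀ ρ,
        (∀ z, -(Φ (x + z) - Φ x) ≤ b * ‖z‖ ^ α) ∧
        ∀ z, ‖z‖ ≤ ε → |Φ (x + z) - Φ x| ≤ b * ‖z‖ ^ α := by
  set δ := (b - b₀) / 2 with hδ
  have hδ0 : 0 < δ := by linarith
  obtain ⟨ε₁, hε₁, hloc⟩ := exists_local_holder hα₀ hα₁ hb₀ (show b₀ < b₀ + δ by linarith) hφ h
  obtain ⟨L, hL⟩ := hφ.exists_lipschitz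
  set ε := min (ε₁ / 2) 1 with hε
  have hε0 : 0 < ε := by positivity
  have hεε₁ : 2 * ε ≤ ε₁ := by have := min_le_left (ε₁ / 2) 1; linarith
  -- For |z| ≥ ε, moving the base point from x₀ to x changes the increment by at most 2Lρ, which
  -- fits into δ|z|^α. Smaller z are covered by the local bound.
  set ρ := min ε (δ * ε ^ α / (2 * (L + 1))) with hρ
  have hρ0 : 0 < ρ := by positivity
  have hρε : ρ ≤ ε := min_le_left _ _
  have hρL : 2 * L * ρ ≤ δ * ε ^ α := by
    have h1 : ρ ≤ δ * ε ^ α / (2 * (L + 1)) := min_le_right _ _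
    rw [le_div_iff₀ (by positivity)] at h1
    linarith
  refine ⟨ε, ρ, δ, hε0, min_le_right _ _, hρ0, hδ0, fun Φ hΦ x hx => ?_⟩
  have hbe : b = b₀ + δ + δ := by rw [hδ]; ring
  have hclose : ∀ z, |(Φ (x + z) - Φ x) - (φ (x + z) - φ x)| ≤ δ * ‖z‖ ^ α := fun z => by
    have := hΦ x (x + z)
    rw [add_sub_cancel_left] at this
    calc _ = |Φ (x + z) - φ (x + z) - (Φ x - φ x)| := by congr 1; ring
      _ ≤ _ := this
  have hxd : ‖x - x₀‖ < ρ := by rwa [← dist_eq_norm]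
  have hnear : ∀ z, ‖z‖ ≤ ε → |φ (x + z) - φ x| ≤ (b₀ + δ) * ‖z‖ ^ α := fun z hz => by
    have := hloc x (by rw [mem_ball_iff_norm]; linarith) (x + z) (by
      rw [mem_ball_iff_norm]
      calc ‖x + z - x₀‖ = ‖(x - x₀) + z‖ := by congr 1; abel
        _ ≤ ‖x - x₀‖ + ‖z‖ := norm_add_le _ _
        _ < ε₁ := by linarith)
    rwa [add_sub_cancel_left] at this
  have hnear' : ∀ z, ‖z‖ ≤ ε → |Φ (x + z) - Φ x| ≤ b * ‖z‖ ^ α := fun z hz => by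
    have h1 := hnear z hz
    have h2 := hclose z
    rw [hbe, add_mul]
    calc |Φ (x + z) - Φ x| = |(φ (x + z) - φ x) + ((Φ (x + z) - Φ x) - (φ (x + z) - φ x))| := by
          congr 1; ring
      _ ≤ _ := abs_add_le _ _
      _ ≤ _ := by gcongr
  refine ⟨fun z => ?_, hnear'⟩
  rcases le_total ‖z‖ ε with hz | hz
  · exact (neg_le_abs _).trans (hnear' z hz)
  · have h1 := (abs_le.1 (hclose z)).1
    have h2 := h z
    have hl : ∀ y : 𝔼, |φ (y + (x - x₀)) - φ y| ≤ L * ρ := fun y => by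
      have := hL.dist_le_mul (y + (x - x₀)) y
      rw [Real.dist_eq, dist_eq_norm, add_sub_cancel_left] at this
      exact this.trans (by gcongr)
    have h3 := (abs_le.1 (hl x₀)).2
    have h4 := (abs_le.1 (hl (x₀ + z))).1
    rw [add_sub_cancel] at h3
    rw [show x₀ + z + (x - x₀) = x + z by abel] at h4
    have h5 : δ * ε ^ α ≤ δ * ‖z‖ ^ α := by gcongr
    rw [hbe]
    linarith

/-- Stability of a strict lower bound for one difference quotient. -/
lemma exists_stable_lower_bound {α a : ℝ} (hα₀ : 0 < α) {φ : 𝔼 → ℝ} (hφ : Continuous φ)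
    {x₀ z₁ : 𝔼} (h : a * ‖z₁‖ ^ α < φ (x₀ + z₁) - φ x₀) :
    ∃ ρ τ s, 0 < ρ ∧ 0 < τ ∧ 0 < s ∧ ∀ Φ : 𝔼 → ℝ,
      (∀ x y, |(Φ y - φ y) - (Φ x - φ x)| ≤ τ * ‖y - x‖ ^ α) → ∀ x ∈ Metric.ball x₀ ρ,
        ∀ z ∈ Metric.ball z₁ s, a * ‖z‖ ^ α ≤ Φ (x + z) - Φ x := by
  obtain ⟨τ, hτ, hτ'⟩ : ∃ τ : ℝ, 0 < τ ∧ (a + τ) * ‖z₁‖ ^ α < φ (x₀ + z₁) - φ x₀ := by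
    have hlim : Tendsto (fun τ : ℝ => (a + τ) * ‖z₁‖ ^ α) (𝓝[>] 0) (𝓝 (a * ‖z₁‖ ^ α)) := by
      have : Tendsto (fun τ : ℝ => (a + τ) * ‖z₁‖ ^ α) (𝓝 0) (𝓝 ((a + 0) * ‖z₁‖ ^ α)) :=
        (tendsto_id.const_add a).mul_const _
      rw [add_zero] at this
      exact this.mono_left nhdsWithin_le_nhds
    obtain ⟨τ, h1, h2⟩ := ((hlim.eventually (gt_mem_nhds h)).and self_mem_nhdsWithin).exists
    exact ⟨τ, h2, h1⟩
  have hc : Continuous fun q : 𝔼 × 𝔼 => φ (q.1 + q.2) - φ q.1 - (a + τ) * ‖q.2‖ ^ α := by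
    have h1 : Continuous fun q : 𝔼 × 𝔼 => ‖q.2‖ ^ α :=
      continuous_snd.norm.rpow_const fun _ => Or.inr hα₀.le
    fun_prop
  have hev := (hc.tendsto (x₀, z₁)).eventually (lt_mem_nhds
    (show 0 < φ (x₀ + z₁) - φ x₀ - (a + τ) * ‖z₁‖ ^ α by linarith))
  obtain ⟨δ, hδ, hδ'⟩ := Metric.eventually_nhds_iff.1 hev
  refine ⟨δ, τ, δ, hδ, hτ, hδ, fun Φ hΦ x hx z hz => ?_⟩
  have h1 := hδ' (show dist (x, z) (x₀, z₁) < δ by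
    rw [Prod.dist_eq]; exact max_lt hx hz)
  have h2 := (abs_le.1 (hΦ x (x + z))).1
  rw [add_sub_cancel_left] at h2
  simp only at h1
  linarith

/-! ### Growth comparison at a touching point -/

/-- The growth comparison obtained from a test function touching the limit of minimizers from
below. -/
lemma eventually_growth_le_of_touching (hn : 1 ≤ n) {α : ℝ} (hα₀ : 0 < α) (hα₁ : α ≤ 1)
    {Ω : Set 𝔼} (hΩ : IsOpen Ω) (hΩb : Bornology.IsBounded Ω) {p lam : ℕ → ℝ}
    (hp : Tendsto p atTop atTop) (hp₂ : ∀ k, 2 * (n : ℝ) < α * p k) (hlam : ∀ k, 0 ≤ lam k)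
    {u : ℕ → 𝔼 → ℝ} {w : 𝔼 → ℝ} (hu : ∀ k, IsRayleighMinimizer Ω α (p k) (lam k) (u k))
    (huw : TendstoUniformly u w atTop) {φ : 𝔼 → ℝ} (hφ : MemCOneZero φ) {x₀ : 𝔼} (hx₀ : x₀ ∈ Ω)
    (heq : φ x₀ = w x₀) (hle : ∀ x, φ x ≤ w x) {a b₀ b D ε₀ : ℝ} (ha : 0 < a) (hb₀ : 0 ≤ b₀)
    (hb : b₀ < b) (hφb : ∀ z, -(φ (x₀ + z) - φ x₀) ≤ b₀ * ‖z‖ ^ α)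
    {G : Set 𝔼} (hGm : MeasurableSet G) (hε₀ : 0 < ε₀) (hGε : ∀ z ∈ G, ε₀ ≤ ‖z‖)
    (hGD : ∀ z ∈ G, ‖z‖ ≤ D)
    (hG : ∃ ρ τ, 0 < ρ ∧ 0 < τ ∧ ∀ Φ : 𝔼 → ℝ,
      (∀ x y, |(Φ y - φ y) - (Φ x - φ x)| ≤ τ * ‖y - x‖ ^ α) → ∀ x ∈ Metric.ball x₀ ρ,
        ∀ z ∈ G, a * ‖z‖ ^ α ≤ Φ (x + z) - Φ x)
    {r₀ : ℝ} (hr₀ : 0 < r₀) {l : ℕ → ℝ}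
    (hl : ∀ᶠ k in atTop, ∀ x ∈ Metric.ball x₀ r₀, l k ≤ lam k * oddPow (p k) (u k x)) :
    ∃ C, ∀ᶠ k in atTop,
      l k + (volume G).toReal / (a * D ^ α) * a ^ p k ≤ C * (p k * b ^ p k) := by
  have hn' : (1 : ℝ) ≤ n := by exact_mod_cast hn
  have hbpos : 0 < b := hb₀.trans_lt hb
  obtain ⟨ε₁, ρ₁, τ₁, hε₁, hε₁1, hρ₁, hτ₁, hst⟩ :=
    exists_stable_holder_bounds hα₀ hα₁ hb₀ hb hφ hφb
  obtain ⟨ρ₂, τ₂, hρ₂, hτ₂, hG⟩ := hG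
  obtain ⟨r₁, hr₁, hr₁Ω⟩ := Metric.isOpen_iff.1 hΩ x₀ hx₀
  set r := min (min r₀ r₁) (min ρ₁ ρ₂) with hr
  have hr0 : 0 < r := by positivity
  have hrr₀ : r ≤ r₀ := (min_le_left _ _).trans (min_le_left _ _)
  have hrr₁ : r ≤ r₁ := (min_le_left _ _).trans (min_le_right _ _)
  have hrρ₁ : r ≤ ρ₁ := (min_le_right _ _).trans (min_le_left _ _)
  have hrρ₂ : r ≤ ρ₂ := (min_le_right _ _).trans (min_le_right _ _)
  -- Φ is fixed before k, so its constants S and M are absorbed in the final C.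
  obtain ⟨Φ, hΦs, hΦc, hΦτ, δ, hδ, hΦx₀, hΦin, hΦout⟩ :=
    exists_smooth_perturbation hα₀ hα₁ (show 0 < min τ₁ τ₂ by positivity) hr0 hφ hΩb x₀
  have hΦτ₁ : ∀ x y, |(Φ y - φ y) - (Φ x - φ x)| ≤ τ₁ * ‖y - x‖ ^ α := fun x y =>
    (hΦτ x y).trans (by gcongr; exact min_le_left _ _)
  have hΦτ₂ : ∀ x y, |(Φ y - φ y) - (Φ x - φ x)| ≤ τ₂ * ‖y - x‖ ^ α := fun x y =>
    (hΦτ x y).trans (by gcongr; exact min_le_right _ _)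
  obtain ⟨L, hL⟩ := hΦs.lipschitzWith_of_hasCompactSupport hΦc (by simp)
  obtain ⟨S, hS0, -, hS⟩ := exists_holder_of_lipschitz hα₀ hα₁ hL hΦc
  obtain ⟨M, hM0, hM⟩ := exists_second_difference_bound hΦs hΦc
  set ε := min ε₁ ε₀ with hε
  have hε0 : 0 < ε := by positivity
  set F := fluxConst n α b ε M S with hF
  have hw0 : ∀ x, x ∉ Ω → w x = 0 := fun x hx =>
    tendsto_nhds_unique (huw.tendsto_at x) (by simp [(hu _).1.2 x hx])
  have hΦΩ : ∀ x, x ∉ Ω → Φ x ≤ 0 := fun x hx => by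
    have h1 := hΦout x fun h => hx (hr₁Ω (Metric.ball_subset_ball hrr₁ h))
    have h2 := hle x
    rw [hw0 x hx] at h2
    rwa [max_eq_right h2] at h1
  have hGf : volume G ≠ ∞ := by
    refine ne_top_of_le_ne_top (measure_closedBall_lt_top (x := (0 : 𝔼)) (r := D)).ne
      (measure_mono fun z hz => ?_)
    rw [mem_closedBall_zero_iff]; exact hGD z hz
  refine ⟨2 * F * ∫ z : 𝔼, decayWeight α z, ?_⟩
  filter_upwards [hl, Metric.tendstoUniformly_iff.1 huw δ hδ,
    hp.eventually (eventually_ge_atTop (1 + n / α))] with k hk1 hk2 hk3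
  -- If the inequality fails for some large k, the bracket of the comparison principle is positive
  -- on {u_k < Φ}, so Φ ≤ u_k. This contradicts Φ(x₀) ≥ w(x₀) + δ > u_k(x₀).
  by_contra! hcon
  have hαp : (n : ℝ) < α * p k := by linarith [hp₂ k]
  have hp2 : 2 < p k := by
    have hp0 : 0 ≤ p k := le_trans (by positivity) hk3
    have := hp₂ k
    nlinarith
  set W : 𝔼 → ℝ := fun z => G.indicator (fun _ => a ^ p k / (a * D ^ α)) z -
    2 * F * (p k * b ^ p k) * decayWeight α z with hW
  have hi1 : Integrable (G.indicator fun _ : 𝔼 => a ^ p k / (a * D ^ α)) :=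
    (integrable_indicator_iff hGm).2 (integrableOn_const hGf)
  have hi2 := (integrable_decayWeight (n := n) hα₀).const_mul (2 * F * (p k * b ^ p k))
  have hWint : ∫ z, W z = (volume G).toReal / (a * D ^ α) * a ^ p k -
      (2 * F * ∫ z : 𝔼, decayWeight α z) * (p k * b ^ p k) := by
    rw [hW, integral_sub hi1 hi2, integral_const_mul, integral_indicator_const _ hGm,
      Measure.real, smul_eq_mul]
    ring
  have hW0 : W 0 = 0 := by
    have h0 : (0 : 𝔼) ∉ G := fun h => by
      have := hGε 0 h
      rw [norm_zero] at this
      linarith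
    simp [hW, indicator_of_notMem h0]
  have hfin := gagliardoEnergy_ne_top_of_lipschitz hn hα₀ hα₁ (by linarith) (hp₂ k).le hL hΦc
  have key := (hu k).le_of_flux_lower_bound hΩb (hlam k) hp2 hαp hL.continuous hfin hS hΦΩ
    (hi1.sub hi2) hW0 (c := l k + ∫ z, W z) (by rw [hWint]; linarith) (fun x hx => ?_) x₀
  · have h1 := hk2 x₀
    rw [Real.dist_eq] at h1
    have := (abs_lt.1 h1).1
    linarith
  -- Outside the small ball, Φ ≤ φ - δ ≤ w - δ < u_k in Ω, and Φ ≤ 0 = u_k off Ω. So Φ exceeds u_k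
  -- only where the stable bounds apply.
  · have hxr : x ∈ Metric.ball x₀ r := by
      by_contra hxr
      by_cases hxΩ : x ∈ Ω
      · have h1 := hΦin x hxΩ hxr
        have h2 := hk2 x
        rw [Real.dist_eq] at h2
        have := (abs_lt.1 h2).2
        linarith [hle x]
      · have h1 := hΦΩ x hxΩ
        rw [(hu k).1.2 x hxΩ] at hx
        linarith
    obtain ⟨hs1, hs2⟩ := hst Φ hΦτ₁ x (Metric.ball_subset_ball hrρ₁ hxr)
    refine ⟨fun z => ?_, add_le_add_left (hk1 x (Metric.ball_subset_ball hrr₀ hxr)) _⟩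
    exact flux_add_flux_lower_bound hα₀ hα₁ ha hbpos hε0 ((min_le_left _ _).trans hε₁1) hp2 hk3 hM0
      hs1 (fun z hz => hs2 z (hz.trans (min_le_left _ _))) (hM x) hS
      (fun z hz => (min_le_right _ _).trans (hGε z hz)) hGD
      (hG Φ hΦτ₂ x (Metric.ball_subset_ball hrρ₂ hxr)) z

/-- At a touching point, a large difference quotient is impossible. -/
lemma false_of_touching_of_lt (hn : 1 ≤ n) {α : ℝ} (hα₀ : 0 < α) (hα₁ : α ≤ 1)
    {Ω : Set 𝔼} (hΩ : IsOpen Ω) (hΩb : Bornology.IsBounded Ω) {p lam : ℕ → ℝ}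
    (hp : Tendsto p atTop atTop) (hp₂ : ∀ k, 2 * (n : ℝ) < α * p k) (hlam : ∀ k, 0 ≤ lam k)
    {u : ℕ → 𝔼 → ℝ} {w : 𝔼 → ℝ} (hu : ∀ k, IsRayleighMinimizer Ω α (p k) (lam k) (u k))
    (huw : TendstoUniformly u w atTop) {φ : 𝔼 → ℝ} (hφ : MemCOneZero φ) {x₀ : 𝔼} (hx₀ : x₀ ∈ Ω)
    (heq : φ x₀ = w x₀) (hle : ∀ x, φ x ≤ w x) {a b₀ b : ℝ} (hb₀ : 0 ≤ b₀)
    (hb : b₀ < b) (hba : b < a) (hφb : ∀ z, -(φ (x₀ + z) - φ x₀) ≤ b₀ * ‖z‖ ^ α)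
    {z₁ : 𝔼} (hz₁ : z₁ ≠ 0) (hφa : a * ‖z₁‖ ^ α < φ (x₀ + z₁) - φ x₀)
    {r₀ : ℝ} (hr₀ : 0 < r₀) {C₀ : ℝ}
    (hl : ∀ᶠ k in atTop, ∀ x ∈ Metric.ball x₀ r₀,
      -(C₀ * b ^ p k) ≤ lam k * oddPow (p k) (u k x)) : False := by
  have hbpos : 0 < b := hb₀.trans_lt hb
  have ha : 0 < a := hbpos.trans hba
  have hz0 : 0 < ‖z₁‖ := norm_pos_iff.2 hz₁
  obtain ⟨ρ, τ, s, hρ, hτ, hs, hst⟩ := exists_stable_lower_bound hα₀ hφ.1.continuous hφa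
  set s' := min s (‖z₁‖ / 2) with hs'
  have hs'0 : 0 < s' := by positivity
  have hnorm : ∀ z ∈ Metric.ball z₁ s', ‖z₁‖ / 2 ≤ ‖z‖ ∧ ‖z‖ ≤ 2 * ‖z₁‖ := fun z hz => by
    rw [mem_ball_iff_norm] at hz
    have h1 := hz.trans_le (min_le_right _ _)
    have h2 := norm_sub_norm_le z z₁
    have h3 := norm_sub_norm_le z₁ z
    rw [norm_sub_rev] at h3
    constructor <;> linarith
  obtain ⟨C, hC⟩ := eventually_growth_le_of_touching hn hα₀ hα₁ hΩ hΩb hp hp₂ hlam hu huw hφ hx₀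
    heq hle ha hb₀ hb hφb measurableSet_ball (half_pos hz0) (fun z hz => (hnorm z hz).1)
    (fun z hz => (hnorm z hz).2)
    ⟨ρ, τ, hρ, hτ, fun Φ hΦ x hx z hz => hst Φ hΦ x hx z
      (Metric.ball_subset_ball (min_le_left _ _) hz)⟩ hr₀ hl
  set c := (volume (Metric.ball z₁ s')).toReal / (a * (2 * ‖z₁‖) ^ α) with hc
  have hc0 : 0 < c := by
    have : 0 < (volume (Metric.ball z₁ s')).toReal :=
      ENNReal.toReal_pos (Metric.measure_ball_pos _ _ hs'0).ne' measure_ball_lt_top.ne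
    positivity
  obtain ⟨k, hk1, hk2, hk3⟩ := (hC.and ((hp.eventually
    (eventually_mul_rpow_lt_rpow hbpos.le hba ((C + |C₀|) / c))).and
      (hp.eventually (eventually_ge_atTop 1)))).exists
  have hbp : 0 < b ^ p k := by positivity
  have h1 : C₀ * b ^ p k ≤ |C₀| * (p k * b ^ p k) := by
    have h2 : b ^ p k ≤ p k * b ^ p k := by nlinarith
    calc C₀ * b ^ p k ≤ |C₀| * b ^ p k := by gcongr; exact le_abs_self _
      _ ≤ _ := by gcongr
  have h3 : c * a ^ p k ≤ (C + |C₀|) * (p k * b ^ p k) := by linarith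
  rw [div_mul_eq_mul_div, div_lt_iff₀ hc0] at hk2
  linarith

/-! ### The viscosity inequalities for the limit -/

lemma holder_quotient_bounds {α : ℝ} (hα₀ : 0 < α) (hα₁ : α ≤ 1) {φ : 𝔼 → ℝ} (hφ : MemCOneZero φ)
    (x₀ : 𝔼) :
    (BddAbove (range fun y : {y : 𝔼 // y ≠ x₀} => (φ y - φ x₀) / ‖(y : 𝔼) - x₀‖ ^ α)) ∧
    BddBelow (range fun y : {y : 𝔼 // y ≠ x₀} => (φ y - φ x₀) / ‖(y : 𝔼) - x₀‖ ^ α) := by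
  obtain ⟨L, hL⟩ := hφ.exists_lipschitz
  obtain ⟨H, -, hH, -⟩ := exists_holder_of_lipschitz hα₀ hα₁ hL hφ.2
  have key : ∀ y : {y : 𝔼 // y ≠ x₀}, |(φ y - φ x₀) / ‖(y : 𝔼) - x₀‖ ^ α| ≤ H := fun y => by
    have : 0 < ‖(y : 𝔼) - x₀‖ ^ α := Real.rpow_pos_of_pos (norm_pos_iff.2 (sub_ne_zero.2 y.2)) _
    rw [abs_div, abs_of_pos this, div_le_iff₀ this]
    exact hH x₀ y
  constructor
  · refine ⟨H, ?_⟩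
    rintro _ ⟨y, rfl⟩
    exact (abs_le.1 (key y)).2
  · refine ⟨-H, ?_⟩
    rintro _ ⟨y, rfl⟩
    exact (abs_le.1 (key y)).1

lemma sub_le_holderSup_mul {α : ℝ} (hα₀ : 0 < α) (hα₁ : α ≤ 1) {φ : 𝔼 → ℝ} (hφ : MemCOneZero φ)
    (x₀ z : 𝔼) : φ (x₀ + z) - φ x₀ ≤ holderSup α φ x₀ * ‖z‖ ^ α := by
  by_cases hz : z = 0
  · simp [hz, hα₀.ne']
  · have hpos : 0 < ‖z‖ ^ α := Real.rpow_pos_of_pos (norm_pos_iff.2 hz) _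
    have h := le_ciSup (holder_quotient_bounds hα₀ hα₁ hφ x₀).1 ⟨x₀ + z, by simpa using hz⟩
    simp only [add_sub_cancel_left] at h
    rwa [div_le_iff₀ hpos] at h

lemma holderInf_mul_le_sub {α : ℝ} (hα₀ : 0 < α) (hα₁ : α ≤ 1) {φ : 𝔼 → ℝ} (hφ : MemCOneZero φ)
    (x₀ z : 𝔼) : holderInf α φ x₀ * ‖z‖ ^ α ≤ φ (x₀ + z) - φ x₀ := by
  by_cases hz : z = 0
  · simp [hz, hα₀.ne']
  · have hpos : 0 < ‖z‖ ^ α := Real.rpow_pos_of_pos (norm_pos_iff.2 hz) _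
    have h := ciInf_le (holder_quotient_bounds hα₀ hα₁ hφ x₀).2 ⟨x₀ + z, by simpa using hz⟩
    simp only [add_sub_cancel_left] at h
    rwa [le_div_iff₀ hpos] at h

lemma nonempty_ne (hn : 1 ≤ n) (x₀ : 𝔼) : Nonempty {y : 𝔼 // y ≠ x₀} := by
  have : Nonempty (Fin n) := ⟨⟨0, hn⟩⟩
  obtain ⟨y, hy⟩ := exists_ne x₀
  exact ⟨⟨y, hy⟩⟩

lemma exists_of_lt_holderSup (hn : 1 ≤ n) {α a : ℝ} {φ : 𝔼 → ℝ} {x₀ : 𝔼}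
    (h : a < holderSup α φ x₀) : ∃ z, z ≠ 0 ∧ a * ‖z‖ ^ α < φ (x₀ + z) - φ x₀ := by
  have := nonempty_ne hn x₀
  obtain ⟨y, hy⟩ := exists_lt_of_lt_ciSup h
  refine ⟨y - x₀, sub_ne_zero.2 y.2, ?_⟩
  rw [lt_div_iff₀ (Real.rpow_pos_of_pos (norm_pos_iff.2 (sub_ne_zero.2 y.2)) _)] at hy
  rwa [add_sub_cancel]

lemma exists_of_holderInf_lt (hn : 1 ≤ n) {α a : ℝ} {φ : 𝔼 → ℝ} {x₀ : 𝔼}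
    (h : holderInf α φ x₀ < a) : ∃ z, z ≠ 0 ∧ φ (x₀ + z) - φ x₀ < a * ‖z‖ ^ α := by
  have := nonempty_ne hn x₀
  obtain ⟨y, hy⟩ := exists_lt_of_ciInf_lt h
  refine ⟨y - x₀, sub_ne_zero.2 y.2, ?_⟩
  rw [div_lt_iff₀ (Real.rpow_pos_of_pos (norm_pos_iff.2 (sub_ne_zero.2 y.2)) _)] at hy
  rwa [add_sub_cancel]

/-- Each strict violation leaves room for a base larger than some b > -L⁻φ(x₀): one from a large
increment of φ in the first inequality, one from the eigenvalue term in the second. -/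
lemma isViscositySupersolution_of_tendsto (hn : 1 ≤ n) {α : ℝ} (hα₀ : 0 < α) (hα₁ : α ≤ 1)
    {Ω : Set 𝔼} (hΩ : IsOpen Ω) (hΩb : Bornology.IsBounded Ω) {p lam : ℕ → ℝ}
    (hp : Tendsto p atTop atTop) (hp₂ : ∀ k, 2 * (n : ℝ) < α * p k) (hlam : ∀ k, 0 ≤ lam k)
    {u : ℕ → 𝔼 → ℝ} {w : 𝔼 → ℝ} (hu : ∀ k, IsRayleighMinimizer Ω α (p k) (lam k) (u k))
    (hu0 : ∀ k x, 0 ≤ u k x) (huw : TendstoUniformly u w atTop) (hw : MemCZeroClosure Ω w)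
    {Λ : ℝ} (hΛ : 0 < Λ)
    (hlow : ∀ d, 0 < d → d < Λ → ∃ c, 0 < c ∧ ∀ᶠ k in atTop, c * d ^ p k ≤ lam k) :
    IsViscositySupersolution Ω α Λ w := by
  have hw0 : ∀ x, 0 ≤ w x := fun x =>
    ge_of_tendsto (huw.tendsto_at x) (Eventually.of_forall fun k => hu0 k x)
  have hp1 : ∀ᶠ k in atTop, 1 < p k := hp.eventually (eventually_gt_atTop 1)
  refine ⟨⟨hw.1, hw.hasCompactSupport hΩb⟩, hw0, fun x₀ hx₀ φ hφ heq hle => ?_⟩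
  have hφb : ∀ z, -(φ (x₀ + z) - φ x₀) ≤ -holderInf α φ x₀ * ‖z‖ ^ α := fun z => by
    have := holderInf_mul_le_sub hα₀ hα₁ hφ x₀ z
    linarith
  -- At a point outside Ω, φ ≤ 0 ≤ φ(x₀), so some increment is nonpositive.
  have hb₀ : 0 ≤ -holderInf α φ x₀ := by
    obtain ⟨y, hy⟩ := nonempty_compl_of_isBounded hn hΩb
    have hyx : y - x₀ ≠ 0 := sub_ne_zero.2 fun h => hy (h ▸ hx₀)
    have h1 := holderInf_mul_le_sub hα₀ hα₁ hφ x₀ (y - x₀)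
    rw [add_sub_cancel] at h1
    have h2 := hle y
    rw [hw.2 y hy] at h2
    have h3 := hw0 x₀
    rw [← heq] at h3
    have hpos : 0 < ‖y - x₀‖ ^ α := Real.rpow_pos_of_pos (norm_pos_iff.2 hyx) _
    by_contra hcon
    have := mul_pos (show 0 < holderInf α φ x₀ by linarith) hpos
    linarith
  constructor
  · by_contra! hcon
    rw [holderInfinityLaplacian] at hcon
    obtain ⟨a, hba, ha⟩ := exists_between (show -holderInf α φ x₀ < holderSup α φ x₀ by linarith)
    obtain ⟨b, hb, hba⟩ := exists_between hba
    obtain ⟨z, hz, hza⟩ := exists_of_lt_holderSup hn ha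
    refine false_of_touching_of_lt hn hα₀ hα₁ hΩ hΩb hp hp₂ hlam hu huw hφ hx₀ heq hle hb₀ hb hba
      hφb hz hza one_pos (C₀ := 0) ?_
    filter_upwards [hp1] with k hk x _
    rw [zero_mul, neg_zero]
    refine mul_nonneg (hlam k) ?_
    rw [oddPow_of_nonneg hk (hu0 k x)]
    exact Real.rpow_nonneg (hu0 k x) _
  · by_contra! hcon
    obtain ⟨t, ht1, ht2⟩ := exists_between (show -holderInf α φ x₀ < Λ * φ x₀ by linarith)
    obtain ⟨b, hb, hbt⟩ := exists_between ht1
    have ht0 : 0 < t := hb₀.trans_lt ht1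
    have hμ : 0 < φ x₀ := by
      have : 0 < Λ * φ x₀ := ht0.trans ht2
      exact pos_of_mul_pos_right this hΛ.le
    -- The gap between t and Λφ(x₀) is shared equally: Λs is below the growth rate of λ_k, m =
    -- φ(x₀)s is below u_k near x₀ for large k, and their product is t.
    set s := √(t / (Λ * φ x₀)) with hs
    have hs0 : 0 < s := by positivity
    have hs1 : s < 1 := by
      rw [hs, Real.sqrt_lt' one_pos, one_pow, div_lt_one (by positivity)]
      exact ht2
    have hss : s * s = t / (Λ * φ x₀) := Real.mul_self_sqrt (by positivity)
    obtain ⟨c, hc, hck⟩ := hlow (Λ * s) (by positivity) (by nlinarith)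
    set m := φ x₀ * s with hm
    have hm0 : 0 < m := by positivity
    have hmw : m < w x₀ := by rw [← heq, hm]; nlinarith
    have hdm : Λ * s * m = t := by
      calc Λ * s * m = (Λ * φ x₀) * (s * s) := by rw [hm]; ring
        _ = t := by rw [hss]; field_simp
    obtain ⟨r, hr, hrw⟩ := Metric.continuousAt_iff.1 (hw.1.continuousAt (x := x₀))
      ((w x₀ - m) / 2) (by linarith)
    -- No set of large increments is needed, so G = ∅: the eigenvalue term alone provides the base t
    -- > b.
    obtain ⟨C, hC⟩ := eventually_growth_le_of_touching hn hα₀ hα₁ hΩ hΩb hp hp₂ hlam hu huw hφ hx₀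
      heq hle one_pos hb₀ hb hφb (G := ∅) (D := 1) MeasurableSet.empty one_pos (by simp) (by simp)
      ⟨1, 1, one_pos, one_pos, by simp⟩ hr (l := fun k => c / m * t ^ p k) (by
        filter_upwards [hck, hp1, Metric.tendstoUniformly_iff.1 huw ((w x₀ - m) / 2) (by linarith)]
          with k hk1 hk2 hk3 x hx
        have h1 := hrw hx
        have h2 := hk3 x
        rw [Real.dist_eq] at h1 h2
        have h3 := (abs_lt.1 h1).1
        have h4 := (abs_lt.1 h2).2
        have h5 : m ≤ u k x := by linarith
        rw [oddPow_of_nonneg hk2 (hu0 k x)]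
        calc c / m * t ^ p k = c * (Λ * s) ^ p k * m ^ (p k - 1) := by
              rw [← hdm, Real.mul_rpow (by positivity) hm0.le, Real.rpow_sub_one hm0.ne']
              field_simp
          _ ≤ _ := by
              gcongr
              · exact hlam k)
    simp only [measure_empty, ENNReal.toReal_zero, zero_div, zero_mul, add_zero] at hC
    obtain ⟨k, hk1, hk2⟩ := (hC.and (hp.eventually
      (eventually_mul_rpow_lt_rpow (hb₀.trans hb.le) hbt (C / (c / m))))).exists
    rw [div_mul_eq_mul_div, div_lt_iff₀ (by positivity)] at hk2
    linarith

/-- The comparison is applied to -u_k and -ψ. The eigenvalue term is now negative, but its base is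
below b once b > Λψ(x₀), so it is harmless against a large increment of -ψ. -/
lemma isViscositySubsolution_of_tendsto (hn : 1 ≤ n) {α : ℝ} (hα₀ : 0 < α) (hα₁ : α ≤ 1)
    {Ω : Set 𝔼} (hΩ : IsOpen Ω) (hΩb : Bornology.IsBounded Ω) {p lam : ℕ → ℝ}
    (hp : Tendsto p atTop atTop) (hp₂ : ∀ k, 2 * (n : ℝ) < α * p k) (hlam : ∀ k, 0 ≤ lam k)
    {u : ℕ → 𝔼 → ℝ} {w : 𝔼 → ℝ} (hu : ∀ k, IsRayleighMinimizer Ω α (p k) (lam k) (u k))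
    (hu0 : ∀ k x, 0 ≤ u k x) (huw : TendstoUniformly u w atTop) (hw : MemCZeroClosure Ω w)
    {Λ : ℝ} (hΛ : 0 < Λ)
    (hup : ∀ d, Λ < d → ∃ C, 0 < C ∧ ∀ᶠ k in atTop, lam k ≤ C * d ^ p k) :
    IsViscositySubsolution Ω α Λ w := by
  have hw0 : ∀ x, 0 ≤ w x := fun x =>
    ge_of_tendsto (huw.tendsto_at x) (Eventually.of_forall fun k => hu0 k x)
  have hp1 : ∀ᶠ k in atTop, 1 < p k := hp.eventually (eventually_gt_atTop 1)
  refine ⟨⟨hw.1, hw.hasCompactSupport hΩb⟩, fun x₀ hx₀ ψ hψ heq hle => ?_⟩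
  by_contra! hcon
  obtain ⟨hcon1, hcon2⟩ := hcon
  rw [holderInfinityLaplacian] at hcon1
  have hμ0 : 0 ≤ ψ x₀ := heq ▸ hw0 x₀
  have hΛμ : 0 ≤ Λ * ψ x₀ := by positivity
  -- b has to dominate the decrements of -ψ, that is L⁺ψ(x₀), as well as the base of the eigenvalue
  -- term. The 0 in the maximum allows for a negative L⁺ψ(x₀).
  obtain ⟨a, hba, ha⟩ := exists_between (show max (max 0 (holderSup α ψ x₀)) (Λ * ψ x₀) <
    -holderInf α ψ x₀ from max_lt (max_lt (by linarith) (by linarith)) (by linarith))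
  obtain ⟨b, hb, hba⟩ := exists_between hba
  have hbsup := (le_max_left _ _).trans_lt hb
  have hbΛ := (le_max_right _ _).trans_lt hb
  have hb0 : 0 < b := hΛμ.trans_lt hbΛ
  obtain ⟨z, hz, hza⟩ := exists_of_holderInf_lt hn (show holderInf α ψ x₀ < -a by linarith)
  have hφ : MemCOneZero (-ψ) := ⟨hψ.1.neg, hψ.2.neg⟩
  have huw' : TendstoUniformly (fun k => -u k) (-w) atTop := by
    rw [Metric.tendstoUniformly_iff] at huw ⊢
    intro ε hε
    filter_upwards [huw ε hε] with k hk x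
    simpa using hk x
  obtain ⟨s, hs0, hs⟩ : ∃ s : ℝ, 0 < s ∧ (Λ + s) * (ψ x₀ + s) < b := by
    have hlim : Tendsto (fun s : ℝ => (Λ + s) * (ψ x₀ + s)) (𝓝[>] 0) (𝓝 (Λ * ψ x₀)) := by
      have : Tendsto (fun s : ℝ => (Λ + s) * (ψ x₀ + s)) (𝓝 0) (𝓝 ((Λ + 0) * (ψ x₀ + 0))) :=
        (tendsto_id.const_add Λ).mul (tendsto_id.const_add _)
      rw [add_zero, add_zero] at this
      exact this.mono_left nhdsWithin_le_nhds
    obtain ⟨s, h1, h2⟩ := ((hlim.eventually (gt_mem_nhds hbΛ)).and self_mem_nhdsWithin).exists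
    exact ⟨s, h2, h1⟩
  obtain ⟨C, hC, hCk⟩ := hup (Λ + s) (by linarith)
  set m := ψ x₀ + s with hm
  have hm0 : 0 < m := by positivity
  obtain ⟨r, hr, hrw⟩ := Metric.continuousAt_iff.1 (hw.1.continuousAt (x := x₀)) (s / 2)
    (by positivity)
  refine false_of_touching_of_lt hn hα₀ hα₁ hΩ hΩb hp hp₂ hlam (fun k => (hu k).neg) huw' hφ hx₀
    (by simp [heq]) (fun x => by simpa using hle x) (le_max_left 0 (holderSup α ψ x₀)) hbsup hba
    (fun z => ?_) hz ?_ hr (C₀ := C / m) ?_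
  · have h1 := sub_le_holderSup_mul hα₀ hα₁ hψ x₀ z
    have h2 : holderSup α ψ x₀ * ‖z‖ ^ α ≤ max 0 (holderSup α ψ x₀) * ‖z‖ ^ α := by
      gcongr
      exact le_max_right _ _
    simp only [Pi.neg_apply]
    linarith
  · simp only [Pi.neg_apply]
    linarith
  · filter_upwards [hCk, hp1, Metric.tendstoUniformly_iff.1 huw (s / 2) (by linarith)]
      with k hk1 hk2 hk3 x hx
    have h1 := hrw hx
    have h2 := hk3 x
    rw [Real.dist_eq] at h1 h2
    have h3 := (abs_lt.1 h1).2
    have h4 := (abs_lt.1 h2).1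
    have h5 : u k x ≤ m := by linarith
    rw [Pi.neg_apply, oddPow_neg, oddPow_of_nonneg hk2 (hu0 k x), mul_neg]
    refine neg_le_neg ?_
    have hux := hu0 k x
    calc lam k * u k x ^ (p k - 1) ≤ C * (Λ + s) ^ p k * m ^ (p k - 1) := by
          have : 0 ≤ p k - 1 := by linarith
          gcongr
      _ = C / m * ((Λ + s) * m) ^ p k := by
          rw [Real.mul_rpow (by positivity) hm0.le, Real.rpow_sub_one hm0.ne']
          field_simp
      _ ≤ C / m * b ^ p k := by
          have : 0 ≤ p k := by linarith
          gcongr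

/-! ### Uniform Hölder bounds and conclusion -/

/-- Normalized minimizers are equi-Hölder continuous and uniformly bounded for large exponents. -/
lemma exists_uniform_holder_bounds (hn : 1 ≤ n) {α : ℝ} (hα₀ : 0 < α) (hα₁ : α ≤ 1)
    {Ω : Set 𝔼} (hΩ : IsOpen Ω) (hne : Ω.Nonempty) (hb : Bornology.IsBounded Ω) :
    ∃ M A : ℝ, ∀ p : ℝ, 4 * (n : ℝ) ≤ α * p → ∀ v : 𝔼 → ℝ, MemCZeroClosure Ω v →
      gagliardoEnergy univ p (α * p) v = firstEigenvalue Ω α p →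
      (∀ x, |v x| ≤ M) ∧ ∀ x y, ‖y - x‖ ≤ 1 → |v y - v x| ≤ A * ‖y - x‖ ^ (α / 2) := by
  have hn' : (1 : ℝ) ≤ n := by exact_mod_cast hn
  obtain ⟨C, hC, hCp⟩ := exists_firstEigenvalue_le hn hΩ hne hb hα₀ hα₁
    (lt_add_one (infinityEigenvalue Ω α))
  have hR := inradius_pos hn hΩ hne hb
  have hΛ : 0 < infinityEigenvalue Ω α := by unfold infinityEigenvalue; positivity
  set d := infinityEigenvalue Ω α + 1 with hd
  -- C·d^p ≤ e^p for p ≥ 1, so the energy bound has the form needed in Morrey's inequality with e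
  -- independent of p.
  set e := max 1 C * d with he
  have he0 : 0 ≤ e := by positivity
  set A := morreyConst n α (α / 2) * e with hA
  have hA0 : 0 ≤ A := mul_nonneg (morreyConst_pos _ _ _).le he0
  obtain ⟨z, hz⟩ := nonempty_compl_of_isBounded hn hb
  obtain ⟨D₁, hD₁⟩ := hb.subset_closedBall z
  set D := max D₁ 1 with hD
  refine ⟨A * D, A, fun p hp v hv hE => ?_⟩
  have hp0 : 0 < p := by
    by_contra h
    have := mul_nonpos_of_nonneg_of_nonpos hα₀.le (not_lt.1 h)
    linarith
  have hp1 : 1 < p := by nlinarith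
  set β := α - 2 * n / p with hβ
  have hβp : β * p = α * p - 2 * n := by rw [hβ]; field_simp
  -- The assumption 4n ≤ αp gives exactly this; the Morrey exponent then has a fixed lower bound.
  have hβα : α / 2 ≤ β := by
    have : 2 * n / p ≤ α / 2 := by
      rw [div_le_div_iff₀ hp0 two_pos]; linarith
    linarith
  have hβ0 : 0 < β := by linarith
  have hβ1 : β ≤ 1 := by
    have : 0 ≤ 2 * n / p := by positivity
    linarith
  have hEle : gagliardoEnergy univ p (α * p) v ≤ ENNReal.ofReal (e ^ p) := by
    rw [hE]
    refine (hCp p hp1 (by linarith)).trans (ENNReal.ofReal_le_ofReal ?_)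
    rw [he, Real.mul_rpow (by positivity) (by positivity)]
    gcongr
    calc C ≤ max 1 C := le_max_right _ _
      _ = max 1 C ^ (1 : ℝ) := (Real.rpow_one _).symm
      _ ≤ max 1 C ^ p := Real.rpow_le_rpow_of_exponent_le (le_max_left _ _) hp1.le
  have hmor : ∀ x y, |v y - v x| ≤ A * ‖y - x‖ ^ β := fun x y => by
    refine (morrey_whole_space hα₀ hp1 hβ0 hβ1 hβp hv.1 (hv.hasCompactSupport hb) he0 hEle
      x y).trans ?_
    have := morreyConst_anti n (α := α) (show 0 < α / 2 by positivity) hβα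
    rw [hA]
    gcongr
  constructor
  · intro x
    by_cases hx : x ∈ Ω
    · have h1 := hmor z x
      rw [hv.2 z hz, sub_zero] at h1
      refine h1.trans ?_
      have hD1 : 1 ≤ D := le_max_right _ _
      have hxD : ‖x - z‖ ≤ D := by
        rw [← dist_eq_norm]; exact (hD₁ hx).trans (le_max_left _ _)
      gcongr
      calc ‖x - z‖ ^ β ≤ D ^ β := by gcongr
        _ ≤ D ^ (1 : ℝ) := Real.rpow_le_rpow_of_exponent_le hD1 hβ1
        _ = D := Real.rpow_one D
    · rw [hv.2 x hx, abs_zero]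
      positivity
  · intro x y hxy
    refine (hmor x y).trans (mul_le_mul_of_nonneg_left ?_ hA0)
    rcases (norm_nonneg (y - x)).eq_or_lt with h0 | h0
    · rw [← h0, Real.zero_rpow hβ0.ne', Real.zero_rpow (by positivity)]
    · exact Real.rpow_le_rpow_of_exponent_ge h0 hxy hβα

end FractionalEigenvalue

theorem mainTheorem2 (n : ℕ) (hn : 1 ≤ n) (α : ℝ) (hα₀ : 0 < α) (hα₁ : α ≤ 1)
    (Ω : Set (EuclideanSpace ℝ (Fin n))) (hΩo : IsOpen Ω) (hΩc : IsConnected Ω)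
    (hΩb : Bornology.IsBounded Ω)
    (p : ℕ → ℝ) (hp : Tendsto p atTop atTop) (hp₂ : ∀ k, 2 * (n : ℝ) < α * p k)
    (u : ℕ → EuclideanSpace ℝ (Fin n) → ℝ)
    (hu : ∀ k, IsFirstEigenfunction Ω α (p k) (u k))
    (hnorm : ∀ k, eLpNorm (u k) (ENNReal.ofReal (p k)) volume = 1) :
    ∃ v : ℕ → EuclideanSpace ℝ (Fin n) → ℝ,
      (∀ k, MemCZeroClosure Ω (v k) ∧ v k =ᵐ[volume] u k) ∧
      ∃ (j : ℕ → ℕ) (w : EuclideanSpace ℝ (Fin n) → ℝ), StrictMono j ∧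
        MemCZeroClosure Ω w ∧
        TendstoUniformlyOn (fun k => v (j k)) w atTop Ω ∧
        IsViscositySolution Ω α (infinityEigenvalue Ω α) w := by
  have hne : Ω.Nonempty := hΩc.nonempty
  have hn' : (1 : ℝ) ≤ n := by exact_mod_cast hn
  have hp1 : ∀ k, 1 < p k := fun k => by
    have h := hp₂ k
    have h0 : 0 < p k := by
      by_contra h0
      have := mul_nonpos_of_nonneg_of_nonpos hα₀.le (not_lt.1 h0)
      linarith
    nlinarith
  choose v hvC hvu hv0 hvP hvE using fun k =>
    (hu k).exists_representative hn hΩo hne hΩb hα₀ hα₁ (hp₂ k) (hnorm k)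
  refine ⟨v, fun k => ⟨hvC k, hvu k⟩, ?_⟩
  set lam : ℕ → ℝ := fun k => (firstEigenvalue Ω α (p k)).toReal with hlam
  have hfin : ∀ k, firstEigenvalue Ω α (p k) ≠ ∞ := fun k =>
    firstEigenvalue_ne_top hn hα₀ hα₁ (by linarith [hp1 k]) (hp₂ k).le hΩo hne
  have hlam' : ∀ k, ENNReal.ofReal (lam k) = firstEigenvalue Ω α (p k) := fun k =>
    ENNReal.ofReal_toReal (hfin k)
  have hmin : ∀ k, IsRayleighMinimizer Ω α (p k) (lam k) (v k) := fun k =>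
    ⟨hvC k, by rw [hlam', hvE, hvP, mul_one], fun f hf => by
      rw [hlam']; exact firstEigenvalue_mul_le (hp1 k) hΩo hΩb (hfin k) hf⟩
  obtain ⟨M, A, hMA⟩ := exists_uniform_holder_bounds hn hα₀ hα₁ hΩo hne hΩb
  -- Only αp > 2n is assumed for every k. The uniform bounds need αp ≥ 4n, so the first k₀ terms are
  -- dropped and the indices shifted back in j.
  obtain ⟨k₀, hk₀⟩ := eventually_atTop.1
    ((hp.const_mul_atTop hα₀).eventually (eventually_ge_atTop (4 * (n : ℝ))))
  have hMA' := fun k => hMA (p (k + k₀)) (hk₀ _ (Nat.le_add_left _ _)) _ (hvC _) (hvE _)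
  obtain ⟨i, w, hi, hiw⟩ := exists_subseq_tendstoUniformly hΩb.isCompact_closure
    (f := fun k => v (k + k₀)) (fun k => (hvC _).1)
    (fun k x hx => (hvC _).2 x fun h => hx (subset_closure h)) (half_pos hα₀)
    (fun k => (hMA' k).1) (fun k => (hMA' k).2)
  set j : ℕ → ℕ := fun k => i k + k₀ with hj
  have hjm : StrictMono j := hi.add_const k₀
  have hw : MemCZeroClosure Ω w :=
    ⟨hiw.continuous (Frequently.of_forall fun k => (hvC _).1), fun x hx =>
      tendsto_nhds_unique (hiw.tendsto_at x) (by simp [(hvC _).2 x hx])⟩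
  have hpj : Tendsto (fun k => p (j k)) atTop atTop := hp.comp hjm.tendsto_atTop
  have hR := inradius_pos hn hΩo hne hΩb
  have hΛ : 0 < infinityEigenvalue Ω α := by unfold infinityEigenvalue; positivity
  refine ⟨j, w, hjm, hw, hiw.tendstoUniformlyOn, ?_, ?_⟩
  · refine isViscositySupersolution_of_tendsto hn hα₀ hα₁ hΩo hΩb hpj (fun k => hp₂ (j k))
      (fun k => ENNReal.toReal_nonneg) (fun k => hmin (j k)) (fun k => hv0 (j k)) hiw hw hΛ
      fun d hd0 hd => ?_
    obtain ⟨c, hc, hck⟩ := exists_le_gagliardoEnergy hn hΩo hΩb hα₀ hw hiw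
      (exists_one_le_of_tendstoUniformly hΩo hΩb hpj (fun k => hvC _) (fun k => hv0 _)
        (fun k => hvP _) hw hiw) hd0 hd
    refine ⟨c, hc, ?_⟩
    filter_upwards [hck] with k hk
    have := hk (p (j k)) (by linarith [hp1 (j k)])
    rw [hvE, ← hlam'] at this
    exact (ENNReal.ofReal_le_ofReal_iff ENNReal.toReal_nonneg).1 this
  · refine isViscositySubsolution_of_tendsto hn hα₀ hα₁ hΩo hΩb hpj (fun k => hp₂ (j k))
      (fun k => ENNReal.toReal_nonneg) (fun k => hmin (j k)) (fun k => hv0 (j k)) hiw hw hΛ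
      fun d hd => ?_
    obtain ⟨C, hC, hCp⟩ := exists_firstEigenvalue_le hn hΩo hne hΩb hα₀ hα₁ hd
    refine ⟨C, hC, Eventually.of_forall fun k => ?_⟩
    have := hCp (p (j k)) (hp1 _) (hp₂ _)
    have hd0 : 0 < d := hΛ.trans hd
    rw [← hlam'] at this
    exact (ENNReal.ofReal_le_ofReal_iff (by positivity)).1 this
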